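/- Let $V$ be a finite-dimensional complex vector space with a nondegenerate symmetric bilinear form $\langle\cdot|\cdot\rangle$. A finite set $\Delta\subset V\setminus\{0\}$ is a \emph{weak generalized root system} if (1) $\Delta=-\Delta$; (2) for $\alpha,\beta\in\Delta$ with $\langle\alpha|\alpha\rangle\neq0$ one has $k=\frac{2\langle\alpha|\beta\rangle}{\langle\alpha|\alpha\rangle}\in\mathbb Z$ and $\beta-k\alpha\in\Delta$; (3) for $\alpha,\beta\in\Delta$ with $\langle\alpha|\alpha\rangle=0$ and $\langle\alpha|\beta\rangle\ne0$ at least one of $\beta\pm\alpha$ is in $\Delta$. The Weyl group $W$ of $\Delta$ is generated by the reflections $s_\alpha(v)=v-\frac{2\langle\alpha|v\rangle}{\langle\alpha|\alpha\rangle}\alpha$ for $\alpha\in\Delta$, $\langle\alpha|\alpha\rangle\ne0$. Let $R=R_\Delta$ be the equivalence relation on $V$ generated by $v\sim wv$ ($w\in W$) and $v\sim v+c\alpha$ ($\alpha\in\Delta$, $\langle\alpha|\alpha\rangle=0$, $\langle v|\alpha\rangle=0$, $c\in\mathbb C$). A \emph{linear Lagrangian relation} on $V$ is a subspace $L\subset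 V\times V$ of dimension $\dim V$ on which the form $\langle v|v'\rangle-\langle w|w'\rangle$ (for $(v,w),(v',w')\in L$) vanishes. A \emph{Lagrangian equivalence relation} is an equivalence relation that is a union of linear Lagrangian relations. In what follows, the \emph{components} of $R$ are the linear Lagrangian relations contained in $R$ (if $R$ is a finite union of linear Lagrangian relations, they are the members of that union). The projections $p_1(L)\subset V$ of the components are the \emph{special coisotropic subspaces} of $R$, the \emph{discriminant} of $R$ is the union of the proper ones, and the Weyl group of $R$ consists of the automorphisms of $V$ whose graph is a component of $R$. $R$ is \emph{$1$-regular} if it is a Lagrangian equivalence relation with finitely many components whose discriminant is either empty or the union of the translates, under the Weyl group of $R$, of one special coisotropic subspace of codimension $1$. $R$ is \emph{$1$-semiregular} if there is an orthogonal direct sum decomposition $V=V^1\oplus\dots\oplus V^k$ such that $R$ is a product $R^1\times\dots\times R^k$ of $1$-regular Lagrangian equivalence relations $R^i$ on $V^i$. A Lagrangian equivalence relation $R$ is \emph{semiregular} if for each special coisotropic subspace $V_0$ of $R$ the relation induced by $R$ on $V_0/V_0^\perp$ is $1$-semiregular. Let $\mathbb C[V]^R$ be the ring of polynomial functions $f$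 on $V$ such that $f(x)=f(y)$ for all $(x,y)\in R$. An equivalence relation $R$ is \emph{detectable} if the set of common zeros of each maximal ideal of $\mathbb C[V]^R$ is an equivalence class of $R$. \textbf{Theorem.} Let $\Delta\subset V$ be a finite weak generalized root system and $R=R_\Delta$. (a) $R$ is a Lagrangian equivalence relation with finitely many components. (b) Suppose that the indecomposable components of $\Delta$ are orthogonally separated in $V$: there is an orthogonal direct sum decomposition $V=E_1\oplus\dots\oplus E_k$ such that $\Delta=\bigcup_i(\Delta\cap E_i)$ and no $\Delta\cap E_i$ is a disjoint union of two non-empty mutually orthogonal symmetric subsets. (For $k=1$ this says that $\Delta$ is indecomposable.) Then $R$ is semiregular. (c) $R$ is detectable. (d) Consequently the two assertions of Musson's theorem hold for $Z=\mathbb C[V]^R$. Writing $\mathfrak m_\lambda$ for the ideal of the polynomials vanishing at $\lambda\in V$: every maximal ideal of $Z$ has the form $Z\cap\mathfrak m_\lambda$ for some $\lambda\in V$; and $Z\cap\mathfrak m_\lambda=Z\cap\mathfrak m_\mu$ if and only if $(\lambda,\mu)\in R$. -/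

import Mathlib

namespace LagrangianRelations

universe u

section Linear

variable {V : Type u} [AddCommGroup V] [Module ℂ V]

/-- A linear Lagrangian relation on `(V, B)`: a subspace `L` of `V × V` that is isotropic for the
form `B v v' - B w w'` and has dimension `dim V`. -/
def IsLinearLagrangian (B : LinearMap.BilinForm ℂ V) (L : Submodule ℂ (V × V)) : Prop :=
  (∀ p ∈ L, ∀ q ∈ L, B p.1 q.1 - B p.2 q.2 = 0) ∧
    Module.finrank ℂ L = Module.finrank ℂ V

/-- The linear Lagrangian relations contained in `R`. When `R` is a finite union of linear
Lagrangian relations, these are exactly the members of the union, because a complex vector space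
is not a finite union of proper subspaces and all linear Lagrangian relations have dimension
`dim V`. -/
def components (B : LinearMap.BilinForm ℂ V) (R : V → V → Prop) :
    Set (Submodule ℂ (V × V)) :=
  {L | IsLinearLagrangian B L ∧ ∀ p ∈ L, R p.1 p.2}

/-- A Lagrangian equivalence relation: an equivalence relation that is a union of linear
Lagrangian relations. -/
def IsLagrangianEquivalence (B : LinearMap.BilinForm ℂ V) (R : V → V → Prop) : Prop :=
  Equivalence R ∧ ∃ A : Set (Submodule ℂ (V × V)),
    (∀ L ∈ A, IsLinearLagrangian B L) ∧ ∀ x y : V, R x y ↔ ∃ L ∈ A, (x, y) ∈ L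

/-- The image of a linear relation under the first projection. -/
def firstProj (L : Submodule ℂ (V × V)) : Submodule ℂ V :=
  L.map (LinearMap.fst ℂ V V)

/-- The special coisotropic subspaces of `R`. -/
def specialCoisotropic (B : LinearMap.BilinForm ℂ V) (R : V → V → Prop) :
    Set (Submodule ℂ V) :=
  firstProj '' components B R

/-- The Weyl group of `R`: the automorphisms of `V` whose graph is a component of `R`. -/
def relWeyl (B : LinearMap.BilinForm ℂ V) (R : V → V → Prop) : Set (V ≃ₗ[ℂ] V) :=
  {s | (s : V →ₗ[ℂ] V).graph ∈ components B R}

/-- The discriminant of `R`: the union of all proper special coisotropic subspaces. -/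
def discriminant (B : LinearMap.BilinForm ℂ V) (R : V → V → Prop) : Set V :=
  {v | ∃ V₀ ∈ specialCoisotropic B R, V₀ ≠ ⊤ ∧ v ∈ V₀}

/-- `R` is `1`-regular: it is a Lagrangian equivalence relation with finitely many components,
and its discriminant is empty or consists of the Weyl group translates of one special coisotropic
hyperplane. -/
def IsOneRegular (B : LinearMap.BilinForm ℂ V) (R : V → V → Prop) : Prop :=
  IsLagrangianEquivalence B R ∧ (components B R).Finite ∧
    (discriminant B R = ∅ ∨
      ∃ V₀ ∈ specialCoisotropic B R, Module.finrank ℂ V₀ + 1 = Module.finrank ℂ V ∧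
        discriminant B R = {v | ∃ s ∈ relWeyl B R, ∃ x ∈ V₀, v = s x})

/-- `V` is the direct sum of the pairwise orthogonal subspaces `E i`. -/
def IsOrthogonalDecomposition (B : LinearMap.BilinForm ℂ V) {k : ℕ}
    (E : Fin k → Submodule ℂ V) : Prop :=
  DirectSum.IsInternal E ∧ ∀ i j, i ≠ j → ∀ x ∈ E i, ∀ y ∈ E j, B x y = 0

/-- `R` is `1`-semiregular: `(V, B)` is an orthogonal direct sum of subspaces `E i`, and `R` is
the product of `1`-regular Lagrangian equivalence relations on the `E i`. -/
def IsOneSemiregular (B : LinearMap.BilinForm ℂ V) (R : V → V → Prop) : Prop :=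
  ∃ (k : ℕ) (E : Fin k → Submodule ℂ V), IsOrthogonalDecomposition B E ∧
    ∃ Rc : ∀ i, E i → E i → Prop, (∀ i, IsOneRegular (B.restrict (E i)) (Rc i)) ∧
      ∀ a b : ∀ i, E i, R (∑ i, (a i : V)) (∑ i, (b i : V)) ↔ ∀ i, Rc i (a i) (b i)

/-- The orthogonal complement `V₁` of `V₀`, intersected with `V₀` and seen as a subspace of `V₀`
(for a coisotropic `V₀` this is all of `V₁`). -/
def radicalIn (B : LinearMap.BilinForm ℂ V) (V₀ : Submodule ℂ V) : Submodule ℂ V₀ :=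
  (B.orthogonal V₀).comap V₀.subtype

/-- The subquotient `V₀ / V₁`. -/
abbrev Subquotient (B : LinearMap.BilinForm ℂ V) (V₀ : Submodule ℂ V) : Type u :=
  V₀ ⧸ radicalIn B V₀

theorem radicalIn_le_ker_flip (B : LinearMap.BilinForm ℂ V) (V₀ : Submodule ℂ V) :
    radicalIn B V₀ ≤ LinearMap.ker (LinearMap.flip (B.restrict V₀)) := by
  intro x hx
  rw [LinearMap.mem_ker]
  ext y
  exact hx y y.2

theorem radicalIn_le_ker (B : LinearMap.BilinForm ℂ V) (hB : B.IsSymm) (V₀ : Submodule ℂ V) :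
    radicalIn B V₀ ≤ LinearMap.ker (B.restrict V₀) := by
  intro x hx
  rw [LinearMap.mem_ker]
  ext y
  exact (hB.eq (x : V) (y : V)).trans (hx y y.2)

/-- The form induced by `B` on `V₀ / V₁`. -/
noncomputable def reducedForm (B : LinearMap.BilinForm ℂ V) (hB : B.IsSymm)
    (V₀ : Submodule ℂ V) : LinearMap.BilinForm ℂ (Subquotient B V₀) :=
  LinearMap.liftQ₂ (radicalIn B V₀) (radicalIn B V₀) (B.restrict V₀)
    (radicalIn_le_ker B hB V₀) (radicalIn_le_ker_flip B V₀)

/-- The relation induced by `R` on `V₀ / V₁`. -/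
def reducedRel (B : LinearMap.BilinForm ℂ V) (V₀ : Submodule ℂ V) (R : V → V → Prop) :
    Subquotient B V₀ → Subquotient B V₀ → Prop :=
  fun p q => ∃ x y : V₀, (radicalIn B V₀).mkQ x = p ∧ (radicalIn B V₀).mkQ y = q ∧
    R (x : V) (y : V)

/-- A Lagrangian equivalence relation is semiregular if its reductions to all its special
coisotropic subspaces are `1`-semiregular. -/
def IsSemiregular (B : LinearMap.BilinForm ℂ V) (hB : B.IsSymm) (R : V → V → Prop) : Prop :=
  IsLagrangianEquivalence B R ∧ ∀ V₀ ∈ specialCoisotropic B R,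
    IsOneSemiregular (reducedForm B hB V₀) (reducedRel B V₀ R)

/-- The ring `ℂ[V]` of polynomial functions on `V`, generated by the linear functions. -/
def polyFun (V : Type u) [AddCommGroup V] [Module ℂ V] : Subalgebra ℂ (V → ℂ) :=
  Algebra.adjoin ℂ (Set.range fun (φ : Module.Dual ℂ V) (v : V) => φ v)

/-- The ring `ℂ[V]^R` of `R`-invariant polynomial functions. -/
def invariantRing (R : V → V → Prop) : Subalgebra ℂ (V → ℂ) where
  carrier := {f | f ∈ polyFun V ∧ ∀ x y, R x y → f x = f y}
  mul_mem' := fun {f g} hf hg => ⟨mul_mem hf.1 hg.1, fun x y h => by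
    simp [hf.2 x y h, hg.2 x y h]⟩
  add_mem' := fun {f g} hf hg => ⟨add_mem hf.1 hg.1, fun x y h => by
    simp [hf.2 x y h, hg.2 x y h]⟩
  algebraMap_mem' := fun c => ⟨Subalgebra.algebraMap_mem _ c, fun _ _ _ => rfl⟩

/-- The ideal of `ℂ[V]^R` of the functions that vanish at `v`. -/
def pointIdeal (R : V → V → Prop) (v : V) : Ideal (invariantRing R) where
  carrier := {f | (f : V → ℂ) v = 0}
  zero_mem' := rfl
  add_mem' := fun {f g} (hf : (f : V → ℂ) v = 0) (hg : (g : V → ℂ) v = 0) => by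
    simp [hf, hg]
  smul_mem' := fun c f (hf : (f : V → ℂ) v = 0) => by
    simp [hf]

/-- An equivalence relation is detectable if the common zero set of each maximal ideal of
`ℂ[V]^R` is an equivalence class. -/
def IsDetectable (R : V → V → Prop) : Prop :=
  Equivalence R ∧ ∀ m : Ideal (invariantRing R), m.IsMaximal →
    ∃ x : V, {v : V | ∀ f ∈ m, (f : V → ℂ) v = 0} = {y : V | R x y}

end Linear

section Roots

variable {V : Type u} [AddCommGroup V] [Module ℂ V]

/-- Finite weak generalized root systems. -/
structure IsWGRS (B : LinearMap.BilinForm ℂ V) (Δ : Set V) : Prop where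
  finite : Δ.Finite
  zero_notMem : (0 : V) ∉ Δ
  neg_mem : ∀ α ∈ Δ, -α ∈ Δ
  reflection : ∀ α ∈ Δ, B α α ≠ 0 → ∀ β ∈ Δ,
    ∃ k : ℤ, 2 * B α β / B α α = (k : ℂ) ∧ β - k • α ∈ Δ
  isotropic : ∀ α ∈ Δ, B α α = 0 → ∀ β ∈ Δ, B α β ≠ 0 → β + α ∈ Δ ∨ β - α ∈ Δ

/-- The Weyl group of `Δ`, generated by the reflections in the anisotropic roots. -/
def rootWeyl (B : LinearMap.BilinForm ℂ V) (Δ : Set V) : Subgroup (V ≃ₗ[ℂ] V) :=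
  Subgroup.closure {s | ∃ α ∈ Δ, B α α ≠ 0 ∧ ∀ v, s v = v - (2 * B α v / B α α) • α}

/-- The equivalence relation generated by the Weyl group of `Δ` and by `v ~ v + c • α` for the
isotropic roots `α` orthogonal to `v` and all complex `c`. -/
def rootRel (B : LinearMap.BilinForm ℂ V) (Δ : Set V) : V → V → Prop :=
  Relation.EqvGen fun v v' =>
    (∃ w ∈ rootWeyl B Δ, v' = w v) ∨
      ∃ α ∈ Δ, B α α = 0 ∧ B v α = 0 ∧ ∃ c : ℂ, v' = v + c • α

/-- `Δ` is not a disjoint union of two non-empty mutually orthogonal symmetric subsets. -/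
def IsIndecomposable (B : LinearMap.BilinForm ℂ V) (Δ : Set V) : Prop :=
  ¬ ∃ Δ₁ Δ₂ : Set V, Δ₁.Nonempty ∧ Δ₂.Nonempty ∧ Disjoint Δ₁ Δ₂ ∧ Δ = Δ₁ ∪ Δ₂ ∧
    (∀ α ∈ Δ₁, -α ∈ Δ₁) ∧ (∀ α ∈ Δ₂, -α ∈ Δ₂) ∧ ∀ α ∈ Δ₁, ∀ β ∈ Δ₂, B α β = 0

/-- `V` is an orthogonal direct sum of subspaces `E i` such that `Δ` is the union of the sets
`Δ ∩ E i`, and these are indecomposable. -/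
def HasOrthogonalComponents (B : LinearMap.BilinForm ℂ V) (Δ : Set V) : Prop :=
  ∃ (k : ℕ) (E : Fin k → Submodule ℂ V), IsOrthogonalDecomposition B E ∧
    (∀ α ∈ Δ, ∃ i, α ∈ E i) ∧ ∀ i, IsIndecomposable B (Δ ∩ (E i : Set V))

end Roots

end LagrangianRelations

/-! The basic objects are the isotropic spans: totally isotropic subspaces I spanned by isotropic
roots, of which there are finitely many. Let I be maximal among those orthogonal to a point x. Then
the class of x is W(x + I): if an isotropic root β orthogonal to x is not orthogonal to some
isotropic root α in I, one of β ± α is an anisotropic root orthogonal to x, and its reflection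
interchanges the lines of α and β, so translation along β is, up to W, translation along α. Hence R
is the union of the relations y = w(x + u) with x in I^⊥ and u in I, which are Lagrangian because
dim I + dim I^⊥ = dim V. The group W is finite: by an averaging argument the form is nondegenerate
on the span of the anisotropic roots, so an element of W is determined by its permutation of these
roots.

Detectability rests on `exists_invariant`. Let D_I (`spanDisc`) be the product of the isotropic
roots orthogonal to I and outside I. A polynomial h on I^⊥ that is invariant under I and under the
stabilizer of I in W extends, after multiplication by D_I, to an element of the invariant ring that
vanishes on J^⊥ unless J lies in a translate of I. The extension is, up to a constant, the sum over
W of the translates of h D_I ∏ b/γ_b. Here b runs over the isotropic roots not orthogonal to I, one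
of each pair ±b, and γ_b = b ± a_b is an anisotropic root with a_b in I. The product is 1 on I^⊥ and
compatible with translations by roots in I (`exists_denominators`); its simple poles lie on
reflection hyperplanes and cancel in the sum. These extensions separate the classes. Combined with
the Nullstellensatz on a suitable I^⊥, they also show that every prime ideal is contained in the
ideal of a point (`exists_le_pointIdeal`).

For semiregularity, the discriminant of the relation induced on I^⊥/I is the union of the
hyperplanes given by the isotropic roots orthogonal to I and outside I. In an indecomposable system
two orthogonal isotropic roots that differ up to sign have a common neighbour (an isotropic root
orthogonal to neither), and no isotropic root is a neighbour of three such roots. Therefore the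
stabilizer of I permutes these hyperplanes transitively, which is 1-regularity. In general I is the
direct sum of its intersections with the E_i, and the reduction is a product. Reductions are treated
as surjections from I^⊥ to some N with kernel I, which covers both I^⊥/I and its factors. -/

namespace LagrangianRelations

universe u

/-! ### Polynomial functions: cancellation, division by linear forms, Nullstellensatz. -/

section PolynomialFunctions

variable {V : Type*} [AddCommGroup V] [Module ℂ V]

theorem dual_mem_polyFun (φ : Module.Dual ℂ V) : (fun v => φ v) ∈ polyFun V :=
  Algebra.subset_adjoin ⟨φ, rfl⟩

theorem const_mem_polyFun (c : ℂ) : (fun _ : V => c) ∈ polyFun V :=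
  Subalgebra.algebraMap_mem _ c

theorem polyFun_induction {p : (f : V → ℂ) → f ∈ polyFun V → Prop}
    (linear : ∀ φ : Module.Dual ℂ V, p (fun v => φ v) (dual_mem_polyFun φ))
    (const : ∀ c : ℂ, p (fun _ => c) (const_mem_polyFun c))
    (add : ∀ f g hf hg, p f hf → p g hg → p (f + g) (add_mem hf hg))
    (mul : ∀ f g hf hg, p f hf → p g hg → p (f * g) (mul_mem hf hg))
    {f : V → ℂ} (hf : f ∈ polyFun V) : p f hf := by
  induction hf using Algebra.adjoin_induction with
  | mem x hx => obtain ⟨φ, rfl⟩ := hx; exact linear φ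
  | algebraMap r => exact const r
  | add x y hx hy h1 h2 => exact add x y hx hy h1 h2
  | mul x y hx hy h1 h2 => exact mul x y hx hy h1 h2

theorem form_mem_polyFun (B : LinearMap.BilinForm ℂ V) (a : V) : (fun v => B a v) ∈ polyFun V :=
  dual_mem_polyFun (B a)

theorem prod_mem_polyFun {ι : Type*} (s : Finset ι) (f : ι → V → ℂ)
    (hf : ∀ i ∈ s, f i ∈ polyFun V) : (fun v => ∏ i ∈ s, f i v) ∈ polyFun V := by
  have : (fun v => ∏ i ∈ s, f i v) = ∏ i ∈ s, f i := by ext v; simp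
  rw [this]; exact prod_mem hf

theorem sum_mem_polyFun {ι : Type*} (s : Finset ι) (f : ι → V → ℂ)
    (hf : ∀ i ∈ s, f i ∈ polyFun V) : (fun v => ∑ i ∈ s, f i v) ∈ polyFun V := by
  have : (fun v => ∑ i ∈ s, f i v) = ∑ i ∈ s, f i := by ext v; simp
  rw [this]; exact sum_mem hf

theorem comp_affine_mem_polyFun {V' : Type*} [AddCommGroup V'] [Module ℂ V'] (T : V' →ₗ[ℂ] V)
    (a : V) {f : V → ℂ} (hf : f ∈ polyFun V) : (fun v => f (T v + a)) ∈ polyFun V' := by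
  induction hf using polyFun_induction with
  | linear φ =>
    have : (fun v => φ (T v + a)) = (fun v => (φ ∘ₗ T) v) + fun _ => φ a := by ext v; simp
    rw [this]; exact add_mem (dual_mem_polyFun _) (const_mem_polyFun _)
  | const c => exact const_mem_polyFun c
  | add f g _ _ hf hg => exact add_mem hf hg
  | mul f g _ _ hf hg => exact mul_mem hf hg

theorem comp_linear_mem_polyFun {V' : Type*} [AddCommGroup V'] [Module ℂ V'] (T : V' →ₗ[ℂ] V)
    {f : V → ℂ} (hf : f ∈ polyFun V) : (fun v => f (T v)) ∈ polyFun V' := by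
  simpa using comp_affine_mem_polyFun T 0 hf

theorem restrict_mem_polyFun (M : Submodule ℂ V) {f : V → ℂ} (hf : f ∈ polyFun V) :
    (fun v : M => f v) ∈ polyFun M :=
  comp_linear_mem_polyFun M.subtype hf

/-- Polynomial functions are polynomial on lines. -/
theorem exists_polynomial_line {f : V → ℂ} (hf : f ∈ polyFun V) (x y : V) :
    ∃ P : Polynomial ℂ, ∀ t : ℂ, f (x + t • y) = P.eval t := by
  induction hf using polyFun_induction with
  | linear φ =>
    exact ⟨Polynomial.C (φ x) + Polynomial.X * Polynomial.C (φ y), fun t => by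
      change φ (x + t • y) = _
      rw [map_add, map_smul, smul_eq_mul]; simp only [Polynomial.eval_add, Polynomial.eval_C, Polynomial.eval_mul, Polynomial.eval_X]⟩
  | const c => exact ⟨Polynomial.C c, fun t => by simp⟩
  | add f g _ _ hf hg =>
    obtain ⟨P, hP⟩ := hf
    obtain ⟨Q, hQ⟩ := hg
    exact ⟨P + Q, fun t => by simp [hP, hQ]⟩
  | mul f g _ _ hf hg =>
    obtain ⟨P, hP⟩ := hf
    obtain ⟨Q, hQ⟩ := hg
    exact ⟨P * Q, fun t => by simp [hP, hQ]⟩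

/-- On the line through a point where f is nonzero and one where g is nonzero, both restrict to
univariate polynomials, whose product is zero only if a factor is. -/
theorem polyFun_eq_zero_or_eq_zero {f g : V → ℂ} (hf : f ∈ polyFun V) (hg : g ∈ polyFun V)
    (h : ∀ v, f v * g v = 0) : (∀ v, f v = 0) ∨ ∀ v, g v = 0 := by
  by_contra! hc
  obtain ⟨⟨x, hx⟩, y, hy⟩ := hc
  obtain ⟨P, hP⟩ := exists_polynomial_line hf x (y - x)
  obtain ⟨Q, hQ⟩ := exists_polynomial_line hg x (y - x)
  have hPQ : P * Q = 0 := by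
    apply Polynomial.funext
    intro t
    rw [Polynomial.eval_mul, ← hP, ← hQ, h, Polynomial.eval_zero]
  rcases mul_eq_zero.1 hPQ with h0 | h0
  · apply hx
    have := hP 0
    simpa [h0] using this
  · apply hy
    have := hQ 1
    simpa [h0] using this

/-- Two polynomial functions that agree where a third one does not vanish are equal, unless the
third one is zero. -/
theorem polyFun_cancel {d f g : V → ℂ} (hd : d ∈ polyFun V) (hf : f ∈ polyFun V)
    (hg : g ∈ polyFun V) (hd0 : ∃ v, d v ≠ 0) (h : ∀ v, d v * f v = d v * g v) (v : V) :
    f v = g v := by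
  rcases polyFun_eq_zero_or_eq_zero hd (sub_mem hf hg)
    (fun v => by simp [mul_sub, h v]) with h1 | h1
  · obtain ⟨w, hw⟩ := hd0
    exact absurd (h1 w) hw
  · exact sub_eq_zero.1 (h1 v)

theorem exists_prod_ne_zero {ι : Type*} (s : Finset ι) (f : ι → V → ℂ)
    (hf : ∀ i ∈ s, f i ∈ polyFun V) (h0 : ∀ i ∈ s, ∃ v, f i v ≠ 0) :
    ∃ v, ∏ i ∈ s, f i v ≠ 0 := by
  classical
  induction s using Finset.induction_on with
  | empty => exact ⟨0, by simp⟩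
  | insert a s ha ih =>
    by_contra! hc
    rcases polyFun_eq_zero_or_eq_zero (hf a (by simp))
      (prod_mem_polyFun s f fun i hi => hf i (by simp [hi]))
      (fun v => by simpa [Finset.prod_insert ha] using hc v) with h | h
    · obtain ⟨v, hv⟩ := h0 a (by simp)
      exact hv (h v)
    · obtain ⟨v, hv⟩ := ih (fun i hi => hf i (by simp [hi])) (fun i hi => h0 i (by simp [hi]))
      exact hv (h v)

/-- A polynomial function that vanishes on the kernel of a linear function is divisible by it. -/
theorem exists_eq_dual_mul (φ : Module.Dual ℂ V) (hφ : φ ≠ 0) {f : V → ℂ} (hf : f ∈ polyFun V)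
    (h : ∀ v, φ v = 0 → f v = 0) : ∃ g ∈ polyFun V, ∀ v, f v = φ v * g v := by
  obtain ⟨v₀, hv₀⟩ : ∃ v₀, φ v₀ = 1 := by
    obtain ⟨w, hw⟩ : ∃ w, φ w ≠ 0 := by
      by_contra! hc
      exact hφ (LinearMap.ext hc)
    exact ⟨(φ w)⁻¹ • w, by simp [hw]⟩
  -- The vector v - φ(v)v₀ is the projection of v to the kernel of φ. The difference of the values
  -- of f at v and at its projection obeys a twisted Leibniz rule, so divisibility by φ passes from
  -- linear functions to all polynomials.
  have key : f ∈ polyFun V ∧ ∃ g ∈ polyFun V, ∀ v, f v - f (v - φ v • v₀) = φ v * g v := by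
    clear h
    induction hf using polyFun_induction with
    | linear ψ =>
      exact ⟨dual_mem_polyFun ψ, fun _ => ψ v₀, const_mem_polyFun _, fun v => by simp⟩
    | const c => exact ⟨const_mem_polyFun c, 0, zero_mem _, fun v => by simp⟩
    | add f g _ _ hf hg =>
      obtain ⟨hf, f', hf', h1⟩ := hf
      obtain ⟨hg, g', hg', h2⟩ := hg
      refine ⟨add_mem hf hg, f' + g', add_mem hf' hg', fun v => ?_⟩
      simp only [Pi.add_apply]
      linear_combination h1 v + h2 v
    | mul f g _ _ hf hg =>
      obtain ⟨hf, f', hf', h1⟩ := hf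
      obtain ⟨hg, g', hg', h2⟩ := hg
      have hc : (fun v => g (v - φ v • v₀)) ∈ polyFun V := by
        have := comp_linear_mem_polyFun (LinearMap.id - φ.smulRight v₀) hg
        simpa using this
      refine ⟨mul_mem hf hg, f * g' + f' * fun v => g (v - φ v • v₀),
        add_mem (mul_mem hf hg') (mul_mem hf' hc), fun v => ?_⟩
      simp only [Pi.add_apply, Pi.mul_apply]
      linear_combination f v * h2 v + g (v - φ v • v₀) * h1 v
  obtain ⟨-, g, hg, h2⟩ := key
  refine ⟨g, hg, fun v => ?_⟩
  rw [← h2, h (v - φ v • v₀) (by simp [hv₀]), sub_zero]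

/-- A polynomial function that vanishes on finitely many distinct hyperplanes is divisible by the
product of their equations. -/
theorem exists_eq_prod_mul {ι : Type*} (s : Finset ι) (φ : ι → Module.Dual ℂ V)
    (hφ : ∀ i ∈ s, ∀ j ∈ s, i ≠ j → ∃ v, φ j v = 0 ∧ φ i v ≠ 0) (hφ0 : ∀ i ∈ s, φ i ≠ 0)
    {f : V → ℂ} (hf : f ∈ polyFun V) (h : ∀ i ∈ s, ∀ v, φ i v = 0 → f v = 0) :
    ∃ g ∈ polyFun V, ∀ v, f v = (∏ i ∈ s, φ i v) * g v := by
  classical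
  induction s using Finset.induction_on with
  | empty => exact ⟨f, hf, by simp⟩
  | insert a s ha ih =>
    obtain ⟨g, hg, hfg⟩ := ih
      (fun i hi j hj => hφ i (by simp [hi]) j (by simp [hj])) (fun i hi => hφ0 i (by simp [hi]))
      (fun i hi => h i (by simp [hi]))
    -- The other linear forms do not vanish identically on the hyperplane of `φ a`, so they can be
    -- cancelled there.
    have h0 : ∀ v, φ a v = 0 → g v = 0 := by
      intro v hv
      let M := LinearMap.ker (φ a)
      refine polyFun_cancel (V := M)
        (restrict_mem_polyFun M (prod_mem_polyFun s _ fun i _ => dual_mem_polyFun (φ i)))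
        (restrict_mem_polyFun M hg) (zero_mem _) ?_ ?_ ⟨v, hv⟩
      · refine exists_prod_ne_zero s (fun i (v : M) => φ i v)
          (fun i _ => restrict_mem_polyFun M (dual_mem_polyFun (φ i))) fun i hi => ?_
        obtain ⟨w, hw, hw'⟩ := hφ i (by simp [hi]) a (by simp) (by rintro rfl; exact ha hi)
        exact ⟨⟨w, hw⟩, hw'⟩
      · rintro ⟨w, hw⟩
        have := hfg w
        rw [h a (by simp) w hw] at this
        simpa using this.symm
    obtain ⟨k, hk, hgk⟩ := exists_eq_dual_mul (φ a) (hφ0 a (by simp)) hg h0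
    refine ⟨k, hk, fun v => ?_⟩
    rw [hfg, hgk, Finset.prod_insert ha]
    ring

/-- A polynomial function with prescribed values `0` at `y` and `1` at finitely many other
points. -/
theorem exists_polyFun_separating (s : Finset V) (y : V) (hy : y ∉ s) :
    ∃ q ∈ polyFun V, q y = 0 ∧ ∀ x ∈ s, q x = 1 := by
  have hφ : ∀ x, x ∈ s → ∃ φ : Module.Dual ℂ V, φ (y - x) = 1 := fun x hx =>
    Module.Projective.exists_dual_eq_one ℂ (sub_ne_zero.2 (by rintro rfl; exact hy hx))
  choose! φ hφ using hφ
  -- Each affine factor is 1 at y and vanishes at its own point of s.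
  refine ⟨fun v => 1 - ∏ x ∈ s, (φ x v - φ x x), sub_mem (one_mem _)
    (prod_mem_polyFun s _ fun x _ => sub_mem (dual_mem_polyFun _) (const_mem_polyFun _)), ?_, ?_⟩
  · have : ∏ x ∈ s, (φ x y - φ x x) = 1 :=
      Finset.prod_eq_one fun x hx => by rw [← map_sub, hφ x hx]
    simp [this]
  · intro x hx
    have : ∏ z ∈ s, (φ z x - φ z z) = 0 := Finset.prod_eq_zero hx (sub_self _)
    simp [this]

/-- The weak Nullstellensatz in coordinates: the polynomials representing M have no common zero, so
the radical of their ideal, and hence the ideal itself, is the whole ring. -/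
theorem exists_sum_mul_eq_one [FiniteDimensional ℂ V] (M : Set (V → ℂ)) (hM : M ⊆ polyFun V)
    (h : ∀ v, ∃ f ∈ M, f v ≠ 0) :
    ∃ (n : ℕ) (m g : Fin n → V → ℂ), (∀ i, m i ∈ M) ∧ (∀ i, g i ∈ polyFun V) ∧
      ∀ v, ∑ i, m i v * g i v = 1 := by
  let b := Module.finBasis ℂ V
  let Ψ : MvPolynomial (Fin (Module.finrank ℂ V)) ℂ →ₐ[ℂ] (V → ℂ) :=
    MvPolynomial.aeval fun i v => b.repr v i
  have hΨ : ∀ p v, Ψ p v = MvPolynomial.aeval (fun i => b.repr v i) p := fun p v => by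
    have : (Pi.evalAlgHom ℂ (fun _ : V => ℂ) v).comp Ψ =
        MvPolynomial.aeval (fun i => b.repr v i) := by
      ext i; simp [Ψ]
    exact congrArg (fun F => F p) this
  have hmem : ∀ p, Ψ p ∈ polyFun V := fun p => by
    induction p using MvPolynomial.induction_on with
    | C a => simp [Ψ]
    | add p q hp hq => rw [map_add]; exact add_mem hp hq
    | mul_X p i hp =>
      rw [map_mul]
      refine mul_mem hp ?_
      simpa [Ψ] using dual_mem_polyFun (b.coord i)
  have hsurj : ∀ f ∈ polyFun V, ∃ p, Ψ p = f := fun f hf => by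
    induction hf using polyFun_induction with
    | linear φ =>
      refine ⟨∑ i, MvPolynomial.C (φ (b i)) * MvPolynomial.X i, ?_⟩
      ext v
      rw [hΨ]
      have := congrArg φ (b.sum_repr v)
      rw [map_sum] at this
      rw [← this]
      simp [mul_comm]
    | const c => exact ⟨MvPolynomial.C c, by ext v; simp [hΨ]⟩
    | add f g _ _ hf hg =>
      obtain ⟨p, rfl⟩ := hf
      obtain ⟨q, rfl⟩ := hg
      exact ⟨p + q, map_add _ _ _⟩
    | mul f g _ _ hf hg =>
      obtain ⟨p, rfl⟩ := hf
      obtain ⟨q, rfl⟩ := hg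
      exact ⟨p * q, map_mul _ _ _⟩
  have htop : (1 : MvPolynomial (Fin (Module.finrank ℂ V)) ℂ) ∈ Ideal.span (Ψ ⁻¹' M) := by
    rw [← Ideal.eq_top_iff_one, ← Ideal.radical_eq_top,
      ← MvPolynomial.vanishingIdeal_zeroLocus_eq_radical (K := ℂ), Ideal.eq_top_iff_one]
    intro x hx
    exfalso
    obtain ⟨f, hf, hfx⟩ := h (b.equivFun.symm x)
    obtain ⟨p, rfl⟩ := hsurj f (hM hf)
    apply hfx
    rw [hΨ]
    have h2 : (fun i => b.repr (b.equivFun.symm x) i) = x := b.equivFun.apply_symm_apply x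
    rw [h2]
    exact hx p (Ideal.subset_span hf)
  obtain ⟨n, g, m, hs⟩ := Submodule.mem_span_set'.1 htop
  refine ⟨n, fun i => Ψ (m i), fun i => Ψ (g i), fun i => (m i).2, fun i => hmem _, fun v => ?_⟩
  have := congrFun (congrArg Ψ hs) v
  simpa [mul_comm] using this

end PolynomialFunctions

end LagrangianRelations

namespace LagrangianRelations

universe u

/-! ### Reflections, integrality, and finiteness of the Weyl group. -/

section RootSystems

variable {V : Type u} [AddCommGroup V] [Module ℂ V]

/-- The isotropic roots. -/
def isoRoots (B : LinearMap.BilinForm ℂ V) (Δ : Set V) : Set V := {α ∈ Δ | B α α = 0}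

/-- The anisotropic roots. -/
def anisoRoots (B : LinearMap.BilinForm ℂ V) (Δ : Set V) : Set V := {α ∈ Δ | B α α ≠ 0}

/-- The reflection in an anisotropic vector. -/
noncomputable def formReflection (B : LinearMap.BilinForm ℂ V) (α : V) (h : B α α ≠ 0) :
    V ≃ₗ[ℂ] V :=
  Module.reflection (x := α) (f := (2 / B α α) • B α)
    (by rw [LinearMap.smul_apply, smul_eq_mul, div_mul_cancel₀ _ h])

theorem formReflection_apply (B : LinearMap.BilinForm ℂ V) (α : V) (h : B α α ≠ 0) (v : V) :
    formReflection B α h v = v - (2 * B α v / B α α) • α := by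
  rw [formReflection, Module.reflection_apply, LinearMap.smul_apply, smul_eq_mul, div_mul_eq_mul_div]

variable {B : LinearMap.BilinForm ℂ V} {Δ : Set V}

theorem formReflection_self {α : V} (h : B α α ≠ 0) : formReflection B α h α = -α := by
  rw [formReflection_apply, mul_div_assoc, div_self h, mul_one, two_smul]; abel

theorem formReflection_of_orthogonal {α : V} (h : B α α ≠ 0) {v : V} (hv : B α v = 0) :
    formReflection B α h v = v := by
  rw [formReflection_apply, hv]; simp

theorem form_formReflection (hB : B.IsSymm) {α : V} (h : B α α ≠ 0) (v w : V) :
    B (formReflection B α h v) (formReflection B α h w) = B v w := by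
  have h1 : B v α = B α v := hB.eq v α
  simp only [formReflection_apply, map_sub, LinearMap.sub_apply, map_smul, LinearMap.smul_apply,
    smul_eq_mul, h1]
  field_simp
  ring

theorem formReflection_mem_rootWeyl {α : V} (hα : α ∈ Δ) (h : B α α ≠ 0) :
    formReflection B α h ∈ rootWeyl B Δ :=
  Subgroup.subset_closure ⟨α, hα, h, formReflection_apply B α h⟩

/-- Reflections are involutions, so inverses of generators need no separate case. -/
theorem rootWeyl_induction {p : (V ≃ₗ[ℂ] V) → Prop} (one : p 1)
    (mul : ∀ s t, p s → p t → p (s * t))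
    (refl : ∀ α ∈ Δ, ∀ h : B α α ≠ 0, p (formReflection B α h)) {w : V ≃ₗ[ℂ] V}
    (hw : w ∈ rootWeyl B Δ) : p w := by
  have hrefl : ∀ s : V ≃ₗ[ℂ] V, (∃ α ∈ Δ, B α α ≠ 0 ∧ ∀ v, s v = v - (2 * B α v / B α α) • α) →
      ∃ α ∈ Δ, ∃ h : B α α ≠ 0, s = formReflection B α h := by
    rintro s ⟨α, hα, h, hs⟩
    exact ⟨α, hα, h, LinearEquiv.ext fun v => by rw [hs, formReflection_apply]⟩
  have hinv : ∀ α (h : B α α ≠ 0), (formReflection B α h)⁻¹ = formReflection B α h := by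
    intro α h
    rw [inv_eq_iff_mul_eq_one]
    ext v
    exact Module.involutive_reflection _ v
  refine Subgroup.closure_induction'' (p := fun w _ => p w) ?_ ?_ one
    (fun s t _ _ => mul s t) hw
  · intro s hs
    obtain ⟨α, hα, h, rfl⟩ := hrefl s hs
    exact refl α hα h
  · intro s hs
    obtain ⟨α, hα, h, rfl⟩ := hrefl s hs
    rw [hinv]
    exact refl α hα h

theorem form_rootWeyl (hB : B.IsSymm) {w : V ≃ₗ[ℂ] V} (hw : w ∈ rootWeyl B Δ) (x y : V) :
    B (w x) (w y) = B x y := by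
  revert x y
  refine rootWeyl_induction (p := fun w => ∀ x y, B (w x) (w y) = B x y) (fun _ _ => rfl)
    (fun s t hs ht x y => ?_) (fun α _ h => form_formReflection hB h) hw
  rw [LinearEquiv.mul_apply, LinearEquiv.mul_apply, hs, ht]

theorem form_rootWeyl_inv (hB : B.IsSymm) {w : V ≃ₗ[ℂ] V} (hw : w ∈ rootWeyl B Δ) (x y : V) :
    B (w⁻¹ x) y = B x (w y) := by
  rw [← form_rootWeyl hB hw _ y]
  congr 2
  exact w.apply_symm_apply x

namespace IsWGRS

variable (hΔ : IsWGRS B Δ)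
include hΔ

theorem formReflection_mem {α : V} (hα : α ∈ Δ) (h : B α α ≠ 0) {β : V} (hβ : β ∈ Δ) :
    formReflection B α h β ∈ Δ := by
  obtain ⟨k, hk, hm⟩ := hΔ.reflection α hα h β hβ
  rw [formReflection_apply, hk, Int.cast_smul_eq_zsmul]
  exact hm

theorem rootWeyl_mem {w : V ≃ₗ[ℂ] V} (hw : w ∈ rootWeyl B Δ) {β : V} (hβ : β ∈ Δ) : w β ∈ Δ := by
  revert β
  exact rootWeyl_induction (p := fun w => ∀ β ∈ Δ, w β ∈ Δ) (fun _ h => h)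
    (fun s t hs ht β hβ => hs _ (ht _ hβ)) (fun α hα h β => hΔ.formReflection_mem hα h) hw _

theorem rootWeyl_mem_iso (hB : B.IsSymm) {w : V ≃ₗ[ℂ] V} (hw : w ∈ rootWeyl B Δ) {β : V}
    (hβ : β ∈ isoRoots B Δ) : w β ∈ isoRoots B Δ :=
  ⟨hΔ.rootWeyl_mem hw hβ.1, by rw [form_rootWeyl hB hw]; exact hβ.2⟩

theorem rootWeyl_mem_aniso (hB : B.IsSymm) {w : V ≃ₗ[ℂ] V} (hw : w ∈ rootWeyl B Δ) {β : V}
    (hβ : β ∈ anisoRoots B Δ) : w β ∈ anisoRoots B Δ :=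
  ⟨hΔ.rootWeyl_mem hw hβ.1, by rw [form_rootWeyl hB hw]; exact hβ.2⟩

theorem neg_mem_iso {α : V} (hα : α ∈ isoRoots B Δ) : -α ∈ isoRoots B Δ :=
  ⟨hΔ.neg_mem α hα.1, by simpa using hα.2⟩

theorem ne_zero {α : V} (hα : α ∈ Δ) : α ≠ 0 := by
  rintro rfl; exact hΔ.zero_notMem hα

/-- The main source of Weyl group elements: the root β + εα is anisotropic, with square 2εB(α, β),
and its reflection sends β to -εα and α to -εβ. A complex ε treats both signs at once. -/
theorem exists_sign {α β : V} (hα : α ∈ isoRoots B Δ) (hβ : β ∈ isoRoots B Δ) (h : B α β ≠ 0) :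
    ∃ ε : ℂ, (ε = 1 ∨ ε = -1) ∧ β + ε • α ∈ Δ := by
  rcases hΔ.isotropic α hα.1 hα.2 β hβ.1 h with h1 | h1
  · exact ⟨1, Or.inl rfl, by simpa using h1⟩
  · exact ⟨-1, Or.inr rfl, by simpa [sub_eq_add_neg] using h1⟩

omit hΔ in
theorem form_add_smul (hB : B.IsSymm) {α β : V} (hα : B α α = 0) (hβ : B β β = 0) (ε : ℂ) :
    B (β + ε • α) (β + ε • α) = 2 * ε * B α β := by
  have h1 : B β α = B α β := hB.eq β α
  simp only [map_add, LinearMap.add_apply, map_smul, LinearMap.smul_apply, smul_eq_mul, hα, hβ, h1]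
  ring

omit hΔ in
theorem form_add_smul_ne (hB : B.IsSymm) {α β : V} (hα : B α α = 0) (hβ : B β β = 0)
    (h : B α β ≠ 0) {ε : ℂ} (hε : ε = 1 ∨ ε = -1) :
    B (β + ε • α) (β + ε • α) ≠ 0 := by
  rw [form_add_smul hB hα hβ]
  rcases hε with rfl | rfl <;> simpa using h

omit hΔ in
theorem formReflection_add_smul_right (hB : B.IsSymm) {α β : V} (hα : B α α = 0) (hβ : B β β = 0)
    (h : B α β ≠ 0) {ε : ℂ} (hε : ε = 1 ∨ ε = -1)
    (hγ : B (β + ε • α) (β + ε • α) ≠ 0) :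
    formReflection B (β + ε • α) hγ β = -(ε • α) := by
  rw [formReflection_apply, form_add_smul hB hα hβ]
  have h0 : ε ≠ 0 := by rcases hε with rfl | rfl <;> simp
  have : 2 * B (β + ε • α) β / (2 * ε * B α β) = 1 := by
    simp only [map_add, LinearMap.add_apply, map_smul, LinearMap.smul_apply, smul_eq_mul, hβ]
    field_simp
    simp
  rw [this]; module

omit hΔ in
theorem formReflection_add_smul_left (hB : B.IsSymm) {α β : V} (hα : B α α = 0) (hβ : B β β = 0)
    (h : B α β ≠ 0) {ε : ℂ} (hε : ε = 1 ∨ ε = -1)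
    (hγ : B (β + ε • α) (β + ε • α) ≠ 0) :
    formReflection B (β + ε • α) hγ α = -(ε • β) := by
  rw [formReflection_apply, form_add_smul hB hα hβ]
  have h1 : B β α = B α β := hB.eq β α
  have : 2 * B (β + ε • α) α / (2 * ε * B α β) = ε := by
    simp only [map_add, LinearMap.add_apply, map_smul, LinearMap.smul_apply, smul_eq_mul, hα, h1]
    rcases hε with rfl | rfl <;> field_simp <;> simp
  rw [this]
  rcases hε with rfl | rfl <;> module

/-- A coefficient that is forced to be an integer by the reflection in `β + ε • α`. -/
theorem exists_int (hB : B.IsSymm) {α β : V} (hα : α ∈ isoRoots B Δ) (hβ : β ∈ isoRoots B Δ)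
    (h : B α β ≠ 0) {σ : V} (hσ : σ ∈ Δ) (hασ : B α σ = 0) :
    ∃ k : ℤ, B β σ = k * B α β := by
  obtain ⟨ε, hε, hγ⟩ := hΔ.exists_sign hα hβ h
  obtain ⟨k, hk, -⟩ := hΔ.reflection _ hγ (form_add_smul_ne hB hα.2 hβ.2 h hε) σ hσ
  rw [form_add_smul hB hα.2 hβ.2] at hk
  simp only [map_add, LinearMap.add_apply, map_smul, LinearMap.smul_apply, smul_eq_mul, hασ] at hk
  rcases hε with rfl | rfl
  · refine ⟨k, ?_⟩
    field_simp at hk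
    linear_combination hk
  · refine ⟨-k, ?_⟩
    field_simp at hk
    push_cast
    linear_combination -hk

omit hΔ in
-- Since a is nonzero, the integers k and l are inverse to each other, hence ±1.
theorem int_inverse {k l : ℤ} {a b : ℂ} (ha : a ≠ 0) (h1 : b = k * a) (h2 : a = l * b) :
    b = a ∨ b = -a := by
  have : ((k * l : ℤ) : ℂ) = 1 := by
    push_cast
    apply mul_right_cancel₀ ha
    rw [h1] at h2
    linear_combination -h2
  have h3 : k * l = 1 := by exact_mod_cast this
  rcases Int.eq_one_or_neg_one_of_mul_eq_one h3 with rfl | rfl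
  · left; simpa using h1
  · right; simpa using h1

/-- The isotropic roots β and tβ are orthogonal, so `exists_int`, applied in both orders, makes
their products with α integer multiples of each other. -/
theorem smul_root (hB : B.IsSymm) {α β : V} (hα : α ∈ isoRoots B Δ) (hβ : β ∈ isoRoots B Δ)
    (h : B α β ≠ 0) {t : ℂ} (ht : t • β ∈ Δ) : t • β = β ∨ t • β = -β := by
  have h' : B β α ≠ 0 := by rwa [hB.eq β α] at *
  have ht0 : t ≠ 0 := by rintro rfl; exact hΔ.zero_notMem (by simpa using ht)
  have hi : t • β ∈ isoRoots B Δ := ⟨ht, by simp [hβ.2]⟩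
  obtain ⟨k, hk⟩ := hΔ.exists_int hB hβ hα h' ht (by simp [hβ.2])
  obtain ⟨l, hl⟩ := hΔ.exists_int hB hi hα (by simp [h', ht0]) hβ.1 (by simp [hβ.2])
  have e1 : B β α = B α β := hB.eq β α
  simp only [map_smul, LinearMap.smul_apply, smul_eq_mul, e1] at hk hl
  rcases int_inverse h hk hl with h2 | h2
  · left; rw [mul_left_eq_self₀.1 h2 |>.resolve_right h, one_smul]
  · right
    have : t = -1 := mul_right_cancel₀ h (by rw [h2]; ring)
    rw [this, neg_one_smul]

/-- Isotropic roots that are orthogonal to each other have, up to sign, the same product with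
every isotropic root that is orthogonal to neither. -/
theorem form_eq_or_eq_neg (hB : B.IsSymm) {α β δ : V} (hα : α ∈ isoRoots B Δ)
    (hβ : β ∈ isoRoots B Δ) (hδ : δ ∈ isoRoots B Δ) (hαβ : B α β = 0) (h1 : B δ α ≠ 0)
    (h2 : B δ β ≠ 0) : B δ β = B δ α ∨ B δ β = -B δ α := by
  have e1 : B δ α = B α δ := hB.eq δ α
  have e2 : B δ β = B β δ := hB.eq δ β
  have e3 : B β α = B α β := hB.eq β α
  obtain ⟨k, hk⟩ := hΔ.exists_int hB hα hδ (e1 ▸ h1) hβ.1 hαβ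
  obtain ⟨l, hl⟩ := hΔ.exists_int hB hβ hδ (e2 ▸ h2) hα.1 (by rw [e3, hαβ])
  rw [← e1] at hk
  rw [← e2] at hl
  exact int_inverse h1 hk hl

/-- The anisotropic roots in a subspace span a subspace on which the form is nondegenerate. -/
theorem eq_zero_of_mem_span_aniso (hB : B.IsSymm) (F : Submodule ℂ V) {z : V}
    (hz : z ∈ Submodule.span ℂ (anisoRoots B Δ ∩ F)) (h : ∀ γ ∈ anisoRoots B Δ ∩ F, B γ z = 0) :
    z = 0 := by
  classical
  by_contra hz0
  obtain ⟨φ, hφ⟩ : ∃ φ : Module.Dual ℂ V, φ z = 1 := Module.Projective.exists_dual_eq_one ℂ hz0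
  set X : Set V := anisoRoots B Δ ∩ F with hX
  let G : Subgroup (V ≃ₗ[ℂ] V) := rootWeyl B (Δ ∩ F)
  have hGX : ∀ g ∈ G, ∀ γ ∈ X, g γ ∈ X := fun g hg =>
    rootWeyl_induction (p := fun g => ∀ γ ∈ X, g γ ∈ X) (fun _ h => h)
      (fun s t hs ht γ hγ => hs _ (ht _ hγ)) (fun α hα hα' γ hγ => by
        refine ⟨⟨hΔ.formReflection_mem hα.1 hα' hγ.1.1, ?_⟩, ?_⟩
        · rw [form_formReflection hB]; exact hγ.1.2
        · rw [formReflection_apply]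
          exact sub_mem hγ.2 (Submodule.smul_mem _ _ hα.2)) hg
  have hGz : ∀ g ∈ G, g z = z := fun g hg =>
    rootWeyl_induction (p := fun g => g z = z) rfl
      (fun s t hs ht => by rw [LinearEquiv.mul_apply, ht, hs])
      (fun α hα hα' => formReflection_of_orthogonal hα' (h α ⟨⟨hα.1, hα'⟩, hα.2⟩)) hg
  have hXfin : X.Finite := (hΔ.finite.subset fun _ h => h.1).subset Set.inter_subset_left
  have : Finite X := hXfin
  -- Finiteness of the reflection group `G` is not yet known. Therefore φ is averaged over the
  -- finitely many self-maps of `X` induced by `G`, each with a chosen lift. The resulting sum `N`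
  -- kills `X` because N(γ) = N(-γ), whereas N(z) is the number of terms.
  let T : Set (X → X) := {t | ∃ g ∈ G, ∀ γ : X, (t γ : V) = g γ}
  have : Fintype T := Fintype.ofFinite T
  choose g hg hgt using fun t : T => t.2
  let N : Module.Dual ℂ V := ∑ t : T, φ ∘ₗ (g t : V →ₗ[ℂ] V)
  have hN : ∀ v, N v = ∑ t : T, φ (g t v) := fun v => by simp [N]
  have hN0 : ∀ γ ∈ X, N γ = 0 := by
    intro γ hγ
    let s := formReflection B γ hγ.1.2
    have hs : s ∈ G := formReflection_mem_rootWeyl (Δ := Δ ∩ F) ⟨hγ.1.1, hγ.2⟩ hγ.1.2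
    have hss : ∀ v, s (s v) = v := Module.involutive_reflection _
    let S : X → X := fun δ => ⟨s δ, hGX s hs δ δ.2⟩
    have hS : ∀ t : T, (fun δ => t.1 (S δ)) ∈ T := fun t => ⟨g t * s, mul_mem (hg t) hs,
      fun δ => hgt t (S δ)⟩
    have hSS : ∀ δ, S (S δ) = δ := fun δ => Subtype.ext (hss δ)
    -- Composition with the reflection permutes `T`. On elements of `X` the choice of lifts is
    -- irrelevant.
    let e : T ≃ T := ⟨fun t => ⟨_, hS t⟩, fun t => ⟨_, hS t⟩,
      fun t => Subtype.ext (funext fun δ => by simp [hSS]),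
      fun t => Subtype.ext (funext fun δ => by simp [hSS])⟩
    have h1 : N (s γ) = N γ := by
      rw [hN, hN, ← e.sum_comp]
      refine Finset.sum_congr rfl fun t _ => ?_
      rw [← hgt (e t) ⟨_, hGX s hs γ hγ⟩, ← hgt t ⟨γ, hγ⟩]
      change φ (t.1 (S (S ⟨γ, hγ⟩))) = _
      rw [hSS]
    rw [formReflection_self, map_neg] at h1
    linear_combination (-1 / 2 : ℂ) * h1
  have hNz : N z = 0 := by
    have : Submodule.span ℂ X ≤ LinearMap.ker N := Submodule.span_le.2 hN0
    exact this hz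
  rw [hN, Finset.sum_congr rfl fun t _ => by rw [hGz _ (hg t), hφ]] at hNz
  have : Nonempty T := ⟨⟨id, 1, one_mem _, fun _ => rfl⟩⟩
  simp only [Finset.sum_const, Finset.card_univ, nsmul_eq_mul, mul_one, Nat.cast_eq_zero,
    Fintype.card_ne_zero] at hNz

/-- If w and w' permute the anisotropic roots in the same way, then wv - w'v is orthogonal to all of
them; it also lies in their span, where the form is nondegenerate. -/
theorem finite_rootWeyl (hB : B.IsSymm) : Finite (rootWeyl B Δ) := by
  have hfin : (anisoRoots B Δ).Finite := hΔ.finite.subset fun _ h => h.1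
  have : Finite (anisoRoots B Δ) := hfin
  let f : rootWeyl B Δ → anisoRoots B Δ → anisoRoots B Δ := fun w γ =>
    ⟨w.1 γ, hΔ.rootWeyl_mem_aniso hB w.2 γ.2⟩
  refine Finite.of_injective f fun w w' hww => Subtype.ext (LinearEquiv.ext fun v => ?_)
  have hsub : ∀ w ∈ rootWeyl B Δ, w v - v ∈ Submodule.span ℂ (anisoRoots B Δ) := fun w hw =>
    rootWeyl_induction (p := fun w => ∀ v, w v - v ∈ Submodule.span ℂ (anisoRoots B Δ))
      (fun v => by simp) (fun s t hs ht v => by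
        have := add_mem (hs (t v)) (ht v)
        simpa using this)
      (fun α hα h v => by
        rw [formReflection_apply, sub_sub_cancel_left]
        exact NegMemClass.neg_mem (Submodule.smul_mem _ _ (Submodule.subset_span (s := anisoRoots B Δ) ⟨hα, h⟩))) hw v
  rw [← sub_eq_zero]
  refine hΔ.eq_zero_of_mem_span_aniso hB ⊤ ?_ ?_
  · have := sub_mem (hsub w w.2) (hsub w' w'.2)
    simpa using this
  · rintro γ ⟨hγ, -⟩
    have h1 : ∀ u : rootWeyl B Δ, B (u.1 (u.1⁻¹ γ)) (u.1 v) = B (u.1⁻¹ γ) v :=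
      fun u => form_rootWeyl hB u.2 _ _
    let δ : anisoRoots B Δ := ⟨w.1⁻¹ γ, hΔ.rootWeyl_mem_aniso hB (inv_mem w.2) hγ⟩
    have hδ : w.1 δ = γ := w.1.apply_symm_apply γ
    have hδ' : w'.1 δ = γ := by
      have := congrArg Subtype.val (congrFun hww δ)
      rw [← hδ]; exact this.symm
    rw [map_sub, sub_eq_zero]
    conv_lhs => rw [← hδ, form_rootWeyl hB w.2]
    rw [← hδ', form_rootWeyl hB w'.2]

end IsWGRS

end RootSystems

end LagrangianRelations

namespace LagrangianRelations

universe u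

/-! ### Configurations of orthogonal isotropic roots with a common neighbour. -/

section RootSystems

variable {V : Type u} [AddCommGroup V] [Module ℂ V]
variable {B : LinearMap.BilinForm ℂ V} {Δ : Set V}

namespace IsWGRS

variable (hΔ : IsWGRS B Δ)
include hΔ

/-- If an isotropic root `β` is orthogonal to neither of two non-collinear orthogonal isotropic
roots `α` and `α'`, the anisotropic roots in the plane of `α` and `β` are collinear. -/
theorem collinear_of_mem_span_pair (hB : B.IsSymm) {α α' β γ γ' : V} (hα : α ∈ isoRoots B Δ)
    (hα' : α' ∈ isoRoots B Δ) (hβ : β ∈ isoRoots B Δ) (hαα' : B α α' = 0)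
    (hne : ∀ t : ℂ, α' ≠ t • α) (h : B α β ≠ 0) (h' : B α' β ≠ 0) (hγ : γ ∈ anisoRoots B Δ)
    (hγ' : γ' ∈ anisoRoots B Δ) (hs : γ ∈ Submodule.span ℂ {α, β})
    (hs' : γ' ∈ Submodule.span ℂ {α, β}) : ∃ t : ℂ, γ' = t • γ := by
  obtain ⟨p, q, rfl⟩ := Submodule.mem_span_pair.1 hs
  obtain ⟨p', q', rfl⟩ := Submodule.mem_span_pair.1 hs'
  by_cases hd : p * q' - p' * q = 0
  · by_cases hp : p = 0
    · have hq : q ≠ 0 := by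
        rintro rfl
        exact hΔ.zero_notMem (by simpa [hp] using hγ.1)
      have hp' : p' = 0 := by
        rw [hp] at hd
        simpa [hq] using hd
      exact ⟨q' / q, by rw [hp, hp', smul_add, smul_smul, smul_smul, div_mul_cancel₀ _ hq]; simp⟩
    · refine ⟨p' / p, ?_⟩
      rw [smul_add, smul_smul, smul_smul, div_mul_cancel₀ _ hp]
      congr 2
      field_simp
      linear_combination hd
  · exfalso
    obtain ⟨ε, hε, hδ⟩ := hΔ.exists_sign hα' hβ h'
    have hε0 : ε ≠ 0 := by rcases hε with rfl | rfl <;> simp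
    have hδ' := form_add_smul_ne hB hα'.2 hβ.2 h' hε
    set F := Submodule.span ℂ {α, β, α'} with hF
    have mα : α ∈ F := Submodule.subset_span (by simp)
    have mβ : β ∈ F := Submodule.subset_span (by simp)
    have mα' : α' ∈ F := Submodule.subset_span (by simp)
    set U := Submodule.span ℂ (anisoRoots B Δ ∩ F) with hU
    have u1 : p • α + q • β ∈ U := Submodule.subset_span
      ⟨hγ, add_mem (F.smul_mem _ mα) (F.smul_mem _ mβ)⟩
    have u2 : p' • α + q' • β ∈ U := Submodule.subset_span
      ⟨hγ', add_mem (F.smul_mem _ mα) (F.smul_mem _ mβ)⟩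
    have u3 : β + ε • α' ∈ U := Submodule.subset_span
      ⟨⟨hδ, hδ'⟩, add_mem mβ (F.smul_mem _ mα')⟩
    have uα : α ∈ U := by
      have : α = (p * q' - p' * q)⁻¹ • (q' • (p • α + q • β) - q • (p' • α + q' • β)) := by
        rw [eq_inv_smul_iff₀ hd]; module
      rw [this]
      exact U.smul_mem _ (sub_mem (U.smul_mem _ u1) (U.smul_mem _ u2))
    have uβ : β ∈ U := by
      have : β = (p * q' - p' * q)⁻¹ • (p • (p' • α + q' • β) - p' • (p • α + q • β)) := by
        rw [eq_inv_smul_iff₀ hd]; module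
      rw [this]
      exact U.smul_mem _ (sub_mem (U.smul_mem _ u2) (U.smul_mem _ u1))
    have uα' : α' ∈ U := by
      have : α' = ε⁻¹ • (β + ε • α' - β) := by
        rw [eq_inv_smul_iff₀ hε0]; module
      rw [this]
      exact U.smul_mem _ (sub_mem u3 uβ)
    have hα'α : B α' α = 0 := by rw [← hαα']; exact hB.eq α' α
    have hβα : B β α = B α β := hB.eq β α
    have hβα' : B β α' = B α' β := hB.eq β α'
    -- With two independent anisotropic roots in the plane of α and β, the anisotropic roots in `F`
    -- span it, so the form on `F` is nondegenerate. But this vector is orthogonal to α, β and α'.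
    have hz : α' - (B α' β / B α β) • α = 0 := by
      refine hΔ.eq_zero_of_mem_span_aniso hB F (sub_mem uα' (U.smul_mem _ uα)) fun δ hδ => ?_
      have : F ≤ LinearMap.ker (B.flip (α' - (B α' β / B α β) • α)) := by
        rw [hF, Submodule.span_le]
        rintro x (rfl | rfl | rfl)
        · simp [hαα', hα.2]
        · simp [hβα, hβα', h]
        · simp [hα'.2, hα'α]
      exact this hδ.2
    exact hne _ (sub_eq_zero.1 hz)

/-- If the signs agreed, the difference of the anisotropic roots δ + εα and δ + εα' would be a
nonzero multiple of α - α' and orthogonal to both of them, so the form would be degenerate on their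
span. -/
theorem sign_eq_neg (hB : B.IsSymm) {α α' δ : V} (hα : α ∈ isoRoots B Δ)
    (hα' : α' ∈ isoRoots B Δ) (hδ : δ ∈ isoRoots B Δ) (hαα' : B α α' = 0) (hne : α ≠ α')
    (h : B δ α ≠ 0) (he : B δ α' = B δ α) {ε ε' : ℂ} (hε : ε = 1 ∨ ε = -1)
    (hε' : ε' = 1 ∨ ε' = -1) (hm : δ + ε • α ∈ Δ) (hm' : δ + ε' • α' ∈ Δ) : ε' = -ε := by
  have e0 : B α' α = B α α' := hB.eq α' α
  have e1 : B δ α = B α δ := hB.eq δ α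
  have e2 : B δ α' = B α' δ := hB.eq δ α'
  by_contra hc
  have hεε : ε' = ε := by
    rcases hε with rfl | rfl <;> rcases hε' with rfl | rfl <;> simp_all
  subst hεε
  have hε0 : ε' ≠ 0 := by rcases hε with rfl | rfl <;> simp
  have a1 := form_add_smul_ne hB hα.2 hδ.2 (e1 ▸ h) hε
  have a2 := form_add_smul_ne hB hα'.2 hδ.2 (by rw [← e2, he]; exact h) hε
  set F := Submodule.span ℂ {δ + ε' • α, δ + ε' • α'} with hF
  have m1 : δ + ε' • α ∈ F := Submodule.subset_span (by simp)
  have m2 : δ + ε' • α' ∈ F := Submodule.subset_span (by simp)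
  have u1 : δ + ε' • α ∈ Submodule.span ℂ (anisoRoots B Δ ∩ F) :=
    Submodule.subset_span ⟨⟨hm, a1⟩, m1⟩
  have u2 : δ + ε' • α' ∈ Submodule.span ℂ (anisoRoots B Δ ∩ F) :=
    Submodule.subset_span ⟨⟨hm', a2⟩, m2⟩
  have hz : (δ + ε' • α) - (δ + ε' • α') = 0 := by
    refine hΔ.eq_zero_of_mem_span_aniso hB F (sub_mem u1 u2) fun x hx => ?_
    have : F ≤ LinearMap.ker (B.flip ((δ + ε' • α) - (δ + ε' • α'))) := by
      rw [hF, Submodule.span_le]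
      rintro x (rfl | rfl)
      · change B _ _ = 0
        simp only [map_add, LinearMap.add_apply, map_sub, map_smul, LinearMap.smul_apply, smul_eq_mul,
          hα.2, hδ.2, hαα', ← e1, he]
        ring
      · change B _ _ = 0
        simp only [map_add, LinearMap.add_apply, map_sub, map_smul, LinearMap.smul_apply, smul_eq_mul,
          hα'.2, hδ.2, e0, hαα', ← e2, he]
        ring
    exact this hx.2
  apply hne
  have : ε' • (α - α') = 0 := by rw [← hz]; module
  exact sub_eq_zero.1 ((smul_eq_zero.1 this).resolve_left hε0)

/-- No isotropic root is orthogonal to none of three pairwise orthogonal isotropic roots that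
differ up to sign. -/
theorem not_three_neighbours (hB : B.IsSymm) {α β σ δ : V} (hα : α ∈ isoRoots B Δ)
    (hβ : β ∈ isoRoots B Δ) (hσ : σ ∈ isoRoots B Δ) (hδ : δ ∈ isoRoots B Δ) (hαβ : B α β = 0)
    (hασ : B α σ = 0) (hβσ : B β σ = 0) (n1 : α ≠ β) (n1' : α ≠ -β) (n2 : α ≠ σ) (n2' : α ≠ -σ)
    (n3 : β ≠ σ) (n3' : β ≠ -σ) (hδα : B δ α ≠ 0) (hδβ : B δ β ≠ 0) (hδσ : B δ σ ≠ 0) : False := by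
  -- After sign changes the three roots have the same product with δ. By `sign_eq_neg` the three
  -- signs attached to them would then be pairwise opposite, which is impossible.
  have main : ∀ β ∈ isoRoots B Δ, ∀ σ ∈ isoRoots B Δ, B α β = 0 → B α σ = 0 → B β σ = 0 →
      α ≠ β → α ≠ σ → β ≠ σ → B δ β = B δ α → B δ σ = B δ α → False := by
    intro β hβ σ hσ hαβ hασ hβσ n1 n2 n3 e1 e2
    have q1 : B δ α = B α δ := hB.eq δ α
    have q2 : B δ β = B β δ := hB.eq δ β
    have q3 : B δ σ = B σ δ := hB.eq δ σ
    obtain ⟨a, ha, ha'⟩ := hΔ.exists_sign hα hδ (by rwa [← q1])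
    obtain ⟨b, hb, hb'⟩ := hΔ.exists_sign hβ hδ (by rwa [← q2, e1])
    obtain ⟨c, hc, hc'⟩ := hΔ.exists_sign hσ hδ (by rwa [← q3, e2])
    have f1 := hΔ.sign_eq_neg hB hα hβ hδ hαβ n1 hδα e1 ha hb ha' hb'
    have f2 := hΔ.sign_eq_neg hB hα hσ hδ hασ n2 hδα e2 ha hc ha' hc'
    have f3 := hΔ.sign_eq_neg hB hβ hσ hδ hβσ n3 (by rwa [e1]) (by rw [e1, e2]) hb hc hb' hc'
    rw [f2, f1, neg_neg] at f3
    rcases ha with rfl | rfl <;> norm_num at f3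
  have nn : ∀ x y : V, x ≠ -y → -x ≠ y := fun x y h h' => h (by rw [← h', neg_neg])
  have nn' : ∀ x y : V, x ≠ y → -x ≠ -y := fun x y h h' => h (neg_injective h')
  rcases hΔ.form_eq_or_eq_neg hB hα hβ hδ hαβ hδα hδβ with e1 | e1 <;>
    rcases hΔ.form_eq_or_eq_neg hB hα hσ hδ hασ hδα hδσ with e2 | e2
  · exact main β hβ σ hσ hαβ hασ hβσ n1 n2 n3 e1 e2
  · exact main β hβ (-σ) (hΔ.neg_mem_iso hσ) hαβ (by simp [hασ]) (by simp [hβσ]) n1 n2' n3' e1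
      (by simp [e2])
  · exact main (-β) (hΔ.neg_mem_iso hβ) σ hσ (by simp [hαβ]) hασ (by simp [hβσ]) n1' n2
      (nn _ _ n3') (by simp [e1]) e2
  · exact main (-β) (hΔ.neg_mem_iso hβ) (-σ) (hΔ.neg_mem_iso hσ) (by simp [hαβ]) (by simp [hασ])
      (by simp [hβσ]) n1' n2' (nn' _ _ n3) (by simp [e1]) (by simp [e2])

/-- Two orthogonal isotropic roots with a common isotropic neighbour `δ` are exchanged, up to
sign, by an element of the Weyl group that fixes what is orthogonal to all three. -/
theorem exists_rootWeyl_swap (hB : B.IsSymm) {α β δ : V} (hα : α ∈ isoRoots B Δ)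
    (hβ : β ∈ isoRoots B Δ) (hδ : δ ∈ isoRoots B Δ) (hαβ : B α β = 0) (n : α ≠ β) (n' : α ≠ -β)
    (h : B δ α ≠ 0) (h' : B δ β ≠ 0) :
    ∃ w ∈ rootWeyl B Δ, (w α = β ∨ w α = -β) ∧
      ∀ σ, B α σ = 0 → B β σ = 0 → B δ σ = 0 → w σ = σ := by
  have main : ∀ β ∈ isoRoots B Δ, B α β = 0 → α ≠ β → B δ β = B δ α →
      ∃ w ∈ rootWeyl B Δ, w α = -β ∧ ∀ σ, B α σ = 0 → B β σ = 0 → B δ σ = 0 → w σ = σ := by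
    intro β hβ hαβ n e
    have e1 : B δ α = B α δ := hB.eq δ α
    have e2 : B δ β = B β δ := hB.eq δ β
    have e3 : B β α = B α β := hB.eq β α
    have h1 : B α δ ≠ 0 := e1 ▸ h
    have h2 : B β δ ≠ 0 := by rwa [← e2, e]
    obtain ⟨ε, hε, hm⟩ := hΔ.exists_sign hα hδ h1
    obtain ⟨ε', hε', hm'⟩ := hΔ.exists_sign hβ hδ h2
    have := hΔ.sign_eq_neg hB hα hβ hδ hαβ n h e hε hε' hm hm'
    subst this
    have a1 := form_add_smul_ne hB hα.2 hδ.2 h1 hε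
    have a2 := form_add_smul_ne hB hβ.2 hδ.2 h2 hε'
    -- The roots δ + εα and δ - εβ are orthogonal. The second reflection sends α to α + ε(δ - εβ);
    -- the first sends α to -εδ and fixes δ - εβ, which leaves -β.
    refine ⟨formReflection B _ a1 * formReflection B _ a2,
      mul_mem (formReflection_mem_rootWeyl hm a1) (formReflection_mem_rootWeyl hm' a2), ?_, ?_⟩
    · have hε2 : ε * ε = 1 := by rcases hε with rfl | rfl <;> norm_num
      have s2 : formReflection B _ a2 α = α + ε • (δ + (-ε) • β) := by
        rw [formReflection_apply, form_add_smul hB hβ.2 hδ.2]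
        have : 2 * B (δ + -ε • β) α / (2 * -ε * B β δ) = -ε := by
          simp only [map_add, LinearMap.add_apply, map_smul, LinearMap.smul_apply, smul_eq_mul, e3,
            hαβ, ← e2, e]
          rcases hε with rfl | rfl <;> field_simp <;> simp
        rw [this]; module
      have o12 : B (δ + ε • α) (δ + (-ε) • β) = 0 := by
        simp only [map_add, LinearMap.add_apply, map_smul, LinearMap.smul_apply, smul_eq_mul, hαβ,
          hδ.2, e, ← e1]
        ring
      rw [LinearEquiv.mul_apply, s2, map_add, map_smul, formReflection_of_orthogonal _ o12,
        formReflection_add_smul_left hB hα.2 hδ.2 h1 hε, smul_add, smul_smul]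
      rw [mul_neg, hε2]
      module
    · intro σ o1 o2 o3
      rw [LinearEquiv.mul_apply, formReflection_of_orthogonal a2 (by simp [o2, o3]),
        formReflection_of_orthogonal a1 (by simp [o1, o3])]
  rcases hΔ.form_eq_or_eq_neg hB hα hβ hδ hαβ h h' with e | e
  · obtain ⟨w, hw, h1, h2⟩ := main β hβ hαβ n e
    exact ⟨w, hw, Or.inr h1, h2⟩
  · obtain ⟨w, hw, h1, h2⟩ := main (-β) (hΔ.neg_mem_iso hβ) (by simp [hαβ]) n' (by simp [e])
    exact ⟨w, hw, Or.inl (by simpa using h1), fun σ o1 o2 o3 => h2 σ o1 (by simp [o2]) o3⟩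

end IsWGRS

end RootSystems

end LagrangianRelations

namespace LagrangianRelations

universe u

/-! ### Finite unions of linear Lagrangian relations. -/

section Lagrangian

variable {V : Type u} [AddCommGroup V] [Module ℂ V]

/-- A vector space over an infinite field is not a finite union of proper subspaces. -/
theorem exists_le_of_finite_cover {E : Type*} [AddCommGroup E] [Module ℂ E]
    (A : Set (Submodule ℂ E)) (hA : A.Finite) (L : Submodule ℂ E)
    (h : ∀ x ∈ L, ∃ M ∈ A, x ∈ M) : ∃ M ∈ A, L ≤ M := by
  have : Finite A := hA
  obtain ⟨⟨M, hM⟩, h1⟩ := Subspace.exists_eq_top_of_iUnion_eq_univ (k := ℂ) (E := L)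
    (p := fun M : A => M.1.comap L.subtype) (by
      rw [Set.eq_univ_iff_forall]
      rintro ⟨x, hx⟩
      obtain ⟨M, hM, hxM⟩ := h x hx
      exact Set.mem_iUnion.2 ⟨⟨M, hM⟩, hxM⟩)
  exact ⟨M, hM, fun x hx => by
    have : (⟨x, hx⟩ : L) ∈ M.comap L.subtype := by rw [h1]; trivial
    exact this⟩

/-- A Lagrangian subspace contained in the union lies in one member, and the dimensions agree. -/
theorem components_eq [FiniteDimensional ℂ V] {B : LinearMap.BilinForm ℂ V} {R : V → V → Prop}
    {A : Set (Submodule ℂ (V × V))} (hfin : A.Finite) (hA : ∀ L ∈ A, IsLinearLagrangian B L)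
    (hR : ∀ x y, R x y ↔ ∃ L ∈ A, (x, y) ∈ L) : components B R = A := by
  ext L
  constructor
  · rintro ⟨hL, hLR⟩
    obtain ⟨M, hM, hLM⟩ := exists_le_of_finite_cover A hfin L
      fun p hp => (hR p.1 p.2).1 (hLR p hp)
    rwa [Submodule.eq_of_le_of_finrank_eq hLM (hL.2.trans (hA M hM).2.symm)]
  · exact fun hL => ⟨hA L hL, fun p hp => (hR _ _).2 ⟨L, hL, hp⟩⟩

end Lagrangian

/-! ### Isotropic spans and the decomposition of the relation into components. -/

section RootSystems

variable {V : Type u} [AddCommGroup V] [Module ℂ V]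

/-- The isotropic subspaces that are spanned by isotropic roots. -/
def isoSpans (B : LinearMap.BilinForm ℂ V) (Δ : Set V) : Set (Submodule ℂ V) :=
  {I | (∀ x ∈ I, ∀ y ∈ I, B x y = 0) ∧ Submodule.span ℂ (isoRoots B Δ ∩ I) = I}

/-- The linear relation composed of translations by `I` on its orthogonal complement and of a
linear automorphism. -/
def translationRel (B : LinearMap.BilinForm ℂ V) (w : V ≃ₗ[ℂ] V) (I : Submodule ℂ V) :
    Submodule ℂ (V × V) where
  carrier := {p | p.1 ∈ B.orthogonal I ∧ w.symm p.2 - p.1 ∈ I}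
  zero_mem' := by simp
  add_mem' {p q} hp hq := ⟨add_mem hp.1 hq.1, by
    have := add_mem hp.2 hq.2
    rw [Prod.snd_add, Prod.fst_add, map_add]
    convert this using 1
    abel⟩
  smul_mem' c p hp := ⟨Submodule.smul_mem _ c hp.1, by
    have := I.smul_mem c hp.2
    rwa [smul_sub, ← map_smul] at this⟩

variable {B : LinearMap.BilinForm ℂ V} {Δ : Set V}

theorem mem_translationRel {w : V ≃ₗ[ℂ] V} {I : Submodule ℂ V} {x y : V} :
    (x, y) ∈ translationRel B w I ↔ x ∈ B.orthogonal I ∧ ∃ u ∈ I, y = w (x + u) := by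
  refine and_congr_right fun _ => ⟨fun h => ⟨_, h, by simp⟩, ?_⟩
  rintro ⟨u, hu, rfl⟩
  simpa using hu

theorem orthogonal_add_mem {I : Submodule ℂ V} (hI : ∀ x ∈ I, ∀ y ∈ I, B x y = 0) {x u : V}
    (hx : x ∈ B.orthogonal I) (hu : u ∈ I) : x + u ∈ B.orthogonal I :=
  add_mem hx fun y hy => hI y hy u hu

/-- The relation is parametrised injectively by I^⊥ × I, whose dimension is dim V. In the form all
terms involving I vanish, and w is an isometry. -/
theorem isLinearLagrangian_translationRel [FiniteDimensional ℂ V] (hB : B.IsSymm)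
    (hnd : B.Nondegenerate) {w : V ≃ₗ[ℂ] V} (hw : ∀ x y, B (w x) (w y) = B x y)
    {I : Submodule ℂ V} (hI : ∀ x ∈ I, ∀ y ∈ I, B x y = 0) :
    IsLinearLagrangian B (translationRel B w I) := by
  constructor
  · rintro ⟨x, y⟩ hp ⟨x', y'⟩ hq
    obtain ⟨hx, u, hu, rfl⟩ := mem_translationRel.1 hp
    obtain ⟨hx', u', hu', rfl⟩ := mem_translationRel.1 hq
    have h1 : B x u' = 0 := (hB.eq u' x).symm.trans (hx u' hu')
    have h2 : B u x' = 0 := hx' u hu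
    simp [hw, h1, h2, hI u hu u' hu']
  · let f : (B.orthogonal I × I) →ₗ[ℂ] V × V :=
      ((B.orthogonal I).subtype ∘ₗ LinearMap.fst ℂ _ _).prod
        (w.toLinearMap ∘ₗ ((B.orthogonal I).subtype ∘ₗ LinearMap.fst ℂ _ _ +
          I.subtype ∘ₗ LinearMap.snd ℂ _ _))
    have hf : Function.Injective f := by
      rintro ⟨x, u⟩ ⟨x', u'⟩ h
      simp only [f, LinearMap.prod_apply, Function.prod, LinearMap.comp_apply, LinearMap.fst_apply,
        LinearMap.snd_apply, Submodule.subtype_apply, LinearMap.add_apply, LinearEquiv.coe_coe,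
        Prod.mk.injEq, EmbeddingLike.apply_eq_iff_eq] at h
      obtain ⟨h1, h2⟩ := h
      rw [h1] at h2
      exact Prod.ext (Subtype.ext h1) (Subtype.ext (add_left_cancel h2))
    have hr : LinearMap.range f = translationRel B w I := by
      ext ⟨x, y⟩
      rw [mem_translationRel]
      constructor
      · rintro ⟨⟨x', u⟩, h⟩
        have h1 : (x' : V) = x := congrArg Prod.fst h
        have h2 : w (x' + u) = y := congrArg Prod.snd h
        exact ⟨h1 ▸ x'.2, u, u.2, by rw [← h2, h1]⟩
      · rintro ⟨hx, u, hu, rfl⟩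
        exact ⟨(⟨x, hx⟩, ⟨u, hu⟩), rfl⟩
    rw [← hr, LinearMap.finrank_range_of_inj hf, Module.finrank_prod,
      LinearMap.BilinForm.finrank_orthogonal hnd]
    have := I.finrank_le
    omega

theorem firstProj_translationRel (w : V ≃ₗ[ℂ] V) (I : Submodule ℂ V) :
    firstProj (translationRel B w I) = B.orthogonal I := by
  ext x
  constructor
  · rintro ⟨⟨x, y⟩, h, rfl⟩
    exact h.1
  · intro hx
    exact ⟨(x, w x), mem_translationRel.2 ⟨hx, 0, zero_mem _, by simp⟩, rfl⟩

theorem bot_mem_isoSpans : (⊥ : Submodule ℂ V) ∈ isoSpans B Δ :=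
  ⟨by simp, by rw [eq_bot_iff, Submodule.span_le]; exact Set.inter_subset_right⟩

theorem sup_mem_isoSpans (hB : B.IsSymm) {I : Submodule ℂ V} (hI : I ∈ isoSpans B Δ) {β : V}
    (hβ : β ∈ isoRoots B Δ) (h : ∀ y ∈ I, B β y = 0) : I ⊔ Submodule.span ℂ {β} ∈ isoSpans B Δ := by
  constructor
  · intro x hx y hy
    obtain ⟨x, hxI, x', hx', rfl⟩ := Submodule.mem_sup.1 hx
    obtain ⟨y, hyI, y', hy', rfl⟩ := Submodule.mem_sup.1 hy
    obtain ⟨s, rfl⟩ := Submodule.mem_span_singleton.1 hx'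
    obtain ⟨t, rfl⟩ := Submodule.mem_span_singleton.1 hy'
    have e : B x β = 0 := (hB.eq β x).symm.trans (h x hxI)
    simp [hI.1 x hxI y hyI, h y hyI, hβ.2, e]
  · refine le_antisymm (Submodule.span_le.2 Set.inter_subset_right) (sup_le ?_ ?_)
    · conv_lhs => rw [← hI.2]
      exact Submodule.span_mono fun x hx => ⟨hx.1, Submodule.mem_sup_left hx.2⟩
    · rw [Submodule.span_singleton_le_iff_mem]
      exact Submodule.subset_span
        ⟨hβ, Submodule.mem_sup_right (Submodule.mem_span_singleton_self β)⟩

theorem span_mem_isoSpans {S : Set V} (hS : S ⊆ isoRoots B Δ)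
    (h : ∀ α ∈ S, ∀ β ∈ S, B α β = 0) : Submodule.span ℂ S ∈ isoSpans B Δ := by
  constructor
  · intro x hx y hy
    induction hx, hy using Submodule.span_induction₂ with
    | mem_mem x y hx hy => exact h x hx y hy
    | zero_left => simp
    | zero_right => simp
    | add_left _ _ _ _ _ _ h1 h2 => simp [h1, h2]
    | add_right _ _ _ _ _ _ h1 h2 => simp [h1, h2]
    | smul_left _ _ _ _ _ h => simp [h]
    | smul_right _ _ _ _ _ h => simp [h]
  · exact le_antisymm (Submodule.span_le.2 Set.inter_subset_right)
      (Submodule.span_mono fun x hx => ⟨hS hx, Submodule.subset_span hx⟩)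

theorem exists_isoRoot_ne {I : Submodule ℂ V} (hI : I ∈ isoSpans B Δ) (φ : Module.Dual ℂ V)
    (h : ∃ y ∈ I, φ y ≠ 0) : ∃ α ∈ isoRoots B Δ, α ∈ I ∧ φ α ≠ 0 := by
  by_contra! hc
  obtain ⟨y, hy, hy'⟩ := h
  have : Submodule.span ℂ (isoRoots B Δ ∩ I) ≤ LinearMap.ker φ :=
    Submodule.span_le.2 fun α hα => hc α hα.1 hα.2
  rw [hI.2] at this
  exact hy' (this hy)

namespace IsWGRS

variable (hΔ : IsWGRS B Δ)
include hΔ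

theorem finite_iso : (isoRoots B Δ).Finite := hΔ.finite.subset fun _ h => h.1

theorem finite_aniso : (anisoRoots B Δ).Finite := hΔ.finite.subset fun _ h => h.1

/-- An isotropic span is recovered from the finite set of isotropic roots in it. -/
theorem finite_isoSpans : (isoSpans B Δ).Finite := by
  refine Set.Finite.of_finite_image (f := fun I : Submodule ℂ V => isoRoots B Δ ∩ I)
    (hΔ.finite_iso.finite_subsets.subset ?_) ?_
  · rintro _ ⟨I, -, rfl⟩
    exact Set.inter_subset_left
  · intro I hI J hJ h
    rw [← hI.2, ← hJ.2]
    exact congrArg _ h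

theorem map_mem_isoSpans (hB : B.IsSymm) {w : V ≃ₗ[ℂ] V} (hw : w ∈ rootWeyl B Δ)
    {I : Submodule ℂ V} (hI : I ∈ isoSpans B Δ) :
    I.map (w : V →ₗ[ℂ] V) ∈ isoSpans B Δ := by
  conv => rw [← hI.2, Submodule.map_span]
  refine span_mem_isoSpans ?_ ?_
  · rintro _ ⟨x, hx, rfl⟩
    exact hΔ.rootWeyl_mem_iso hB hw hx.1
  · rintro _ ⟨x, hx, rfl⟩ _ ⟨y, hy, rfl⟩
    exact (form_rootWeyl hB hw x y).trans (hI.1 x hx.2 y hy.2)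

/-- The isotropic spans that are maximal among those orthogonal to `x`, in terms of roots. -/
theorem exists_maximal_isoSpan (hB : B.IsSymm) {x : V} {I : Submodule ℂ V}
    (hI : I ∈ isoSpans B Δ) (hx : x ∈ B.orthogonal I) :
    ∃ J ∈ isoSpans B Δ, I ≤ J ∧ x ∈ B.orthogonal J ∧
      ∀ β ∈ isoRoots B Δ, B β x = 0 → (∀ y ∈ J, B β y = 0) → β ∈ J := by
  have hfin : {I ∈ isoSpans B Δ | x ∈ B.orthogonal I}.Finite :=
    hΔ.finite_isoSpans.subset fun _ h => h.1
  obtain ⟨J, hIJ, hJ⟩ := hfin.exists_le_maximal ⟨hI, hx⟩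
  refine ⟨J, hJ.prop.1, hIJ, hJ.prop.2, fun β hβ hβx hβJ => ?_⟩
  have h1 : J ⊔ Submodule.span ℂ {β} ≤ J := by
    refine hJ.le_of_ge ⟨sup_mem_isoSpans hB hJ.prop.1 hβ hβJ, ?_⟩ le_sup_left
    intro y hy
    obtain ⟨y, hyJ, y', hy', rfl⟩ := Submodule.mem_sup.1 hy
    obtain ⟨t, rfl⟩ := Submodule.mem_span_singleton.1 hy'
    have : B y x = 0 := hJ.prop.2 y hyJ
    change B _ x = 0
    simp [this, hβx]
  exact h1 (Submodule.mem_sup_right (Submodule.mem_span_singleton_self β))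

/-- The class of a point, in terms of a maximal isotropic span orthogonal to it. -/
theorem exists_of_rootRel (hB : B.IsSymm) {x y : V} {I : Submodule ℂ V} (hI : I ∈ isoSpans B Δ)
    (hx : x ∈ B.orthogonal I)
    (hmax : ∀ β ∈ isoRoots B Δ, B β x = 0 → (∀ y ∈ I, B β y = 0) → β ∈ I)
    (h : rootRel B Δ x y) : ∃ w ∈ rootWeyl B Δ, ∃ u ∈ I, y = w (x + u) := by
  -- It suffices that this set is stable under the Weyl group and under the admissible translations,
  -- since both kinds of moves are reversible.
  let C : Set V := {y | ∃ w ∈ rootWeyl B Δ, ∃ u ∈ I, y = w (x + u)}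
  have hW : ∀ y ∈ C, ∀ w ∈ rootWeyl B Δ, w y ∈ C := by
    rintro _ ⟨w', hw', u, hu, rfl⟩ w hw
    exact ⟨w * w', mul_mem hw hw', u, hu, rfl⟩
  have hT : ∀ y ∈ C, ∀ β ∈ isoRoots B Δ, B β y = 0 → ∀ c : ℂ, y + c • β ∈ C := by
    rintro _ ⟨w, hw, u, hu, rfl⟩ β' hβ' hβy c
    set β := w⁻¹ β' with hβ
    have hww : w β = β' := w.apply_symm_apply β'
    have hβi : β ∈ isoRoots B Δ := hΔ.rootWeyl_mem_iso hB (inv_mem hw) hβ'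
    have hz : B β (x + u) = 0 := by rwa [← form_rootWeyl hB hw, hww]
    suffices h : x + u + c • β ∈ C by
      have := hW _ h w hw
      rwa [map_add, map_smul, hww] at this
    by_cases ho : ∀ y ∈ I, B β y = 0
    · have : β ∈ I := hmax β hβi (by simpa [ho u hu] using hz) ho
      exact ⟨1, one_mem _, u + c • β, add_mem hu (I.smul_mem c this), by simp [add_assoc]⟩
    -- Translation along β is replaced by translation along a root α of I: the reflection in β + εα
    -- fixes x + u and sends α to -εβ, so the coefficient of α has to be -εc.
    · push Not at ho
      obtain ⟨α, hα, hαI, hne⟩ := exists_isoRoot_ne hI (B β) ho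
      have hne' : B α β ≠ 0 := by
        have : B β α = B α β := hB.eq β α
        rwa [← this]
      obtain ⟨ε, hε, hγ⟩ := hΔ.exists_sign hα hβi hne'
      have ha := form_add_smul_ne hB hα.2 hβi.2 hne' hε
      have hαz : B α (x + u) = 0 := orthogonal_add_mem hI.1 hx hu α hαI
      refine ⟨_, formReflection_mem_rootWeyl hγ ha, u - (ε * c) • α,
        sub_mem hu (I.smul_mem _ hαI), ?_⟩
      rw [← add_sub_assoc, map_sub, map_smul, formReflection_add_smul_left hB hα.2 hβi.2 hne' hε,
        formReflection_of_orthogonal ha (by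
          rw [map_add B, LinearMap.add_apply, hz, map_smul, LinearMap.smul_apply, hαz]; simp)]
      rcases hε with rfl | rfl <;> module
  have hstep : ∀ a b : V, rootRel B Δ a b → (a ∈ C ↔ b ∈ C) := by
    intro a b hab
    induction hab with
    | rel a b h =>
      rcases h with ⟨w, hw, rfl⟩ | ⟨α, hα, hα0, hα', c, rfl⟩
      · refine ⟨fun h => hW _ h w hw, fun h => ?_⟩
        have := hW _ h _ (inv_mem hw)
        rwa [show w⁻¹ (w a) = a from w.symm_apply_apply a] at this
      · have e : B α a = 0 := (hB.eq α a).trans hα'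
        refine ⟨fun h => hT _ h α ⟨hα, hα0⟩ e c, fun h => ?_⟩
        have := hT _ h α ⟨hα, hα0⟩ (by simp [e, hα0]) (-c)
        simpa using this
    | refl => exact Iff.rfl
    | symm _ _ _ h => exact h.symm
    | trans _ _ _ _ _ h1 h2 => exact h1.trans h2
  exact (hstep x y h).1 ⟨1, one_mem _, 0, zero_mem _, by simp⟩

omit hΔ in
theorem rootRel_rootWeyl {w : V ≃ₗ[ℂ] V} (hw : w ∈ rootWeyl B Δ) (x : V) :
    rootRel B Δ x (w x) :=
  Relation.EqvGen.rel _ _ (Or.inl ⟨w, hw, rfl⟩)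

omit hΔ in
-- Translations by multiples of single roots in I can be performed one after another, because x
-- stays in I^⊥.
theorem rootRel_add (hB : B.IsSymm) {I : Submodule ℂ V} (hI : I ∈ isoSpans B Δ) {x u : V}
    (hx : x ∈ B.orthogonal I) (hu : u ∈ I) : rootRel B Δ x (x + u) := by
  have h1 : ∀ u ∈ Submodule.span ℂ (isoRoots B Δ ∩ I),
      u ∈ I ∧ ∀ x ∈ B.orthogonal I, rootRel B Δ x (x + u) := by
    intro u hu
    induction hu using Submodule.closure_induction with
    | zero => exact ⟨zero_mem _, fun x _ => by rw [add_zero]; exact Relation.EqvGen.refl x⟩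
    | add u v _ _ hu hv =>
      refine ⟨add_mem hu.1 hv.1, fun x hx => ?_⟩
      rw [← add_assoc]
      exact (hu.2 x hx).trans _ _ _ (hv.2 _ (orthogonal_add_mem hI.1 hx hu.1))
    | smul_mem c v hv =>
      exact ⟨I.smul_mem c hv.2, fun x hx => Relation.EqvGen.rel _ _
        (Or.inr ⟨v, hv.1.1, hv.1.2, (hB.eq v x).symm.trans (hx v hv.2), c, rfl⟩)⟩
  exact (h1 u (by rwa [hI.2])).2 x hx

omit hΔ in
theorem rootRel_of_mem (hB : B.IsSymm) {I : Submodule ℂ V} (hI : I ∈ isoSpans B Δ)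
    {w : V ≃ₗ[ℂ] V} (hw : w ∈ rootWeyl B Δ) {x u : V} (hx : x ∈ B.orthogonal I) (hu : u ∈ I) :
    rootRel B Δ x (w (x + u)) :=
  (rootRel_add hB hI hx hu).trans _ _ _ (rootRel_rootWeyl hw _)

/-- The linear Lagrangian relations whose union is `rootRel`. -/
def _root_.LagrangianRelations.rootComponents (B : LinearMap.BilinForm ℂ V) (Δ : Set V) :
    Set (Submodule ℂ (V × V)) :=
  {L | ∃ w ∈ rootWeyl B Δ, ∃ I ∈ isoSpans B Δ, L = translationRel B w I}

theorem finite_rootComponents (hB : B.IsSymm) : (rootComponents B Δ).Finite := by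
  have h1 : (rootWeyl B Δ : Set (V ≃ₗ[ℂ] V)).Finite := hΔ.finite_rootWeyl hB
  refine (Set.Finite.image2 (translationRel B) h1 hΔ.finite_isoSpans).subset ?_
  rintro _ ⟨w, hw, I, hI, rfl⟩
  exact ⟨w, hw, I, hI, rfl⟩

theorem rootRel_iff (hB : B.IsSymm) (x y : V) :
    rootRel B Δ x y ↔ ∃ L ∈ rootComponents B Δ, (x, y) ∈ L := by
  constructor
  · intro h
    obtain ⟨I, hI, -, hx, hmax⟩ := hΔ.exists_maximal_isoSpan hB (x := x) bot_mem_isoSpans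
      (by intro y hy; rw [(Submodule.mem_bot ℂ).1 hy]; change B 0 x = 0; simp)
    obtain ⟨w, hw, u, hu, rfl⟩ := hΔ.exists_of_rootRel hB hI hx hmax h
    exact ⟨_, ⟨w, hw, I, hI, rfl⟩, mem_translationRel.2 ⟨hx, u, hu, rfl⟩⟩
  · rintro ⟨_, ⟨w, hw, I, hI, rfl⟩, h⟩
    obtain ⟨hx, u, hu, rfl⟩ := mem_translationRel.1 h
    exact rootRel_of_mem hB hI hw hx hu

omit hΔ in
theorem isLinearLagrangian_of_mem [FiniteDimensional ℂ V] (hB : B.IsSymm) (hnd : B.Nondegenerate)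
    {L : Submodule ℂ (V × V)} (hL : L ∈ rootComponents B Δ) : IsLinearLagrangian B L := by
  obtain ⟨w, hw, I, hI, rfl⟩ := hL
  exact isLinearLagrangian_translationRel hB hnd (form_rootWeyl hB hw) hI.1

theorem isLagrangianEquivalence_rootRel [FiniteDimensional ℂ V] (hB : B.IsSymm)
    (hnd : B.Nondegenerate) : IsLagrangianEquivalence B (rootRel B Δ) :=
  ⟨Relation.EqvGen.is_equivalence _, rootComponents B Δ,
    fun _ hL => isLinearLagrangian_of_mem hB hnd hL, hΔ.rootRel_iff hB⟩

theorem components_rootRel [FiniteDimensional ℂ V] (hB : B.IsSymm) (hnd : B.Nondegenerate) :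
    components B (rootRel B Δ) = rootComponents B Δ :=
  components_eq (hΔ.finite_rootComponents hB)
    (fun _ hL => isLinearLagrangian_of_mem hB hnd hL) (hΔ.rootRel_iff hB)

/-- All isotropic spans orthogonal to `z` can be moved into a maximal one by elements of the Weyl
group that fix `z`. -/
theorem exists_rootWeyl_map_le (hB : B.IsSymm) {z : V} {I : Submodule ℂ V} (hI : I ∈ isoSpans B Δ)
    (hz : z ∈ B.orthogonal I)
    (hmax : ∀ β ∈ isoRoots B Δ, B β z = 0 → (∀ y ∈ I, B β y = 0) → β ∈ I) {J : Submodule ℂ V}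
    (hJ : J ∈ isoSpans B Δ) (hzJ : z ∈ B.orthogonal J) :
    ∃ w ∈ rootWeyl B Δ, w z = z ∧ J.map (w : V →ₗ[ℂ] V) ≤ I := by
  induction hn : ((isoRoots B Δ ∩ J) \ I).ncard using Nat.strong_induction_on generalizing J with
  | _ n ih =>
  by_cases hsub : isoRoots B Δ ∩ J ⊆ I
  · refine ⟨1, one_mem _, rfl, ?_⟩
    have : J ≤ I := by rw [← hJ.2]; exact Submodule.span_le.2 hsub
    rintro _ ⟨x, hx, rfl⟩
    exact this hx
  · obtain ⟨β, ⟨hβ, hβJ⟩, hβI⟩ := Set.not_subset.1 hsub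
    have hβz : B β z = 0 := hzJ β hβJ
    have : ∃ y ∈ I, B β y ≠ 0 := by
      by_contra! hc
      exact hβI (hmax β hβ hβz hc)
    obtain ⟨α, hα, hαI, hne⟩ := exists_isoRoot_ne hI (B β) this
    have hne' : B α β ≠ 0 := by
      have : B β α = B α β := hB.eq β α
      rwa [← this]
    obtain ⟨ε, hε, hγ⟩ := hΔ.exists_sign hα hβ hne'
    have ha := form_add_smul_ne hB hα.2 hβ.2 hne' hε
    have hαz : B α z = 0 := hz α hαI
    set s := formReflection B _ ha with hs
    have hsW : s ∈ rootWeyl B Δ := formReflection_mem_rootWeyl hγ ha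
    have hsz : s z = z := formReflection_of_orthogonal ha (by simp [hβz, hαz])
    have hsβ : s β = -(ε • α) := formReflection_add_smul_right hB hα.2 hβ.2 hne' hε ha
    have hsJ : z ∈ B.orthogonal (J.map (s : V →ₗ[ℂ] V)) := by
      rintro _ ⟨x, hx, rfl⟩
      have := form_rootWeyl hB hsW x z
      rw [hsz] at this
      exact this.trans (hzJ x hx)
    -- The reflection fixes the roots of J that lie in I, as they are orthogonal to α and β, and it
    -- moves β into I. So the roots of the new span outside I come from old ones other than β.
    have hlt : ((isoRoots B Δ ∩ J.map (s : V →ₗ[ℂ] V)) \ I).ncard < n := by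
      have hfin : ((isoRoots B Δ ∩ J) \ I).Finite :=
        (hΔ.finite_iso.subset Set.inter_subset_left).subset Set.sdiff_subset
      have h1 : (isoRoots B Δ ∩ J.map (s : V →ₗ[ℂ] V)) \ I ⊆
          s '' (((isoRoots B Δ ∩ J) \ I) \ {β}) := by
        rintro _ ⟨⟨hx, x, hxJ, rfl⟩, hxI⟩
        have hxi : x ∈ isoRoots B Δ := by
          have := hΔ.rootWeyl_mem_iso hB (inv_mem hsW) hx
          exact (s.symm_apply_apply x) ▸ this
        refine ⟨x, ⟨⟨⟨hxi, hxJ⟩, fun hxI' => hxI ?_⟩, ?_⟩, rfl⟩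
        · have e : s x = x := formReflection_of_orthogonal ha (by
            simp [hJ.1 β hβJ x hxJ, hI.1 α hαI x hxI'])
          exact e.symm ▸ hxI'
        · rintro rfl
          apply hxI
          change s x ∈ I
          rw [hsβ]
          exact NegMemClass.neg_mem (I.smul_mem _ hαI)
      refine (Set.ncard_le_ncard h1 ((hfin.subset Set.sdiff_subset).image _)).trans_lt ?_
      refine (Set.ncard_image_le (hfin.subset Set.sdiff_subset)).trans_lt ?_
      rw [← hn]
      exact Set.ncard_sdiff_singleton_lt_of_mem ⟨⟨hβ, hβJ⟩, hβI⟩ hfin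
    obtain ⟨w, hw, hwz, hwJ⟩ := ih _ hlt (hΔ.map_mem_isoSpans hB hsW hJ) hsJ rfl
    refine ⟨w * s, mul_mem hw hsW, by rw [LinearEquiv.mul_apply, hsz, hwz], ?_⟩
    rintro _ ⟨x, hx, rfl⟩
    exact hwJ ⟨s x, ⟨x, hx, rfl⟩, rfl⟩

end IsWGRS

end RootSystems

end LagrangianRelations

namespace LagrangianRelations

universe u

/-! ### Numerators and denominators of the rational functions to be averaged. -/

section RootSystems

variable {V : Type u} [AddCommGroup V] [Module ℂ V]
variable {B : LinearMap.BilinForm ℂ V} {Δ : Set V}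

/-- A finite symmetric set without zero is the disjoint union of a half and its negative. -/
theorem exists_half_system (P : Set V) (hP : P.Finite) (hneg : ∀ b ∈ P, -b ∈ P) (h0 : 0 ∉ P) :
    ∃ Ψ : Finset V, (∀ b ∈ Ψ, b ∈ P) ∧ (∀ b ∈ P, b ∈ Ψ ∨ -b ∈ Ψ) ∧ ∀ b ∈ Ψ, -b ∉ Ψ := by
  classical
  -- Of b and -b, the half contains the one that comes first in a fixed well-order.
  refine ⟨{b ∈ hP.toFinset | WellOrderingRel b (-b)}, by simp +contextual, fun b hb => ?_, ?_⟩
  · have hne : b ≠ -b := fun h => by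
      have h2 : (2 : ℂ) • b = 0 := by rw [two_smul]; exact add_eq_zero_iff_eq_neg.2 h
      exact h0 (((smul_eq_zero.1 h2).resolve_left two_ne_zero) ▸ hb)
    simp only [Finset.mem_filter, Set.Finite.mem_toFinset, neg_neg]
    rcases trichotomous_of WellOrderingRel b (-b) with h | h | h
    · exact Or.inl ⟨hb, h⟩
    · exact absurd h hne
    · exact Or.inr ⟨hneg b hb, h⟩
  · intro b hb hb'
    simp only [Finset.mem_filter, neg_neg] at hb hb'
    exact asymm_of WellOrderingRel hb.2 hb'.2

namespace IsWGRS

variable (hΔ : IsWGRS B Δ)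
include hΔ

omit hΔ in
/-- An isotropic root in the plane of two isotropic roots `α` and `β`, and not orthogonal to `α`,
is a multiple of `β`. -/
theorem collinear_of_isotropic (hB : B.IsSymm) {α β b : V} (hα : B α α = 0) (hβ : B β β = 0)
    (h : B α β ≠ 0) (hb : B b b = 0) (hαb : B α b ≠ 0) (hs : b ∈ Submodule.span ℂ {α, β}) :
    ∃ t : ℂ, b = t • β := by
  obtain ⟨p, q, rfl⟩ := Submodule.mem_span_pair.1 hs
  have e : B β α = B α β := hB.eq β α
  simp only [map_add, LinearMap.add_apply, map_smul, LinearMap.smul_apply, smul_eq_mul, hα, hβ, e]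
    at hb hαb
  have hq : q ≠ 0 := by rintro rfl; simp at hαb
  have hp : p = 0 := by
    have : p * (q * B α β * 2) = 0 := by linear_combination hb
    exact (mul_eq_zero.1 this).resolve_right (by simp [hq, h])
  exact ⟨q, by simp [hp]⟩

/-- For each isotropic root `b` that is not orthogonal to the isotropic span `I`, an isotropic
root in `I`, depending only on the hyperplane of `I` orthogonal to `b`, and an anisotropic root in
the plane of the two. -/
theorem exists_partner (hB : B.IsSymm) {I : Submodule ℂ V} (hI : I ∈ isoSpans B Δ) :
    ∃ (a γ : V → V) (ε : V → ℂ), ∀ b ∈ isoRoots B Δ, (∃ y ∈ I, B b y ≠ 0) →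
      a b ∈ isoRoots B Δ ∧ a b ∈ I ∧ B b (a b) ≠ 0 ∧ (ε b = 1 ∨ ε b = -1) ∧
        γ b = b + ε b • a b ∧ γ b ∈ Δ ∧
        ∀ b', {α ∈ isoRoots B Δ ∩ I | B b α ≠ 0} = {α ∈ isoRoots B Δ ∩ I | B b' α ≠ 0} →
          a b = a b' := by
  let A : V → Set V := fun b => {α ∈ isoRoots B Δ ∩ I | B b α ≠ 0}
  -- The choice is made on subsets, so that the partner of b depends only on the set `A b` of
  -- isotropic roots of I not orthogonal to b.
  have hpick : ∃ a : Set V → V, ∀ X, X.Nonempty → a X ∈ X := by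
    classical
    exact ⟨fun X => if h : X.Nonempty then h.some else 0, fun X hX => by
      simp only [dif_pos hX]; exact hX.some_mem⟩
  obtain ⟨a, ha⟩ := hpick
  have hA : ∀ b, (∃ y ∈ I, B b y ≠ 0) → a (A b) ∈ A b := fun b hb => by
    obtain ⟨α, hα, hαI, hne⟩ := exists_isoRoot_ne hI (B b) hb
    exact ha _ ⟨α, ⟨hα, hαI⟩, hne⟩
  have hε : ∀ b, ∃ ε : ℂ, b ∈ isoRoots B Δ → (∃ y ∈ I, B b y ≠ 0) →
      (ε = 1 ∨ ε = -1) ∧ b + ε • a (A b) ∈ Δ := fun b => by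
    by_cases h : b ∈ isoRoots B Δ ∧ ∃ y ∈ I, B b y ≠ 0
    · have h1 := hA b h.2
      have e : B b (a (A b)) = B (a (A b)) b := hB.eq b _
      obtain ⟨ε, h2⟩ := hΔ.exists_sign h1.1.1 h.1 (e ▸ h1.2)
      exact ⟨ε, fun _ _ => h2⟩
    · exact ⟨0, fun h1 h2 => absurd ⟨h1, h2⟩ h⟩
  choose ε hε using hε
  refine ⟨fun b => a (A b), fun b => b + ε b • a (A b), ε, fun b hb hbI => ?_⟩
  have h1 := hA b hbI
  exact ⟨h1.1.1, h1.1.2, h1.2, (hε b hb hbI).1, rfl, (hε b hb hbI).2,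
    fun b' hb' => congrArg a hb'⟩

/-- Data for the construction of invariants: `Ψ` consists of isotropic roots not orthogonal to
the isotropic span `I`, one of each pair `±b`, and the anisotropic roots `γ b` are such that the
quotient of the products of the `b` and of the `γ b` is invariant under translations by an
isotropic root in `I` on its orthogonal complement. -/
theorem exists_denominators (hB : B.IsSymm) {I : Submodule ℂ V} (hI : I ∈ isoSpans B Δ) :
    ∃ (Ψ : Finset V) (γ : V → V),
      (∀ b ∈ Ψ, b ∈ isoRoots B Δ ∧ γ b ∈ anisoRoots B Δ) ∧
      (∀ b ∈ isoRoots B Δ, (∃ y ∈ I, B b y ≠ 0) → b ∈ Ψ ∨ -b ∈ Ψ) ∧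
      (∀ b ∈ Ψ, ∀ b' ∈ Ψ, ∀ t : ℂ, γ b' = t • γ b → b = b') ∧
      (∀ b ∈ Ψ, ∀ x ∈ B.orthogonal I, B b x = B (γ b) x) ∧
      ∀ α ∈ isoRoots B Δ, α ∈ I → ∀ x, B α x = 0 → ∀ c : ℂ,
        (∏ b ∈ Ψ, B b (x + c • α)) * ∏ b ∈ Ψ, B (γ b) x =
          (∏ b ∈ Ψ, B b x) * ∏ b ∈ Ψ, B (γ b) (x + c • α) := by
  classical
  obtain ⟨a, γ, ε, hp⟩ := hΔ.exists_partner hB hI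
  let P : Set V := {b ∈ isoRoots B Δ | ∃ y ∈ I, B b y ≠ 0}
  obtain ⟨Ψ, hΨP, hΨ, hΨneg⟩ := exists_half_system P (hΔ.finite_iso.subset fun _ h => h.1)
    (fun b ⟨h1, y, hy, h2⟩ => ⟨hΔ.neg_mem_iso h1, y, hy, by simpa using h2⟩)
    (fun h => hΔ.zero_notMem h.1.1)
  have eq_of_sign : ∀ b ∈ Ψ, ∀ b' ∈ Ψ, (b' = b ∨ b' = -b) → b = b' := by
    rintro b hb _ hb' (rfl | rfl)
    · rfl
    · exact absurd hb' (hΨneg b hb)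
  have γI : ∀ b ∈ P, ∀ y ∈ I, B (γ b) y = B b y := by
    intro b hb y hy
    obtain ⟨h1, h2, -, -, h5, -⟩ := hp b hb.1 hb.2
    rw [h5, map_add, LinearMap.add_apply, map_smul, LinearMap.smul_apply, hI.1 _ h2 _ hy]
    simp
  have symm : ∀ x y, B x y = B y x := fun x y => hB.eq x y
  have γan : ∀ b ∈ P, γ b ∈ anisoRoots B Δ := by
    intro b hb
    obtain ⟨h1, h2, h3, h4, h5, h6, -⟩ := hp b hb.1 hb.2
    refine ⟨h6, ?_⟩
    rw [h5]
    exact form_add_smul_ne hB h1.2 hb.1.2 (symm b _ ▸ h3) h4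
  -- On I the forms of b and `γ b` agree, so collinear `γ b` and `γ b'` force a common partner.
  -- Isotropy of b' = t γ_b - ε' a_b then gives b' = tb, whence b' = ±b by `smul_root`.
  have γinj : ∀ b ∈ P, ∀ b' ∈ P, ∀ t : ℂ, γ b' = t • γ b → b' = b ∨ b' = -b := by
    intro b hb b' hb' t ht
    obtain ⟨h1, h2, h3, h4, h5, h6, h7⟩ := hp b hb.1 hb.2
    obtain ⟨h1', h2', h3', h4', h5', h6', h7'⟩ := hp b' hb'.1 hb'.2
    have ht0 : t ≠ 0 := by
      rintro rfl
      exact hΔ.ne_zero h6' (by rw [ht, zero_smul])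
    have haa : a b = a b' := h7 b' (by
      ext α
      refine and_congr_right fun hα => ?_
      rw [← γI b hb α hα.2, ← γI b' hb' α hα.2, ht, map_smul, LinearMap.smul_apply, smul_eq_mul]
      simp [ht0])
    have key : t * ε b = ε b' := by
      have e1 : b' = t • γ b - ε b' • a b := by rw [← ht, h5', haa]; abel
      have e2 : B b' b' = 0 := hb'.1.2
      have e3 : B (γ b) (γ b) = 2 * ε b * B (a b) b := by
        rw [h5]; exact form_add_smul hB h1.2 hb.1.2 _
      have e4 : B (γ b) (a b) = B (a b) b := by rw [γI b hb _ h2, symm]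
      have e5 : B (a b) (γ b) = B (a b) b := by rw [symm, e4]
      rw [e1] at e2
      simp only [map_sub, LinearMap.sub_apply, map_smul, LinearMap.smul_apply, smul_eq_mul, e3, e4,
        e5, h1.2] at e2
      have : 2 * t * B (a b) b * (t * ε b - ε b') = 0 := by linear_combination e2
      exact sub_eq_zero.1 ((mul_eq_zero.1 this).resolve_left
        (by simp [ht0, symm (a b) b, h3]))
    have e : b' = t • b := by
      have : b' = t • γ b - ε b' • a b := by rw [← ht, h5', haa]; abel
      rw [this, h5, ← key]; module
    have := hΔ.smul_root hB h1 hb.1 (symm b _ ▸ h3) (t := t) (by rw [← e]; exact hb'.1.1)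
    rwa [← e] at this
  refine ⟨Ψ, γ, fun b hb => ⟨(hΨP b hb).1, γan b (hΨP b hb)⟩, fun b hb hbI => hΨ b ⟨hb, hbI⟩,
    fun b hb b' hb' t ht => eq_of_sign b hb b' hb' (γinj b (hΨP b hb) b' (hΨP b' hb') t ht),
    fun b hb x hx => ?_, ?_⟩
  · obtain ⟨h1, h2, -, -, h5, -⟩ := hp b (hΨP b hb).1 (hΨP b hb).2
    have : B (a b) x = 0 := hx _ h2
    rw [h5, map_add, LinearMap.add_apply, map_smul, LinearMap.smul_apply, this]
    simp
  intro α hα hαI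
  let s : V → V := fun b => α - (2 * B (γ b) α / B (γ b) (γ b)) • γ b
  -- the images of `α` under the reflections in the roots `γ b`
  have hs : ∀ b ∈ P, B α b ≠ 0 → s b ∈ isoRoots B Δ ∧ B α (s b) ≠ 0 ∧
      (∀ y ∈ I, B (s b) y ≠ 0 ↔ B b y ≠ 0) ∧ γ b ∈ Submodule.span ℂ {α, s b} ∧
      ∃ k : ℂ, ∀ x, B α x = 0 → B (γ b) x = k * B (s b) x := by
    intro b hb hαb
    have hγ := γan b hb
    have hαγ : B (γ b) α ≠ 0 := by rw [γI b hb α hαI, symm]; exact hαb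
    set k := 2 * B (γ b) α / B (γ b) (γ b) with hk
    have hk0 : k ≠ 0 := div_ne_zero (mul_ne_zero two_ne_zero hαγ) hγ.2
    have hsb : s b = α - k • γ b := rfl
    have hsb' : formReflection B (γ b) hγ.2 α = s b := formReflection_apply B _ hγ.2 α
    refine ⟨?_, ?_, ?_, ?_, -k⁻¹, ?_⟩
    · rw [← hsb']
      exact hΔ.rootWeyl_mem_iso hB (formReflection_mem_rootWeyl hγ.1 hγ.2) hα
    · rw [hsb, map_sub, map_smul, hα.2, symm α]
      simp [hk0, hαγ]
    · intro y hy
      rw [hsb, map_sub, LinearMap.sub_apply, map_smul, LinearMap.smul_apply, hI.1 α hαI y hy,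
        γI b hb y hy]
      simp [hk0]
    · refine Submodule.mem_span_pair.2 ⟨k⁻¹, -k⁻¹, ?_⟩
      rw [hsb, smul_sub, smul_smul, neg_mul, inv_mul_cancel₀ hk0]
      module
    · intro x hx
      rw [hsb, map_sub, LinearMap.sub_apply, map_smul, LinearMap.smul_apply, hx, smul_eq_mul]
      field_simp
      ring
  -- If `γ b` and `γ b'` are not collinear, `collinear_of_mem_span_pair` makes every isotropic root
  -- of I not orthogonal to `s b` a multiple of α. In particular the common partner is one, so b and
  -- b' lie in the plane of α and `s b`. Being isotropic and not orthogonal to α, they are multiples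
  -- of `s b`.
  have sinj : ∀ b ∈ P, ∀ b' ∈ P, B α b ≠ 0 → B α b' ≠ 0 → (s b' = s b ∨ s b' = -s b) →
      b' = b ∨ b' = -b := by
    intro b hb b' hb' hαb hαb' hss
    obtain ⟨s1, s2, s3, s4, -⟩ := hs b hb hαb
    obtain ⟨s1', s2', s3', s4', -⟩ := hs b' hb' hαb'
    by_cases hc : ∃ t : ℂ, γ b' = t • γ b
    · obtain ⟨t, ht⟩ := hc
      exact γinj b hb b' hb' t ht
    have s4' : γ b' ∈ Submodule.span ℂ {α, s b} := by
      rcases hss with h | h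
      · rwa [h] at s4'
      · rw [h] at s4'
        obtain ⟨p, q, h1⟩ := Submodule.mem_span_pair.1 s4'
        exact Submodule.mem_span_pair.2 ⟨p, -q, by rw [← h1]; module⟩
    have hcol : ∀ α' ∈ isoRoots B Δ, α' ∈ I → B (s b) α' ≠ 0 → ∃ t : ℂ, α' = t • α := by
      intro α' hα' hα'I h
      by_contra! hne
      exact hc (hΔ.collinear_of_mem_span_pair hB hα hα' s1 (hI.1 α hαI α' hα'I) hne s2
        (by rwa [symm]) (γan b hb) (γan b' hb') s4 s4')
    obtain ⟨h1, h2, h3, h4, h5, h6, h7⟩ := hp b hb.1 hb.2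
    obtain ⟨h1', h2', h3', h4', h5', h6', h7'⟩ := hp b' hb'.1 hb'.2
    have haa : a b = a b' := h7 b' (by
      ext σ
      refine and_congr_right fun hσ => ?_
      rw [← s3 σ hσ.2, ← s3' σ hσ.2]
      rcases hss with h | h <;> simp [h])
    obtain ⟨t, ht⟩ := hcol _ h1 h2 ((s3 _ h2).2 h3)
    have hmem : ∀ c ∈ P, γ c = c + ε c • a c → a c = t • α →
        γ c ∈ Submodule.span ℂ {α, s b} → c ∈ Submodule.span ℂ {α, s b} := by
      intro c hc e1 e2 h
      have : c = γ c - (ε c * t) • α := by rw [e1, e2]; module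
      rw [this]
      exact sub_mem h (Submodule.smul_mem _ _ (Submodule.subset_span (by simp)))
    obtain ⟨p, hp1⟩ := collinear_of_isotropic hB hα.2 s1.2 s2 hb.1.2 hαb
      (hmem b hb h5 ht s4)
    obtain ⟨q, hq1⟩ := collinear_of_isotropic hB hα.2 s1.2 s2 hb'.1.2 hαb'
      (hmem b' hb' h5' (haa ▸ ht) s4')
    have hp0 : p ≠ 0 := by
      rintro rfl
      exact hΔ.ne_zero hb.1.1 (by rw [hp1, zero_smul])
    have e : b' = (q / p) • b := by
      rw [hq1]
      nth_rewrite 2 [hp1]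
      rw [smul_smul, div_mul_cancel₀ _ hp0]
    have := hΔ.smul_root hB hα hb.1 hαb (t := q / p) (by rw [← e]; exact hb'.1.1)
    rwa [← e] at this
  -- Only the factors indexed by this set change under translation along α.
  set 𝒜 := Ψ.filter fun b => B α b ≠ 0 with h𝒜
  have m𝒜 : ∀ b ∈ 𝒜, b ∈ Ψ ∧ b ∈ P ∧ B α b ≠ 0 := fun b hb => by
    rw [h𝒜, Finset.mem_filter] at hb
    exact ⟨hb.1, hΨP b hb.1, hb.2⟩
  have hτ : ∀ b, ∃ c, b ∈ 𝒜 → c ∈ 𝒜 ∧ (c = s b ∨ c = -s b) := by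
    intro b
    by_cases hb : b ∈ 𝒜
    · obtain ⟨b1, b2, b3⟩ := m𝒜 b hb
      obtain ⟨s1, s2, -⟩ := hs b b2 b3
      rcases hΨ (s b) ⟨s1, α, hαI, by rwa [symm]⟩ with h | h
      · exact ⟨s b, fun _ => ⟨Finset.mem_filter.2 ⟨h, s2⟩, Or.inl rfl⟩⟩
      · exact ⟨-s b, fun _ => ⟨Finset.mem_filter.2 ⟨h, by simpa using s2⟩, Or.inr rfl⟩⟩
    · exact ⟨0, fun h => absurd h hb⟩
  choose τ hτ using hτ
  have τinj : Set.InjOn τ 𝒜 := by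
    intro b hb b' hb' h
    obtain ⟨b1, b2, b3⟩ := m𝒜 b hb
    obtain ⟨b1', b2', b3'⟩ := m𝒜 b' hb'
    refine eq_of_sign b b1 b' b1' (sinj b b2 b' b2' b3 b3' ?_)
    rcases (hτ b hb).2 with h1 | h1 <;> rcases (hτ b' hb').2 with h2 | h2 <;>
      rw [h, h2] at h1
    · exact Or.inl h1
    · exact Or.inr (by rw [← h1, neg_neg])
    · exact Or.inr h1
    · exact Or.inl (neg_injective h1)
  have τsurj : Set.SurjOn τ 𝒜 𝒜 :=
    Finset.surjOn_of_injOn_of_card_le τ (fun b hb => (hτ b hb).1) τinj le_rfl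
  have hk : ∀ b, ∃ k : ℂ, b ∈ 𝒜 → ∀ x, B α x = 0 → B (γ b) x = k * B (τ b) x := by
    intro b
    by_cases hb : b ∈ 𝒜
    · obtain ⟨b1, b2, b3⟩ := m𝒜 b hb
      obtain ⟨-, -, -, -, k, hk⟩ := hs b b2 b3
      rcases (hτ b hb).2 with h | h
      · exact ⟨k, fun _ x hx => by rw [h, hk x hx]⟩
      · exact ⟨-k, fun _ x hx => by rw [h, hk x hx]; simp⟩
    · exact ⟨0, fun h => absurd h hb⟩
  choose k hk using hk
  -- On α^⊥ the form of `γ b` is a multiple of that of `τ b`, which is ± `s b`, and τ permutes 𝒜.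
  -- Thus the two partial products differ by a constant there, and their quotient cannot change
  -- under translation.
  have main : ∀ x, B α x = 0 → ∏ b ∈ 𝒜, B (γ b) x = (∏ b ∈ 𝒜, k b) * ∏ b ∈ 𝒜, B b x := by
    intro x hx
    rw [Finset.prod_congr rfl fun b hb => hk b hb x hx, Finset.prod_mul_distrib]
    congr 1
    exact Finset.prod_nbij τ (fun b hb => (hτ b hb).1) τinj τsurj fun _ _ => rfl
  intro x hx c
  have hx' : B α (x + c • α) = 0 := by simp [hx, hα.2]
  have split : ∀ f : V → V, ∀ x, ∏ b ∈ Ψ, B (f b) x =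
      (∏ b ∈ 𝒜, B (f b) x) * ∏ b ∈ Ψ.filter (fun b => ¬ B α b ≠ 0), B (f b) x := fun f x =>
    (Finset.prod_filter_mul_prod_filter_not Ψ _ _).symm
  have c1 : ∏ b ∈ Ψ.filter (fun b => ¬ B α b ≠ 0), B b (x + c • α) =
      ∏ b ∈ Ψ.filter (fun b => ¬ B α b ≠ 0), B b x := by
    refine Finset.prod_congr rfl fun b hb => ?_
    rw [Finset.mem_filter, not_not] at hb
    simp [symm b α, hb.2]
  have c2 : ∏ b ∈ Ψ.filter (fun b => ¬ B α b ≠ 0), B (γ b) (x + c • α) =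
      ∏ b ∈ Ψ.filter (fun b => ¬ B α b ≠ 0), B (γ b) x := by
    refine Finset.prod_congr rfl fun b hb => ?_
    rw [Finset.mem_filter, not_not] at hb
    rw [map_add, map_smul, γI b (hΨP b hb.1) α hαI, symm b α, hb.2]
    simp
  rw [split (fun b => b) x, split (fun b => b) (x + c • α), split γ x, split γ (x + c • α),
    main x hx, main _ hx', c1, c2]
  ring

end IsWGRS

end RootSystems

end LagrangianRelations

namespace LagrangianRelations

universe u

/-! ### Semi-invariant products of anisotropic roots and Weyl group averages. -/

section RootSystems

variable {V : Type u} [AddCommGroup V] [Module ℂ V]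
variable {B : LinearMap.BilinForm ℂ V} {Δ : Set V}

/-- The product of the linear forms given by a finite set of vectors. -/
noncomputable def formProd (B : LinearMap.BilinForm ℂ V) (Γ : Finset V) (x : V) : ℂ :=
  ∏ g ∈ Γ, B g x

theorem formProd_mem_polyFun (B : LinearMap.BilinForm ℂ V) (Γ : Finset V) :
    formProd B Γ ∈ polyFun V :=
  prod_mem_polyFun Γ _ fun g _ => form_mem_polyFun B g

theorem exists_formProd_ne_zero (M : Submodule ℂ V) (Γ : Finset V)
    (h : ∀ g ∈ Γ, ∃ v ∈ M, B g v ≠ 0) : ∃ v ∈ M, formProd B Γ v ≠ 0 := by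
  obtain ⟨v, hv⟩ := exists_prod_ne_zero Γ (fun g (v : M) => B g v)
    (fun g _ => restrict_mem_polyFun M (form_mem_polyFun B g)) (fun g hg => by
      obtain ⟨v, hv, hne⟩ := h g hg
      exact ⟨⟨v, hv⟩, hne⟩)
  exact ⟨v, v.2, hv⟩

theorem exists_orthogonal_of_not_collinear (hnd : B.Nondegenerate) {a b : V} (ha : a ≠ 0)
    (h : ∀ t : ℂ, b ≠ t • a) : ∃ v, B a v = 0 ∧ B b v ≠ 0 := by
  by_contra! hc
  obtain ⟨v₀, hv₀⟩ : ∃ v₀, B a v₀ ≠ 0 := by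
    by_contra! h0
    exact ha (hnd.1 a h0)
  apply h (B b v₀ / B a v₀)
  rw [← sub_eq_zero]
  refine hnd.1 _ fun v => ?_
  have := hc (v - (B a v / B a v₀) • v₀) (by simp [hv₀])
  simp only [map_sub, LinearMap.sub_apply, map_smul, LinearMap.smul_apply, smul_eq_mul] at this ⊢
  rw [← this]
  field_simp

theorem exists_mem_orthogonal_of_notMem [FiniteDimensional ℂ V] (hB : B.IsSymm)
    (hnd : B.Nondegenerate) {I : Submodule ℂ V} {g : V} (hg : g ∉ I) :
    ∃ v ∈ B.orthogonal I, B g v ≠ 0 := by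
  by_contra! hc
  apply hg
  rw [← LinearMap.BilinForm.orthogonal_orthogonal hnd hB.isRefl I]
  exact fun v hv => (hB.eq v g).trans (hc v hv)

namespace IsWGRS

variable (hΔ : IsWGRS B Δ)
include hΔ

/-- A maximal set of pairwise non-collinear anisotropic roots containing G meets every anisotropic
root line. Prescribing G later makes the roots γ_b factors of the common denominator. -/
theorem exists_aniso_representatives (G : Finset V) (hG : ∀ g ∈ G, g ∈ anisoRoots B Δ)
    (hGG : ∀ g ∈ G, ∀ g' ∈ G, ∀ t : ℂ, g' = t • g → g = g') :
    ∃ Γ : Finset V, G ⊆ Γ ∧ (∀ g ∈ Γ, g ∈ anisoRoots B Δ) ∧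
      (∀ g ∈ Γ, ∀ g' ∈ Γ, ∀ t : ℂ, g' = t • g → g = g') ∧
      ∀ δ ∈ anisoRoots B Δ, ∃ g ∈ Γ, ∃ t : ℂ, δ = t • g := by
  classical
  let 𝒢 : Set (Finset V) := {Γ | (∀ g ∈ Γ, g ∈ anisoRoots B Δ) ∧
    ∀ g ∈ Γ, ∀ g' ∈ Γ, ∀ t : ℂ, g' = t • g → g = g'}
  have hfin : 𝒢.Finite := by
    refine (hΔ.finite_aniso.toFinset.powerset.finite_toSet).subset fun Γ hΓ => ?_
    rw [Finset.mem_coe, Finset.mem_powerset]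
    intro g hg
    simpa using hΓ.1 g hg
  obtain ⟨Γ, hGΓ, hΓ⟩ := hfin.exists_le_maximal (a := G) ⟨hG, hGG⟩
  refine ⟨Γ, hGΓ, hΓ.prop.1, hΓ.prop.2, fun δ hδ => ?_⟩
  by_contra! hc
  have h1 : insert δ Γ ≤ Γ := by
    refine hΓ.le_of_ge ⟨?_, ?_⟩ (Finset.subset_insert _ _)
    · intro g hg
      rcases Finset.mem_insert.1 hg with rfl | hg
      · exact hδ
      · exact hΓ.prop.1 g hg
    · intro g hg g' hg' t ht
      rcases Finset.mem_insert.1 hg with rfl | hg1 <;>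
        rcases Finset.mem_insert.1 hg' with rfl | hg2
      · rfl
      · exfalso
        have ht0 : t ≠ 0 := by
          rintro rfl
          exact hΔ.ne_zero (hΓ.prop.1 g' hg2).1 (by rw [ht, zero_smul])
        exact hc g' hg2 t⁻¹ (by rw [ht, smul_smul, inv_mul_cancel₀ ht0, one_smul])
      · exact absurd ht (hc g hg1 t)
      · exact hΓ.prop.2 g hg1 g' hg2 t ht
  exact hc δ (h1 (Finset.mem_insert_self _ _)) 1 (one_smul _ _).symm

/-- The product of representatives of the anisotropic root lines is semi-invariant under the Weyl
group, with a character that is `-1` on reflections. -/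
theorem exists_character (hB : B.IsSymm) (hnd : B.Nondegenerate) {Γ : Finset V}
    (hΓ : ∀ g ∈ Γ, g ∈ anisoRoots B Δ)
    (hΓΓ : ∀ g ∈ Γ, ∀ g' ∈ Γ, ∀ t : ℂ, g' = t • g → g = g')
    (hΓΔ : ∀ δ ∈ anisoRoots B Δ, ∃ g ∈ Γ, ∃ t : ℂ, δ = t • g) :
    ∃ χ : (V ≃ₗ[ℂ] V) → ℂ,
      (∀ w ∈ rootWeyl B Δ, χ w ≠ 0 ∧ ∀ x, formProd B Γ (w x) = χ w * formProd B Γ x) ∧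
      (∀ w ∈ rootWeyl B Δ, ∀ v ∈ rootWeyl B Δ, χ (w * v) = χ w * χ v) ∧
      ∀ g ∈ Γ, ∃ s ∈ rootWeyl B Δ, χ s = -1 ∧ ∀ x, B g x = 0 → s x = x := by
  classical
  obtain ⟨v₀, -, hv₀⟩ := exists_formProd_ne_zero (B := B) ⊤ Γ
    (fun g hg => ⟨g, trivial, (hΓ g hg).2⟩)
  have hex : ∀ w : V ≃ₗ[ℂ] V, ∃ χ : ℂ, w ∈ rootWeyl B Δ →
      χ ≠ 0 ∧ ∀ x, formProd B Γ (w x) = χ * formProd B Γ x := by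
    intro w
    by_cases hw : w ∈ rootWeyl B Δ
    swap
    · exact ⟨0, fun h => absurd h hw⟩
    -- The element `w⁻¹` permutes the root lines, hence the representatives up to scalars; the
    -- product of these scalars is the character value.
    have h1 : ∀ g, ∃ g' : V, ∃ t : ℂ, g ∈ Γ → g' ∈ Γ ∧ w⁻¹ g = t • g' := by
      intro g
      by_cases hg : g ∈ Γ
      · obtain ⟨g', hg', t, ht⟩ := hΓΔ _ (hΔ.rootWeyl_mem_aniso hB (inv_mem hw) (hΓ g hg))
        exact ⟨g', t, fun _ => ⟨hg', ht⟩⟩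
      · exact ⟨0, 0, fun h => absurd h hg⟩
    choose ρ t hρ using h1
    have ht0 : ∀ g ∈ Γ, t g ≠ 0 := by
      intro g hg h0
      have := (hρ g hg).2
      rw [h0, zero_smul] at this
      exact hΔ.ne_zero (hΔ.rootWeyl_mem (inv_mem hw) (hΓ g hg).1) this
    have inj : Set.InjOn ρ Γ := by
      intro g hg g' hg' h
      refine hΓΓ g hg g' hg' (t g' / t g) ((w⁻¹).injective ?_)
      rw [map_smul, (hρ g hg).2, (hρ g' hg').2, smul_smul, div_mul_cancel₀ _ (ht0 g hg), h]
    have surj : Set.SurjOn ρ Γ Γ :=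
      Finset.surjOn_of_injOn_of_card_le ρ (fun g hg => (hρ g hg).1) inj le_rfl
    refine ⟨∏ g ∈ Γ, t g, fun _ => ⟨Finset.prod_ne_zero_iff.2 ht0, fun x => ?_⟩⟩
    have h2 : ∏ g ∈ Γ, B (ρ g) x = ∏ g ∈ Γ, B g x :=
      Finset.prod_nbij ρ (fun g hg => (hρ g hg).1) inj surj fun _ _ => rfl
    rw [formProd, formProd, ← h2, ← Finset.prod_mul_distrib]
    refine Finset.prod_congr rfl fun g hg => ?_
    rw [← form_rootWeyl_inv hB hw, (hρ g hg).2, map_smul, LinearMap.smul_apply, smul_eq_mul]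
  choose χ hχ using hex
  refine ⟨χ, fun w hw => hχ w hw, fun w hw v hv => ?_, fun g hg => ?_⟩
  · have h1 := (hχ _ (mul_mem hw hv)).2 v₀
    rw [LinearEquiv.mul_apply, (hχ w hw).2, (hχ v hv).2, ← mul_assoc] at h1
    exact (mul_right_cancel₀ hv₀ h1).symm
  · have hgan := hΓ g hg
    set s := formReflection B g hgan.2 with hs
    have hsW : s ∈ rootWeyl B Δ := formReflection_mem_rootWeyl hgan.1 hgan.2
    have hsx : ∀ x, B g x = 0 → s x = x := fun x hx => formReflection_of_orthogonal hgan.2 hx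
    refine ⟨s, hsW, ?_, hsx⟩
    have hprod : ∀ x, formProd B Γ x = B g x * formProd B (Γ.erase g) x := fun x =>
      (Finset.mul_prod_erase Γ (fun g => B g x) hg).symm
    have hBg : ∀ x, B g (s x) = -B g x := by
      intro x
      have h1 : B g g ≠ 0 := hgan.2
      rw [hs, formReflection_apply, map_sub, map_smul, smul_eq_mul]
      field_simp
      ring
    obtain ⟨x₀, hx₀, hne⟩ := exists_formProd_ne_zero (B := B) (LinearMap.ker (B g)) (Γ.erase g)
      (fun g' hg' => by
        have hg'Γ := Finset.mem_of_mem_erase hg'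
        exact exists_orthogonal_of_not_collinear hnd (hΔ.ne_zero hgan.1) fun t ht =>
          Finset.ne_of_mem_erase hg' (hΓΓ g hg g' hg'Γ t ht).symm)
    -- The factor g changes sign under its reflection. After it is cancelled, the identity is
    -- evaluated at a point of g^⊥ outside the other hyperplanes, which the reflection fixes.
    have h2 := polyFun_cancel (d := fun x => B g x)
      (f := fun x => -formProd B (Γ.erase g) (s x))
      (g := fun x => χ s * formProd B (Γ.erase g) x) (form_mem_polyFun B g)
      (NegMemClass.neg_mem (comp_linear_mem_polyFun (s : V →ₗ[ℂ] V) (formProd_mem_polyFun B _)))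
      (mul_mem (const_mem_polyFun _) (formProd_mem_polyFun B _)) ⟨g, hgan.2⟩ (fun x => by
        have := (hχ s hsW).2 x
        rw [hprod, hprod, hBg] at this
        linear_combination this) x₀
    rw [hsx x₀ hx₀] at h2
    exact mul_right_cancel₀ hne (by linear_combination -h2)

/-- A rational function with simple poles along the anisotropic root hyperplanes has a polynomial
average over the Weyl group. -/
theorem exists_average (hB : B.IsSymm) (hnd : B.Nondegenerate) {Γ : Finset V}
    (hΓ : ∀ g ∈ Γ, g ∈ anisoRoots B Δ)
    (hΓΓ : ∀ g ∈ Γ, ∀ g' ∈ Γ, ∀ t : ℂ, g' = t • g → g = g')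
    (hΓΔ : ∀ δ ∈ anisoRoots B Δ, ∃ g ∈ Γ, ∃ t : ℂ, δ = t • g) [Fintype (rootWeyl B Δ)]
    {p : V → ℂ} (hp : p ∈ polyFun V) :
    ∃ f ∈ polyFun V, ∃ χ : rootWeyl B Δ → ℂ,
      (∀ w, χ w ≠ 0 ∧ ∀ x, formProd B Γ (w.1 x) = χ w * formProd B Γ x) ∧
      (∀ x, formProd B Γ x * f x = ∑ w : rootWeyl B Δ, (χ w)⁻¹ * p (w.1 x)) ∧
      ∀ w ∈ rootWeyl B Δ, ∀ x, f (w x) = f x := by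
  obtain ⟨χ, h1, h2, h3⟩ := hΔ.exists_character hB hnd hΓ hΓΓ hΓΔ
  have hpw : ∀ w : rootWeyl B Δ, (fun x => (χ w.1)⁻¹ * p (w.1 x)) ∈ polyFun V := fun w =>
    mul_mem (const_mem_polyFun _) (comp_linear_mem_polyFun (w.1 : V →ₗ[ℂ] V) hp)
  have hA : (fun x => ∑ w : rootWeyl B Δ, (χ w.1)⁻¹ * p (w.1 x)) ∈ polyFun V :=
    sum_mem_polyFun _ _ fun w _ => hpw w
  have key : ∀ v ∈ rootWeyl B Δ, ∀ x, ∑ w : rootWeyl B Δ, (χ w.1)⁻¹ * p (w.1 (v x)) =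
      χ v * ∑ w : rootWeyl B Δ, (χ w.1)⁻¹ * p (w.1 x) := by
    intro v hv x
    rw [Finset.mul_sum, ← Equiv.sum_comp (Equiv.mulRight (⟨v, hv⟩ : rootWeyl B Δ))
      (fun w => χ v * ((χ w.1)⁻¹ * p (w.1 x)))]
    refine Finset.sum_congr rfl fun w _ => ?_
    have hv0 := (h1 v hv).1
    have hw0 := (h1 w w.2).1
    simp only [Equiv.coe_mulRight, Subgroup.coe_mul, LinearEquiv.mul_apply, h2 w.1 w.2 v hv]
    field_simp
  -- On the hyperplane of g the semi-invariant sum equals its negative, because the reflection fixes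
  -- the point and has character -1. So the sum vanishes there and is divisible by the full product.
  obtain ⟨f, hf, hfA⟩ := exists_eq_prod_mul Γ (fun g => B g)
    (fun g hg g' hg' hne => exists_orthogonal_of_not_collinear hnd (hΔ.ne_zero (hΓ g' hg').1)
      fun t ht => hne (hΓΓ g' hg' g hg t ht).symm)
    (fun g hg h0 => (hΓ g hg).2 (by rw [h0]; rfl)) hA (fun g hg x hx => by
      obtain ⟨s, hs, hχs, hsx⟩ := h3 g hg
      have := key s hs x
      rw [hsx x hx, hχs] at this
      linear_combination (1 / 2 : ℂ) * this)
  refine ⟨f, hf, fun w => χ w.1, fun w => h1 w.1 w.2, fun x => (hfA x).symm, fun w hw x => ?_⟩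
  obtain ⟨v₀, -, hv₀⟩ := exists_formProd_ne_zero (B := B) ⊤ Γ
    (fun g hg => ⟨g, trivial, (hΓ g hg).2⟩)
  refine polyFun_cancel (d := formProd B Γ) (f := fun x => f (w x)) (formProd_mem_polyFun B Γ)
    (comp_linear_mem_polyFun (w : V →ₗ[ℂ] V) hf) hf ⟨v₀, hv₀⟩ (fun x => ?_) x
  have e1 : _ = formProd B Γ x * f x := hfA x
  have e2 : _ = formProd B Γ (w x) * f (w x) := hfA (w x)
  rw [(h1 w hw).2] at e2
  simp only [key w hw x] at e2
  have hw0 := (h1 w hw).1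
  exact mul_left_cancel₀ hw0 (by linear_combination χ w * e1 - e2)

end IsWGRS

end RootSystems

end LagrangianRelations

namespace LagrangianRelations

universe u

/-! ### Invariants with prescribed restriction to the orthogonal complement of an isotropic span. -/

section RootSystems

variable {V : Type u} [AddCommGroup V] [Module ℂ V]

/-- The isotropic roots outside the isotropic span `I` and orthogonal to it. -/
def outerRoots (B : LinearMap.BilinForm ℂ V) (Δ : Set V) (I : Submodule ℂ V) : Set V :=
  {b ∈ isoRoots B Δ | (∀ y ∈ I, B b y = 0) ∧ b ∉ I}

/-- The product of the linear forms given by the isotropic roots outside `I` and orthogonal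
to it. -/
noncomputable def spanDisc (B : LinearMap.BilinForm ℂ V) (Δ : Set V) (I : Submodule ℂ V)
    (x : V) : ℂ :=
  ∏ᶠ b ∈ outerRoots B Δ I, B b x

variable {B : LinearMap.BilinForm ℂ V} {Δ : Set V}

theorem map_rootWeyl_le_iff {w : V ≃ₗ[ℂ] V} {I J : Submodule ℂ V} :
    J.map (w : V →ₗ[ℂ] V) ≤ I ↔ J ≤ I.map ((w⁻¹ : V ≃ₗ[ℂ] V) : V →ₗ[ℂ] V) := by
  constructor
  · intro h x hx
    exact ⟨w x, h ⟨x, hx, rfl⟩, w.symm_apply_apply x⟩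
  · rintro h _ ⟨x, hx, rfl⟩
    obtain ⟨y, hy, rfl⟩ := h hx
    have : w (w⁻¹ y) = y := w.apply_symm_apply y
    exact this.symm ▸ hy

theorem map_eq_of_map_le [FiniteDimensional ℂ V] {w : V ≃ₗ[ℂ] V} {I : Submodule ℂ V}
    (h : I.map (w : V →ₗ[ℂ] V) ≤ I) : I.map (w : V →ₗ[ℂ] V) = I :=
  Submodule.eq_of_le_of_finrank_eq h (LinearEquiv.finrank_map_eq w I)

theorem map_inv_eq {w : V ≃ₗ[ℂ] V} {I : Submodule ℂ V} (h : I.map (w : V →ₗ[ℂ] V) = I) :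
    I.map ((w⁻¹ : V ≃ₗ[ℂ] V) : V →ₗ[ℂ] V) = I := by
  ext x
  constructor
  · rintro ⟨y, hy, rfl⟩
    rw [SetLike.mem_coe, ← h] at hy
    obtain ⟨z, hz, rfl⟩ := hy
    have : w⁻¹ (w z) = z := w.symm_apply_apply z
    exact this.symm ▸ hz
  · intro hx
    exact ⟨w x, h.le ⟨x, hx, rfl⟩, w.symm_apply_apply x⟩

theorem rootWeyl_mem_orthogonal (hB : B.IsSymm) {w : V ≃ₗ[ℂ] V} (hw : w ∈ rootWeyl B Δ)
    {I : Submodule ℂ V} {x : V} (hx : x ∈ B.orthogonal I) :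
    w x ∈ B.orthogonal (I.map (w : V →ₗ[ℂ] V)) := by
  rintro _ ⟨y, hy, rfl⟩
  exact (form_rootWeyl hB hw y x).trans (hx y hy)

namespace IsWGRS

variable (hΔ : IsWGRS B Δ)
include hΔ

theorem finite_outerRoots (I : Submodule ℂ V) : (outerRoots B Δ I).Finite :=
  hΔ.finite_iso.subset fun _ h => h.1

theorem spanDisc_eq (I : Submodule ℂ V) (x : V) :
    spanDisc B Δ I x = formProd B (hΔ.finite_outerRoots I).toFinset x :=
  finprod_mem_eq_finite_toFinset_prod _ (hΔ.finite_outerRoots I)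

theorem spanDisc_mem_polyFun (I : Submodule ℂ V) : spanDisc B Δ I ∈ polyFun V := by
  rw [funext (hΔ.spanDisc_eq I)]
  exact formProd_mem_polyFun _ _

theorem spanDisc_eq_zero_iff (I : Submodule ℂ V) (x : V) :
    spanDisc B Δ I x = 0 ↔ ∃ b ∈ outerRoots B Δ I, B b x = 0 := by
  rw [hΔ.spanDisc_eq, formProd, Finset.prod_eq_zero_iff]
  simp

omit hΔ in
theorem spanDisc_add {I : Submodule ℂ V} (x : V) {u : V} (hu : u ∈ I) :
    spanDisc B Δ I (x + u) = spanDisc B Δ I x :=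
  finprod_mem_congr rfl fun b hb => by rw [map_add, hb.2.1 u hu, add_zero]

theorem spanDisc_rootWeyl (hB : B.IsSymm) {I : Submodule ℂ V} {w : V ≃ₗ[ℂ] V}
    (hw : w ∈ rootWeyl B Δ) (hI : I.map (w : V →ₗ[ℂ] V) = I) (x : V) :
    spanDisc B Δ I (w x) = spanDisc B Δ I x := by
  have hmem : ∀ v ∈ rootWeyl B Δ, I.map (v : V →ₗ[ℂ] V) = I → ∀ b ∈ outerRoots B Δ I,
      v b ∈ outerRoots B Δ I := by
    intro v hv hvI b hb
    refine ⟨hΔ.rootWeyl_mem_iso hB hv hb.1, fun y hy => ?_, fun h => hb.2.2 ?_⟩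
    · rw [← hvI] at hy
      obtain ⟨y, hy, rfl⟩ := hy
      exact (form_rootWeyl hB hv b y).trans (hb.2.1 y hy)
    · rw [← hvI] at h
      obtain ⟨y, hy, h⟩ := h
      exact v.injective h ▸ hy
  symm
  refine finprod_mem_eq_of_bijOn w ⟨fun b hb => hmem w hw hI b hb, w.injective.injOn,
    fun b hb => ⟨w⁻¹ b, hmem _ (inv_mem hw) (map_inv_eq hI) b hb, w.apply_symm_apply b⟩⟩ ?_
  intro b hb
  exact (form_rootWeyl hB hw b x).symm

/-- Invariants with prescribed restriction, up to the factor `spanDisc B Δ I`, to the orthogonal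
complement of an isotropic span. -/
theorem exists_invariant [FiniteDimensional ℂ V] (hB : B.IsSymm) (hnd : B.Nondegenerate)
    {I : Submodule ℂ V} (hI : I ∈ isoSpans B Δ) {h : V → ℂ} (hh : h ∈ polyFun V)
    (hadd : ∀ x, ∀ u ∈ I, h (x + u) = h x)
    (hst : ∀ w ∈ rootWeyl B Δ, I.map (w : V →ₗ[ℂ] V) = I → ∀ x ∈ B.orthogonal I,
      h (w x) = h x) :
    ∃ f ∈ invariantRing (rootRel B Δ), (∀ x ∈ B.orthogonal I, f x = h x * spanDisc B Δ I x) ∧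
      ∀ J ∈ isoSpans B Δ, (∀ w ∈ rootWeyl B Δ, ¬ J ≤ I.map (w : V →ₗ[ℂ] V)) →
        ∀ x ∈ B.orthogonal J, f x = 0 := by
  classical
  have := hΔ.finite_rootWeyl hB
  have : Fintype (rootWeyl B Δ) := Fintype.ofFinite _
  have symm : ∀ x y, B x y = B y x := fun x y => hB.eq x y
  obtain ⟨Ψ, γ, hΨ, hΨI, hγ, hγI, hK⟩ := hΔ.exists_denominators hB hI
  obtain ⟨Γ, hGΓ, hΓ, hΓΓ, hΓΔ⟩ := hΔ.exists_aniso_representatives (Ψ.image γ)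
    (fun g hg => by
      obtain ⟨b, hb, rfl⟩ := Finset.mem_image.1 hg
      exact (hΨ b hb).2)
    (fun g hg g' hg' t ht => by
      obtain ⟨b, hb, rfl⟩ := Finset.mem_image.1 hg
      obtain ⟨b', hb', rfl⟩ := Finset.mem_image.1 hg'
      rw [hγ b hb b' hb' t ht])
  set E := formProd B Γ with hE
  set E' := formProd B (Γ \ Ψ.image γ) with hE'
  have hEE : ∀ x, E x = (∏ b ∈ Ψ, B (γ b) x) * E' x := by
    intro x
    rw [hE, formProd, ← Finset.prod_sdiff hGΓ, mul_comm, Finset.prod_image]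
    · rfl
    · intro b hb b' hb' e
      exact hγ b hb b' hb' 1 (by rw [one_smul, e])
  -- The quotient p/E is h D_I ∏ b/γ_b. The factor E' contains the representatives that are not
  -- among the γ_b.
  let p : V → ℂ := fun x => h x * spanDisc B Δ I x * (∏ b ∈ Ψ, B b x) * E' x
  have hp : p ∈ polyFun V :=
    mul_mem (mul_mem (mul_mem hh (hΔ.spanDisc_mem_polyFun I)) (formProd_mem_polyFun B Ψ))
      (formProd_mem_polyFun B _)
  -- An isotropic root outside I gives a factor of D_I if it is orthogonal to I, and otherwise, up
  -- to sign, an element of Ψ.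
  have p_zero : ∀ β ∈ isoRoots B Δ, β ∉ I → ∀ y, B β y = 0 → p y = 0 := by
    intro β hβ hβI y hy
    by_cases ho : ∀ z ∈ I, B β z = 0
    · have := (hΔ.spanDisc_eq_zero_iff I y).2 ⟨β, ⟨hβ, ho, hβI⟩, hy⟩
      simp [p, this]
    · push Not at ho
      have : ∏ b ∈ Ψ, B b y = 0 := by
        rcases hΨI β hβ ho with h1 | h1
        · exact Finset.prod_eq_zero h1 hy
        · exact Finset.prod_eq_zero h1 (by simp [hy])
      simp [p, this]
  have p_orth : ∀ y ∈ B.orthogonal I, p y = h y * spanDisc B Δ I y * E y := by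
    intro y hy
    rw [hEE, ← mul_assoc]
    simp only [p]
    rw [Finset.prod_congr rfl fun b hb => hγI b hb y hy]
  have p_inv : ∀ α ∈ isoRoots B Δ, α ∈ I → ∀ x, B α x = 0 → ∀ c : ℂ,
      E x * p (x + c • α) = E (x + c • α) * p x := by
    intro α hα hαI x hx c
    have h1 := hK α hα hαI x hx c
    simp only [p]
    rw [hadd x _ (I.smul_mem c hαI), spanDisc_add x (I.smul_mem c hαI), hEE, hEE]
    linear_combination (h x * spanDisc B Δ I x * E' x * E' (x + c • α)) * h1
  obtain ⟨f, hf, χ, hχ, hfE, hfW⟩ := hΔ.exists_average hB hnd hΓ hΓΓ hΓΔ hp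
  have hEpoly : E ∈ polyFun V := formProd_mem_polyFun B Γ
  have hχE : ∀ w x, E x = (χ w)⁻¹ * E (w.1 x) := by
    intro w x
    have h1 := (hχ w).1
    have h2 : E (w.1 x) = χ w * E x := (hχ w).2 x
    rw [h2, inv_mul_cancel_left₀ h1]
  have hE_orth : ∀ J ∈ isoSpans B Δ, ∃ v ∈ B.orthogonal J, E v ≠ 0 := fun J hJ =>
    exists_formProd_ne_zero _ Γ fun g hg =>
      exists_mem_orthogonal_of_notMem hB hnd fun hgJ => (hΓ g hg).2 (hJ.1 g hgJ g hgJ)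
  -- Each summand is separately invariant under translation along δ: if wδ lies in I, by `p_inv`;
  -- otherwise p vanishes at both points. The denominators at both points are cleared first, as
  -- neither vanishes identically on δ^⊥.
  have hf_iso : ∀ δ ∈ isoRoots B Δ, ∀ x, B δ x = 0 → ∀ c : ℂ, f (x + c • δ) = f x := by
    intro δ hδ x hx c
    let M := LinearMap.ker (B δ)
    have hE_add : (fun x => E (x + c • δ)) ∈ polyFun V := by
      simpa using comp_affine_mem_polyFun LinearMap.id (c • δ) hEpoly
    have hf_add : (fun x => f (x + c • δ)) ∈ polyFun V := by
      simpa using comp_affine_mem_polyFun LinearMap.id (c • δ) hf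
    obtain ⟨v, hv, hEv⟩ := exists_formProd_ne_zero (B := B) M Γ fun g hg =>
      exists_orthogonal_of_not_collinear hnd (hΔ.ne_zero hδ.1) (b := g) fun t ht =>
        (hΓ g hg).2 (by rw [ht]; simp [hδ.2])
    refine polyFun_cancel (V := M) (d := fun x => E x * E (x + c • δ))
      (restrict_mem_polyFun M (mul_mem hEpoly hE_add)) (restrict_mem_polyFun M hf_add)
      (restrict_mem_polyFun M hf) ?_ ?_ ⟨x, hx⟩
    · by_contra! hc
      rcases polyFun_eq_zero_or_eq_zero (V := M) (restrict_mem_polyFun M hEpoly)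
        (restrict_mem_polyFun M hE_add) hc with h0 | h0
      · exact hEv (h0 ⟨v, hv⟩)
      · have hv' : v - c • δ ∈ M := by
          have : B δ v = 0 := hv
          change B δ _ = 0
          simp [this, hδ.2]
        have := h0 ⟨v - c • δ, hv'⟩
        simp only [sub_add_cancel] at this
        exact hEv this
    · rintro ⟨x, hx⟩
      have hx : B δ x = 0 := hx
      have e1 := hfE x
      have e2 := hfE (x + c • δ)
      have e3 : E x * ∑ w : rootWeyl B Δ, (χ w)⁻¹ * p (w.1 (x + c • δ)) =
          E (x + c • δ) * ∑ w : rootWeyl B Δ, (χ w)⁻¹ * p (w.1 x) := by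
        rw [Finset.mul_sum, Finset.mul_sum]
        refine Finset.sum_congr rfl fun w _ => ?_
        rw [hχE w x, hχE w (x + c • δ), map_add, map_smul]
        have hwδ : w.1 δ ∈ isoRoots B Δ := hΔ.rootWeyl_mem_iso hB w.2 hδ
        have hwx : B (w.1 δ) (w.1 x) = 0 := by rw [form_rootWeyl hB w.2, hx]
        by_cases hwI : w.1 δ ∈ I
        · linear_combination (χ w)⁻¹ * (χ w)⁻¹ * p_inv _ hwδ hwI _ hwx c
        · rw [p_zero _ hwδ hwI _ hwx, p_zero _ hwδ hwI _ (by simp [hwx, hwδ.2])]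
          ring
      change E x * E (x + c • δ) * f (x + c • δ) = E x * E (x + c • δ) * f x
      linear_combination E x * e2 - E (x + c • δ) * e1 + e3
  have hinv : f ∈ invariantRing (rootRel B Δ) := by
    refine ⟨hf, fun x y hxy => ?_⟩
    induction hxy with
    | rel x y hxy =>
      rcases hxy with ⟨w, hw, rfl⟩ | ⟨α, hα, hα0, hxα, c, rfl⟩
      · exact (hfW w hw x).symm
      · exact (hf_iso α ⟨hα, hα0⟩ x (by rw [symm, hxα]) c).symm
    | refl => rfl
    | symm _ _ _ ih => exact ih.symm
    | trans _ _ _ _ _ h1 h2 => exact h1.trans h2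
  have not_le : ∀ J ∈ isoSpans B Δ, ∀ w ∈ rootWeyl B Δ, ¬ J.map (w : V →ₗ[ℂ] V) ≤ I →
      ∀ x ∈ B.orthogonal J, p (w x) = 0 := by
    intro J hJ w hw hwJ x hx
    have : ¬ isoRoots B Δ ∩ J ⊆ {β | w β ∈ I} := by
      intro hsub
      apply hwJ
      rw [Submodule.map_le_iff_le_comap]
      conv_lhs => rw [← hJ.2]
      exact Submodule.span_le.2 hsub
    obtain ⟨β, ⟨hβ, hβJ⟩, hβI⟩ := Set.not_subset.1 this
    exact p_zero (w β) (hΔ.rootWeyl_mem_iso hB hw hβ) hβI _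
      ((form_rootWeyl hB hw β x).trans (hx β hβJ))
  -- On I^⊥ the summands outside the stabilizer of I vanish and those in the stabilizer are all
  -- equal, so the sum is the prescribed function times the order of the stabilizer.
  let N : ℕ := (Finset.univ.filter
    fun w : rootWeyl B Δ => I.map (w.1 : V →ₗ[ℂ] V) = I).card
  have hN : (N : ℂ) ≠ 0 := by
    refine Nat.cast_ne_zero.2 (Finset.card_ne_zero.2 ⟨1, ?_⟩)
    rw [Finset.mem_filter]
    exact ⟨Finset.mem_univ _, Submodule.map_id I⟩
  have hval : ∀ x ∈ B.orthogonal I, f x = N * (h x * spanDisc B Δ I x) := by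
    intro x hx
    obtain ⟨v, hv, hEv⟩ := hE_orth I hI
    refine polyFun_cancel (V := B.orthogonal I) (f := fun x => f x) (d := fun x => E x)
      (g := fun x => N * (h x * spanDisc B Δ I x)) (restrict_mem_polyFun _ hEpoly)
      (restrict_mem_polyFun _ hf)
      (mul_mem (const_mem_polyFun _) (restrict_mem_polyFun _
        (mul_mem hh (hΔ.spanDisc_mem_polyFun I)))) ⟨⟨v, hv⟩, hEv⟩ ?_ ⟨x, hx⟩
    rintro ⟨x, hx⟩
    have hterm : ∀ w : rootWeyl B Δ, (χ w)⁻¹ * p (w.1 x) =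
        if I.map (w.1 : V →ₗ[ℂ] V) = I then h x * spanDisc B Δ I x * E x else 0 := by
      intro w
      split_ifs with hw
      · have hwx := rootWeyl_mem_orthogonal hB w.2 hx
        rw [hw] at hwx
        rw [p_orth _ hwx, hst w.1 w.2 hw x hx, hΔ.spanDisc_rootWeyl hB w.2 hw, hχE w x]
        ring
      · rw [not_le I hI w.1 w.2 (fun h => hw (map_eq_of_map_le h)) x hx, mul_zero]
    change E x * f x = E x * (N * (h x * spanDisc B Δ I x))
    rw [hfE x, Finset.sum_congr rfl fun w _ => hterm w, ← Finset.sum_filter, Finset.sum_const,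
      nsmul_eq_mul]
    ring
  refine ⟨(N : ℂ)⁻¹ • f, Subalgebra.smul_mem _ hinv _, fun x hx => ?_, fun J hJ hJI x hx => ?_⟩
  · rw [Pi.smul_apply, hval x hx, smul_eq_mul, inv_mul_cancel_left₀ hN]
  · obtain ⟨v, hv, hEv⟩ := hE_orth J hJ
    have : f x = 0 := by
      refine polyFun_cancel (V := B.orthogonal J) (f := fun x => f x) (d := fun x => E x)
        (g := 0) (restrict_mem_polyFun _ hEpoly) (restrict_mem_polyFun _ hf) (zero_mem _)
        ⟨⟨v, hv⟩, hEv⟩ ?_ ⟨x, hx⟩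
      rintro ⟨x, hx⟩
      change E x * f x = E x * 0
      rw [hfE x, mul_zero]
      refine Finset.sum_eq_zero fun w _ => ?_
      rw [not_le J hJ w.1 w.2 (fun h => hJI _ (inv_mem w.2) (map_rootWeyl_le_iff.1 h)) x hx,
        mul_zero]
    rw [Pi.smul_apply, this, smul_zero]

end IsWGRS

end RootSystems

end LagrangianRelations

namespace LagrangianRelations

universe u

/-! ### Separation of classes and prime ideals of the invariant ring. -/

section Detectability

variable {V : Type u} [AddCommGroup V] [Module ℂ V]

/-- The functions whose restriction to the orthogonal complement of `I` is invariant under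
translations by `I` and under the stabilizer of `I` in the Weyl group. -/
def IsSpanInvariant (B : LinearMap.BilinForm ℂ V) (Δ : Set V) (I : Submodule ℂ V)
    (h : V → ℂ) : Prop :=
  (∀ x ∈ B.orthogonal I, ∀ u ∈ I, h (x + u) = h x) ∧
    ∀ w ∈ rootWeyl B Δ, I.map (w : V →ₗ[ℂ] V) = I → ∀ x ∈ B.orthogonal I, h (w x) = h x

/-- The functions vanishing on the orthogonal complements of the isotropic spans that are not
contained in a Weyl group translate of `I`. -/
def spanIdeal (B : LinearMap.BilinForm ℂ V) (Δ : Set V) (I : Submodule ℂ V) : Set (V → ℂ) :=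
  {f | ∀ J ∈ isoSpans B Δ, (∀ w ∈ rootWeyl B Δ, ¬ J ≤ I.map (w : V →ₗ[ℂ] V)) →
    ∀ x ∈ B.orthogonal J, f x = 0}

variable {B : LinearMap.BilinForm ℂ V} {Δ : Set V}

theorem exists_projection (M : Submodule ℂ V) : ∃ π : V →ₗ[ℂ] M, ∀ x : M, π x = x := by
  obtain ⟨π, hπ⟩ := M.subtype.exists_leftInverse_of_injective M.ker_subtype
  exact ⟨π, fun x => LinearMap.congr_fun hπ x⟩

/-- Composition with κ makes a polynomial invariant under translations by I. -/
theorem exists_kill (I : Submodule ℂ V) :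
    ∃ κ : V →ₗ[ℂ] V, (∀ u ∈ I, κ u = 0) ∧ ∀ x, x - κ x ∈ I := by
  obtain ⟨π, hπ⟩ := exists_projection I
  refine ⟨LinearMap.id - I.subtype ∘ₗ π, fun u hu => ?_, fun x => ?_⟩
  · simp [hπ ⟨u, hu⟩]
  · simp

theorem finrank_map_rootWeyl (w : V ≃ₗ[ℂ] V) (I : Submodule ℂ V) :
    Module.finrank ℂ (I.map (w : V →ₗ[ℂ] V)) = Module.finrank ℂ I :=
  LinearEquiv.finrank_map_eq w I

theorem isSpanInvariant_one (I : Submodule ℂ V) : IsSpanInvariant B Δ I fun _ => 1 :=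
  ⟨fun _ _ _ _ => rfl, fun _ _ _ _ _ => rfl⟩

theorem IsSpanInvariant.mul {I : Submodule ℂ V} {h k : V → ℂ} (hh : IsSpanInvariant B Δ I h)
    (hk : IsSpanInvariant B Δ I k) : IsSpanInvariant B Δ I fun x => h x * k x :=
  ⟨fun x hx u hu => congrArg₂ _ (hh.1 x hx u hu) (hk.1 x hx u hu),
    fun w hw hI x hx => congrArg₂ _ (hh.2 w hw hI x hx) (hk.2 w hw hI x hx)⟩

theorem map_mul_eq {w v : V ≃ₗ[ℂ] V} {I : Submodule ℂ V} (hw : I.map (w : V →ₗ[ℂ] V) = I)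
    (hv : I.map (v : V →ₗ[ℂ] V) = I) : I.map ((w * v : V ≃ₗ[ℂ] V) : V →ₗ[ℂ] V) = I := by
  have : I.map ((w * v : V ≃ₗ[ℂ] V) : V →ₗ[ℂ] V) =
      (I.map (v : V →ₗ[ℂ] V)).map (w : V →ₗ[ℂ] V) := Submodule.map_comp _ _ _
  rw [this, hv, hw]

/-- The stabilizer of `I` in the Weyl group. -/
def spanStabilizer (B : LinearMap.BilinForm ℂ V) (Δ : Set V) (I : Submodule ℂ V) :
    Subgroup (V ≃ₗ[ℂ] V) where
  carrier := {w | w ∈ rootWeyl B Δ ∧ I.map (w : V →ₗ[ℂ] V) = I}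
  one_mem' := ⟨one_mem _, Submodule.map_id I⟩
  mul_mem' := fun hw hv => ⟨mul_mem hw.1 hv.1, map_mul_eq hw.2 hv.2⟩
  inv_mem' := fun hw => ⟨inv_mem hw.1, map_inv_eq hw.2⟩

namespace IsWGRS

variable (hΔ : IsWGRS B Δ)
include hΔ

theorem finite_spanStabilizer (hB : B.IsSymm) (I : Submodule ℂ V) :
    Finite (spanStabilizer B Δ I) := by
  have := hΔ.finite_rootWeyl hB
  exact Finite.Set.subset (rootWeyl B Δ : Set (V ≃ₗ[ℂ] V)) fun w hw => hw.1

/-- A linear projection to I^⊥, which contains I, turns translation invariance on I^⊥ into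
translation invariance on V, as required by `exists_invariant`. -/
theorem exists_invariant_of_isSpanInvariant [FiniteDimensional ℂ V] (hB : B.IsSymm)
    (hnd : B.Nondegenerate) {I : Submodule ℂ V} (hI : I ∈ isoSpans B Δ) {h : V → ℂ}
    (hh : h ∈ polyFun V) (hinv : IsSpanInvariant B Δ I h) :
    ∃ f ∈ invariantRing (rootRel B Δ), f ∈ spanIdeal B Δ I ∧
      ∀ x ∈ B.orthogonal I, f x = h x * spanDisc B Δ I x := by
  obtain ⟨π, hπ⟩ := exists_projection (B.orthogonal I)
  have hπ' : ∀ x ∈ B.orthogonal I, (π x : V) = x := fun x hx => by rw [hπ ⟨x, hx⟩]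
  obtain ⟨f, hf, h1, h2⟩ := hΔ.exists_invariant hB hnd hI (h := fun x => h (π x))
    (comp_linear_mem_polyFun ((B.orthogonal I).subtype ∘ₗ π) hh)
    (fun x u hu => by
      have hu' : u ∈ B.orthogonal I := fun y hy => hI.1 y hy u hu
      simp only [map_add, Submodule.coe_add, hπ' u hu']
      exact hinv.1 _ (π x).2 u hu)
    (fun w hw hwI x hx => by
      have := rootWeyl_mem_orthogonal hB hw hx
      rw [hwI] at this
      simp only [hπ' _ this, hπ' x hx]
      exact hinv.2 w hw hwI x hx)
  exact ⟨f, hf, h2, fun x hx => by rw [h1 x hx, hπ' x hx]⟩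

/-- For a maximal isotropic span orthogonal to x, a zero of the discriminant at x would yield one
more root orthogonal to x and to the span. -/
theorem exists_spanDisc_ne_zero (hB : B.IsSymm) (x : V) :
    ∃ I ∈ isoSpans B Δ, x ∈ B.orthogonal I ∧ spanDisc B Δ I x ≠ 0 := by
  obtain ⟨I, hI, -, hx, hmax⟩ := hΔ.exists_maximal_isoSpan hB (x := x) bot_mem_isoSpans
    (by simp)
  refine ⟨I, hI, hx, fun h => ?_⟩
  obtain ⟨b, hb, hbx⟩ := (hΔ.spanDisc_eq_zero_iff I x).1 h
  exact hb.2.2 (hmax b hb.1 hbx hb.2.1)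

/-- Modulo I, the point y avoids the finite orbit of x under the stabilizer of I, since otherwise x
and y would be related. A polynomial on the quotient that vanishes at y and is 1 on the orbit is
multiplied over the stabilizer. -/
theorem exists_isSpanInvariant_separating (hB : B.IsSymm) {I : Submodule ℂ V}
    (hI : I ∈ isoSpans B Δ) {x y : V} (hx : x ∈ B.orthogonal I) (h : ¬ rootRel B Δ x y) :
    ∃ q ∈ polyFun V, IsSpanInvariant B Δ I q ∧ q x ≠ 0 ∧ q y = 0 := by
  classical
  have := hΔ.finite_spanStabilizer hB I
  have : Fintype (spanStabilizer B Δ I) := Fintype.ofFinite _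
  obtain ⟨κ, hκ, hκI⟩ := exists_kill I
  obtain ⟨q, hq, hqy, hqx⟩ := exists_polyFun_separating
    (Finset.univ.image fun w : spanStabilizer B Δ I => κ (w.1 x)) (κ y) (by
      intro hy
      obtain ⟨w, -, hw⟩ := Finset.mem_image.1 hy
      have hwI := w.2.2
      have hyw : y - w.1 x ∈ I := by
        have h1 : y - w.1 x = (y - κ y) - (w.1 x - κ (w.1 x)) := by rw [hw]; abel
        rw [h1]
        exact sub_mem (hκI _) (hκI _)
      have hwx := rootWeyl_mem_orthogonal hB w.2.1 hx
      rw [hwI] at hwx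
      apply h
      have := rootRel_add hB hI hwx hyw
      rw [add_sub_cancel] at this
      exact (rootRel_rootWeyl w.2.1 x).trans _ _ _ this)
  refine ⟨fun z => ∏ w : spanStabilizer B Δ I, q (κ (w.1 z)), prod_mem_polyFun _ _ fun w _ =>
    comp_linear_mem_polyFun (κ ∘ₗ (w.1 : V →ₗ[ℂ] V)) hq, ⟨fun z _ u hu => ?_,
      fun v hv hvI z _ => ?_⟩, ?_, ?_⟩
  · refine Finset.prod_congr rfl fun w _ => ?_
    rw [map_add, map_add, hκ (w.1 u) (w.2.2.le ⟨u, hu, rfl⟩), add_zero]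
  · exact Fintype.prod_equiv (Equiv.mulRight (⟨v, hv, hvI⟩ : spanStabilizer B Δ I)) _ _
      fun w => rfl
  · refine Finset.prod_ne_zero_iff.2 fun w _ => ?_
    rw [hqx _ (Finset.mem_image.2 ⟨w, Finset.mem_univ _, rfl⟩)]
    exact one_ne_zero
  · exact Finset.prod_eq_zero (Finset.mem_univ 1) hqy

/-- Let I and J be spans with nonvanishing discriminants at x and at y. The invariant extending D_I
is nonzero at x and would vanish at y unless J lies in a translate of I. By symmetry I and J are
conjugate; after y is moved into I^⊥, a span-invariant polynomial separates the points. -/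
theorem rootRel_of_forall_eq [FiniteDimensional ℂ V] (hB : B.IsSymm) (hnd : B.Nondegenerate)
    {x y : V} (h : ∀ f ∈ invariantRing (rootRel B Δ), f x = f y) : rootRel B Δ x y := by
  by_contra hxy
  obtain ⟨I, hI, hx, hIx⟩ := hΔ.exists_spanDisc_ne_zero hB x
  obtain ⟨J, hJ, hy, hJy⟩ := hΔ.exists_spanDisc_ne_zero hB y
  have key : ∀ {x y : V} {I J : Submodule ℂ V}, I ∈ isoSpans B Δ → J ∈ isoSpans B Δ →
      x ∈ B.orthogonal I → y ∈ B.orthogonal J → spanDisc B Δ I x ≠ 0 →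
      (∀ f ∈ invariantRing (rootRel B Δ), f x = f y) →
      ∃ w ∈ rootWeyl B Δ, J ≤ I.map (w : V →ₗ[ℂ] V) := by
    intro x y I J hI hJ hx hy hIx h
    by_contra! hc
    obtain ⟨f, hf, hfI, hfx⟩ := hΔ.exists_invariant_of_isSpanInvariant hB hnd hI
      (one_mem (polyFun V)) (isSpanInvariant_one I)
    refine hIx ?_
    rw [← one_mul (spanDisc B Δ I x)]
    exact (hfx x hx).symm.trans ((h f hf).trans (hfI J hJ hc y hy))
  obtain ⟨w, hw, hJI⟩ := key hI hJ hx hy hIx h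
  obtain ⟨v, hv, hIJ⟩ := key hJ hI hy hx hJy fun f hf => (h f hf).symm
  have hJI' : J = I.map (w : V →ₗ[ℂ] V) := by
    refine Submodule.eq_of_le_of_finrank_le hJI ?_
    have h1 := Submodule.finrank_mono hIJ
    rw [finrank_map_rootWeyl] at h1 ⊢
    exact h1
  have hy' : w⁻¹ y ∈ B.orthogonal I := by
    have := rootWeyl_mem_orthogonal hB (inv_mem hw) hy
    rw [hJI'] at this
    refine LinearMap.BilinForm.orthogonal_le ?_ this
    exact fun z hz => ⟨w z, ⟨z, hz, rfl⟩, w.symm_apply_apply z⟩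
  have hyy : rootRel B Δ y (w⁻¹ y) := rootRel_rootWeyl (inv_mem hw) y
  obtain ⟨q, hq, hqI, hqx, hqy⟩ := hΔ.exists_isSpanInvariant_separating hB hI hx
    (fun hxy' => hxy (hxy'.trans _ _ _ (hyy.symm _ _)))
  obtain ⟨f, hf, -, hfI⟩ := hΔ.exists_invariant_of_isSpanInvariant hB hnd hI hq hqI
  have h1 := h f hf
  rw [hf.2 _ _ hyy, hfI x hx, hfI _ hy', hqy, zero_mul] at h1
  exact (mul_ne_zero hqx hIx) h1

/-- Some power of an invariant vanishing on the orthogonal complements of the larger isotropic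
spans is divisible by `spanDisc B Δ I` on the orthogonal complement of `I`. -/
theorem exists_pow_eq_mul [FiniteDimensional ℂ V] (hB : B.IsSymm) (hnd : B.Nondegenerate)
    {I : Submodule ℂ V} (hI : I ∈ isoSpans B Δ) {f : V → ℂ}
    (hf : f ∈ invariantRing (rootRel B Δ))
    (h0 : ∀ J ∈ isoSpans B Δ, I < J → ∀ x ∈ B.orthogonal J, f x = 0) :
    ∃ (n : ℕ) (h : V → ℂ), h ∈ polyFun V ∧ IsSpanInvariant B Δ I h ∧
      ∀ x ∈ B.orthogonal I, f x ^ (n + 1) = h x * spanDisc B Δ I x := by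
  obtain ⟨π, hπ⟩ := exists_projection (B.orthogonal I)
  have hg : ∀ b, b ∈ outerRoots B Δ I →
      ∃ g ∈ polyFun V, ∀ x ∈ B.orthogonal I, f x = B b x * g x := by
    intro b hb
    obtain ⟨v, hv, hbv⟩ := exists_mem_orthogonal_of_notMem hB hnd hb.2.2
    obtain ⟨g, hg, hfg⟩ := exists_eq_dual_mul ((B b) ∘ₗ (B.orthogonal I).subtype)
      (fun h => hbv (LinearMap.congr_fun h ⟨v, hv⟩)) (restrict_mem_polyFun _ hf.1)
      (by
        rintro ⟨x, hx⟩ hbx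
        refine h0 _ (sup_mem_isoSpans hB hI hb.1 hb.2.1) ?_ x ?_
        · exact left_lt_sup.2 fun h => hb.2.2 (h (Submodule.mem_span_singleton_self b))
        · intro y hy
          obtain ⟨u, hu, z, hz, rfl⟩ := Submodule.mem_sup.1 hy
          obtain ⟨c, rfl⟩ := Submodule.mem_span_singleton.1 hz
          have h1 : B u x = 0 := hx u hu
          have h2 : B b x = 0 := hbx
          change B (u + c • b) x = 0
          simp [h1, h2])
    exact ⟨fun x => g (π x), comp_linear_mem_polyFun π hg, fun x hx => by
      have : π x = ⟨x, hx⟩ := hπ ⟨x, hx⟩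
      simp only [this]
      exact hfg ⟨x, hx⟩⟩
  choose! g hg hfg using hg
  set T := (hΔ.finite_outerRoots I).toFinset with hT
  have hmemT : ∀ {b}, b ∈ T → b ∈ outerRoots B Δ I := fun hb => by simpa [hT] using hb
  have hD := hΔ.spanDisc_mem_polyFun I
  -- Each linear factor of D_I divides f on I^⊥, so the power of f with exponent |T| is divisible by
  -- D_I. The extra factor f keeps the exponent positive when T is empty.
  have heq : ∀ x ∈ B.orthogonal I, f x ^ (T.card + 1) =
      (f x * ∏ b ∈ T, g b x) * spanDisc B Δ I x := by
    intro x hx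
    rw [hΔ.spanDisc_eq, formProd, mul_assoc, ← Finset.prod_mul_distrib, pow_succ',
      Finset.prod_congr rfl fun b hb => (mul_comm _ _).trans (hfg b (hmemT hb) x hx).symm,
      Finset.prod_const]
  have hpoly : (fun x => f x * ∏ b ∈ T, g b x) ∈ polyFun V :=
    mul_mem hf.1 (prod_mem_polyFun T g fun b hb => hg b (hmemT hb))
  obtain ⟨v, hv, hDv⟩ : ∃ v ∈ B.orthogonal I, spanDisc B Δ I v ≠ 0 := by
    obtain ⟨v, hv, h⟩ := exists_formProd_ne_zero (B := B) (B.orthogonal I) T fun b hb =>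
      exists_mem_orthogonal_of_notMem hB hnd (hmemT hb).2.2
    exact ⟨v, hv, by rwa [hΔ.spanDisc_eq]⟩
  -- The invariance of the quotient follows from that of f and D_I by cancelling D_I, which is not
  -- identically zero on I^⊥.
  have cancel : ∀ k ∈ polyFun (B.orthogonal I), (∀ x : B.orthogonal I,
      spanDisc B Δ I x * k x = spanDisc B Δ I x * (f x * ∏ b ∈ T, g b x)) →
      ∀ x : B.orthogonal I, k x = f x * ∏ b ∈ T, g b x := fun k hk h x =>
    polyFun_cancel (restrict_mem_polyFun _ hD) hk (restrict_mem_polyFun _ hpoly)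
      ⟨⟨v, hv⟩, hDv⟩ h x
  refine ⟨T.card, _, hpoly, ⟨fun x hx u hu => ?_, fun w hw hwI x hx => ?_⟩, heq⟩
  · refine cancel (fun x => f (x + u) * ∏ b ∈ T, g b (x + u))
      (restrict_mem_polyFun (f := fun x => f (x + u) * ∏ b ∈ T, g b (x + u)) _
        (by simpa using comp_affine_mem_polyFun LinearMap.id u hpoly)) ?_ ⟨x, hx⟩
    rintro ⟨x, hx⟩
    have h1 := heq x hx
    have h2 := heq (x + u) (orthogonal_add_mem hI.1 hx hu)
    have h3 := hf.2 _ _ (rootRel_add hB hI hx hu)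
    rw [← h3, spanDisc_add x hu, h1] at h2
    change spanDisc B Δ I x * (f (x + u) * ∏ b ∈ T, g b (x + u)) = _
    rw [← h3]
    linear_combination -h2
  · refine cancel (fun x => f (w x) * ∏ b ∈ T, g b (w x))
      (restrict_mem_polyFun (f := fun x => f (w x) * ∏ b ∈ T, g b (w x)) _
        (comp_linear_mem_polyFun (w : V →ₗ[ℂ] V) hpoly)) ?_ ⟨x, hx⟩
    rintro ⟨x, hx⟩
    have hwx := rootWeyl_mem_orthogonal hB hw hx
    rw [hwI] at hwx
    have h1 := heq x hx
    have h2 := heq (w x) hwx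
    have h3 := hf.2 _ _ (rootRel_rootWeyl hw x)
    rw [← h3, hΔ.spanDisc_rootWeyl hB hw hwI x, h1] at h2
    change spanDisc B Δ I x * (f (w x) * ∏ b ∈ T, g b (w x)) = _
    rw [← h3]
    linear_combination -h2

omit hΔ in
theorem eq_zero_of_le_map (hB : B.IsSymm) {f : V → ℂ} (hf : f ∈ invariantRing (rootRel B Δ))
    {I J : Submodule ℂ V} {w : V ≃ₗ[ℂ] V} (hw : w ∈ rootWeyl B Δ)
    (hJ : J ≤ I.map (w : V →ₗ[ℂ] V)) (h : ∀ x ∈ B.orthogonal J, f x = 0) :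
    ∀ x ∈ B.orthogonal I, f x = 0 := by
  intro x hx
  rw [hf.2 _ _ (rootRel_rootWeyl hw x)]
  exact h _ (LinearMap.BilinForm.orthogonal_le hJ (rootWeyl_mem_orthogonal hB hw hx))

/-- Let J be maximal such that g is nonzero on J^⊥. A power of g agrees on J^⊥ with an invariant f
in the ideal attached to J, so f lies in m. Their difference is nonzero on fewer of the subspaces
J'^⊥; induction applies, and m is prime. -/
theorem mem_of_spanIdeal_le [FiniteDimensional ℂ V] (hB : B.IsSymm) (hnd : B.Nondegenerate)
    {m : Ideal (invariantRing (rootRel B Δ))} (hm : m.IsPrime)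
    (g : invariantRing (rootRel B Δ))
    (h : ∀ J ∈ isoSpans B Δ, (∃ x ∈ B.orthogonal J, (g : V → ℂ) x ≠ 0) →
      ∀ f : invariantRing (rootRel B Δ), (f : V → ℂ) ∈ spanIdeal B Δ J → f ∈ m) : g ∈ m := by
  induction hn : {J ∈ isoSpans B Δ | ∃ x ∈ B.orthogonal J, (g : V → ℂ) x ≠ 0}.ncard
    using Nat.strong_induction_on generalizing g with
  | _ n ih =>
    have hfin : {J ∈ isoSpans B Δ | ∃ x ∈ B.orthogonal J, (g : V → ℂ) x ≠ 0}.Finite :=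
      hΔ.finite_isoSpans.subset fun _ h => h.1
    by_cases hg0 : g = 0
    · rw [hg0]; exact m.zero_mem
    have hne : {J ∈ isoSpans B Δ | ∃ x ∈ B.orthogonal J, (g : V → ℂ) x ≠ 0}.Nonempty := by
      refine ⟨⊥, bot_mem_isoSpans, ?_⟩
      by_contra! hc
      exact hg0 (Subtype.ext (funext fun x => hc x (by simp)))
    obtain ⟨J, ⟨hJ, hgJ⟩, hmax⟩ := hfin.exists_maximal hne
    obtain ⟨k, q, hq, hqJ, hgq⟩ := hΔ.exists_pow_eq_mul hB hnd hJ g.2 (by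
      intro J' hJ' hlt x hx
      by_contra hc
      exact hlt.not_ge (hmax ⟨hJ', x, hx, hc⟩ hlt.le))
    obtain ⟨f, hf, hfJ, hfq⟩ := hΔ.exists_invariant_of_isSpanInvariant hB hnd hJ hq hqJ
    have hval : ∀ x, ((g ^ (k + 1) - ⟨f, hf⟩ : invariantRing (rootRel B Δ)) : V → ℂ) x =
      (g : V → ℂ) x ^ (k + 1) - f x := fun x => rfl
    have himp : ∀ J' ∈ isoSpans B Δ, (∃ x ∈ B.orthogonal J',
        ((g ^ (k + 1) - ⟨f, hf⟩ : invariantRing (rootRel B Δ)) : V → ℂ) x ≠ 0) →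
        ∃ x ∈ B.orthogonal J', (g : V → ℂ) x ≠ 0 := by
      rintro J' hJ' ⟨x, hx, hne⟩
      by_contra! hc
      apply hne
      rw [hval, hc x hx, zero_pow k.succ_ne_zero, zero_sub, neg_eq_zero]
      refine hfJ J' hJ' (fun w hw hle => ?_) x hx
      obtain ⟨z, hz, hgz⟩ := hgJ
      exact hgz (eq_zero_of_le_map hB g.2 hw hle hc z hz)
    have hmem : (g ^ (k + 1) - ⟨f, hf⟩ : invariantRing (rootRel B Δ)) ∈ m := by
      refine ih _ ?_ _ (fun J' hJ' hx => h J' hJ' (himp J' hJ' hx)) rfl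
      rw [← hn]
      refine Set.ncard_lt_ncard ?_ hfin
      refine ⟨fun J' hJ' => ⟨hJ'.1, himp J' hJ'.1 hJ'.2⟩, fun hsub => ?_⟩
      obtain ⟨-, x, hx, hne⟩ := hsub ⟨hJ, hgJ⟩
      exact hne (by rw [hval, hgq x hx, hfq x hx, sub_self])
    have hfm : (⟨f, hf⟩ : invariantRing (rootRel B Δ)) ∈ m := h J hJ hgJ ⟨f, hf⟩ hfJ
    refine hm.mem_of_pow_mem (k + 1) ?_
    have := m.add_mem hmem hfm
    rwa [sub_add_cancel] at this

/-- A span I of least dimension is chosen whose ideal contains an invariant f₀ outside m. If m had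
no zero on I^⊥, a Nullstellensatz identity there, averaged and multiplied by a power of f₀, would
extend to V up to invariants vanishing on I^⊥. These lie in m, so f₀ would lie in m. -/
theorem exists_le_pointIdeal [FiniteDimensional ℂ V] (hB : B.IsSymm) (hnd : B.Nondegenerate)
    {m : Ideal (invariantRing (rootRel B Δ))} (hm : m.IsPrime) :
    ∃ x, m ≤ pointIdeal (rootRel B Δ) x := by
  classical
  obtain ⟨I, ⟨hI, f₀, hf₀, hf₀m⟩, hmin⟩ :
      ∃ I, (I ∈ isoSpans B Δ ∧ ∃ f : invariantRing (rootRel B Δ),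
        (f : V → ℂ) ∈ spanIdeal B Δ I ∧ f ∉ m) ∧
        ∀ J, (J ∈ isoSpans B Δ ∧ ∃ f : invariantRing (rootRel B Δ),
        (f : V → ℂ) ∈ spanIdeal B Δ J ∧ f ∉ m) → Module.finrank ℂ I ≤ Module.finrank ℂ J := by
    have hne : {I | I ∈ isoSpans B Δ ∧ ∃ f : invariantRing (rootRel B Δ),
        (f : V → ℂ) ∈ spanIdeal B Δ I ∧ f ∉ m}.Nonempty := by
      by_contra! hc
      refine hm.ne_top ((Ideal.eq_top_iff_one m).2
        (hΔ.mem_of_spanIdeal_le hB hnd hm 1 fun J hJ _ f hf => ?_))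
      by_contra hfm
      exact (hc ▸ (⟨hJ, f, hf, hfm⟩ : J ∈ {I | I ∈ isoSpans B Δ ∧
        ∃ f : invariantRing (rootRel B Δ), (f : V → ℂ) ∈ spanIdeal B Δ I ∧ f ∉ m}) :
        J ∈ (∅ : Set (Submodule ℂ V)))
    obtain ⟨I, hI, hmin⟩ := Set.exists_min_image _ (fun I : Submodule ℂ V => Module.finrank ℂ I)
      (hΔ.finite_isoSpans.subset fun _ h => h.1) hne
    exact ⟨I, hI, hmin⟩
  -- The criterion `mem_of_spanIdeal_le` is applied to f f₀. If the ideal of J is not inside m and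
  -- f₀ is nonzero on J^⊥, then minimality makes J a translate of I, so f vanishes on J^⊥.
  have vanish : ∀ f : invariantRing (rootRel B Δ),
      (∀ x ∈ B.orthogonal I, (f : V → ℂ) x = 0) → f ∈ m := by
    intro f hf
    refine (hm.mem_or_mem (hΔ.mem_of_spanIdeal_le hB hnd hm (f * f₀) ?_)).resolve_right hf₀m
    rintro J hJ ⟨x, hx, hne⟩ k hk
    by_contra hkm
    have hle := hmin J ⟨hJ, k, hk, hkm⟩
    have hne' : (f : V → ℂ) x * (f₀ : V → ℂ) x ≠ 0 := hne
    obtain ⟨w, hw, hJI⟩ : ∃ w ∈ rootWeyl B Δ, J ≤ I.map (w : V →ₗ[ℂ] V) := by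
      by_contra! hc
      exact right_ne_zero_of_mul hne' (hf₀ J hJ hc x hx)
    have hJI' : J = I.map (w : V →ₗ[ℂ] V) := Submodule.eq_of_le_of_finrank_le hJI
      ((finrank_map_rootWeyl w I).trans_le hle)
    have hIJ : I ≤ J.map ((w⁻¹ : V ≃ₗ[ℂ] V) : V →ₗ[ℂ] V) :=
      map_rootWeyl_le_iff.1 hJI'.ge
    exact left_ne_zero_of_mul hne'
      (eq_zero_of_le_map hB f.2 (inv_mem hw) hIJ hf x hx)
  by_contra! hc
  have hc' : ∀ v : B.orthogonal I, ∃ f ∈ (fun f : invariantRing (rootRel B Δ) =>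
      fun v : B.orthogonal I => (f : V → ℂ) v) '' (m : Set (invariantRing (rootRel B Δ))),
      f v ≠ 0 := by
    intro v
    obtain ⟨f, hf, hfv⟩ := SetLike.not_le_iff_exists.1 (hc v)
    exact ⟨_, ⟨f, hf, rfl⟩, hfv⟩
  obtain ⟨n, a, g, ha, hg, hsum⟩ := exists_sum_mul_eq_one _
    (by rintro _ ⟨f, -, rfl⟩; exact restrict_mem_polyFun _ f.2.1) hc'
  choose a' ha' haa using ha
  obtain ⟨π, hπ⟩ := exists_projection (B.orthogonal I)
  obtain ⟨κ, hκ, hκI⟩ := exists_kill I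
  have := hΔ.finite_spanStabilizer hB I
  have : Fintype (spanStabilizer B Δ I) := Fintype.ofFinite _
  -- The coefficients become invariant under I through κ and under the stabilizer through summation.
  -- As the `a' i` are constant on classes and κ(wx) lies in the class of x, the identity survives
  -- with right-hand side the order of the stabilizer.
  let G : Fin n → V → ℂ := fun i z => ∑ w : spanStabilizer B Δ I, g i (π (κ (w.1 z)))
  have hG : ∀ i, G i ∈ polyFun V := fun i => sum_mem_polyFun _ _ fun w _ =>
    comp_linear_mem_polyFun (π ∘ₗ κ ∘ₗ (w.1 : V →ₗ[ℂ] V)) (hg i)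
  have hGI : ∀ i, IsSpanInvariant B Δ I (G i) := by
    refine fun i => ⟨fun z _ u hu => ?_, fun v hv hvI z _ => ?_⟩
    · refine Finset.sum_congr rfl fun w _ => ?_
      rw [map_add, map_add, hκ (w.1 u) (w.2.2.le ⟨u, hu, rfl⟩), add_zero]
    · exact Fintype.sum_equiv (Equiv.mulRight (⟨v, hv, hvI⟩ : spanStabilizer B Δ I)) _ _
        fun w => rfl
  have hGsum : ∀ x ∈ B.orthogonal I,
      ∑ i, (a' i : V → ℂ) x * G i x = Fintype.card (spanStabilizer B Δ I) := by
    intro x hx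
    have : ∀ w : spanStabilizer B Δ I,
        ∑ i, (a' i : V → ℂ) x * g i (π (κ (w.1 x))) = 1 := by
      intro w
      have hwx := rootWeyl_mem_orthogonal hB w.2.1 hx
      rw [w.2.2] at hwx
      have hu := I.neg_mem (hκI (w.1 x))
      have hκx : κ (w.1 x) = w.1 x + -(w.1 x - κ (w.1 x)) := by abel
      have hκw : κ (w.1 x) ∈ B.orthogonal I := by
        rw [hκx]; exact orthogonal_add_mem hI.1 hwx hu
      have hrel : rootRel B Δ x (κ (w.1 x)) := by
        rw [hκx]
        exact (rootRel_rootWeyl w.2.1 x).trans _ _ _ (rootRel_add hB hI hwx hu)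
      rw [← hsum (π (κ (w.1 x)))]
      refine Finset.sum_congr rfl fun i _ => ?_
      rw [(a' i).2.2 _ _ hrel, ← haa i, hπ ⟨_, hκw⟩]
    simp only [G, Finset.mul_sum]
    rw [Finset.sum_comm, Finset.sum_congr rfl fun w _ => this w]
    simp
  obtain ⟨k, q, hq, hqI, hfq⟩ := hΔ.exists_pow_eq_mul hB hnd hI f₀.2 (by
    intro J hJ hlt x hx
    refine hf₀ J hJ (fun w _ hle => ?_) x hx
    have h1 := Submodule.finrank_mono hle
    rw [finrank_map_rootWeyl] at h1
    have h3 := Submodule.finrank_lt_finrank_of_lt hlt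
    omega)
  choose F hF _ hFq using fun i => hΔ.exists_invariant_of_isSpanInvariant hB hnd hI
    (mul_mem hq (hG i)) (hqI.mul (hGI i))
  let N : ℂ := Fintype.card (spanStabilizer B Δ I)
  have hN : N ≠ 0 := Nat.cast_ne_zero.2 Fintype.card_ne_zero
  -- On I^⊥ the power of f₀ is q D_I and `F i` is q G_i D_I, so the averaged identity makes this
  -- difference vanish there.
  have hmem : (N • f₀ ^ (k + 1) - ∑ i, a' i * ⟨F i, hF i⟩ : invariantRing (rootRel B Δ)) ∈ m := by
    refine vanish _ fun x hx => ?_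
    have : ((N • f₀ ^ (k + 1) - ∑ i, a' i * ⟨F i, hF i⟩ : invariantRing (rootRel B Δ)) :
        V → ℂ) x = N * (f₀ : V → ℂ) x ^ (k + 1) - ∑ i, (a' i : V → ℂ) x * F i x := by
      simp
    have hNx : ∑ i, (a' i : V → ℂ) x * G i x = N := hGsum x hx
    rw [this, hfq x hx, ← hNx, Finset.sum_mul, sub_eq_zero]
    refine Finset.sum_congr rfl fun i _ => ?_
    have h1 : F i x = (q x * G i x) * spanDisc B Δ I x := hFq i x hx
    rw [h1]
    ring
  have hsum_mem : ∑ i, a' i * ⟨F i, hF i⟩ ∈ m :=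
    sum_mem fun i _ => m.mul_mem_right _ (ha' i)
  have h1 := m.add_mem hmem hsum_mem
  rw [sub_add_cancel] at h1
  have h2 := Submodule.smul_of_tower_mem m N⁻¹ h1
  rw [smul_smul, inv_mul_cancel₀ hN, one_smul] at h2
  exact hf₀m (hm.mem_of_pow_mem _ h2)

theorem pointIdeal_eq_iff [FiniteDimensional ℂ V] (hB : B.IsSymm) (hnd : B.Nondegenerate)
    (x y : V) : pointIdeal (rootRel B Δ) x = pointIdeal (rootRel B Δ) y ↔ rootRel B Δ x y := by
  constructor
  · intro h
    refine hΔ.rootRel_of_forall_eq hB hnd fun f hf => ?_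
    have h1 : (⟨f, hf⟩ - algebraMap ℂ _ (f x) : invariantRing (rootRel B Δ)) ∈
        pointIdeal (rootRel B Δ) x := sub_self (f x)
    rw [h] at h1
    exact (sub_eq_zero.1 (h1 : f y - f x = 0)).symm
  · intro h
    ext f
    change (f : V → ℂ) x = 0 ↔ (f : V → ℂ) y = 0
    rw [f.2.2 x y h]

omit hΔ in
theorem pointIdeal_ne_top (R : V → V → Prop) (x : V) : pointIdeal R x ≠ ⊤ := by
  intro h
  have h1 : (1 : invariantRing R) ∈ pointIdeal R x := h ▸ Submodule.mem_top
  exact one_ne_zero (h1 : (1 : ℂ) = 0)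

theorem exists_eq_pointIdeal [FiniteDimensional ℂ V] (hB : B.IsSymm) (hnd : B.Nondegenerate)
    (m : Ideal (invariantRing (rootRel B Δ))) (hm : m.IsMaximal) :
    ∃ x, m = pointIdeal (rootRel B Δ) x := by
  obtain ⟨x, hx⟩ := hΔ.exists_le_pointIdeal hB hnd hm.isPrime
  exact ⟨x, hm.eq_of_le (pointIdeal_ne_top _ x) hx⟩

theorem isDetectable_rootRel [FiniteDimensional ℂ V] (hB : B.IsSymm) (hnd : B.Nondegenerate) :
    IsDetectable (rootRel B Δ) := by
  refine ⟨Relation.EqvGen.is_equivalence _, fun m hm => ?_⟩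
  obtain ⟨x, rfl⟩ := hΔ.exists_eq_pointIdeal hB hnd m hm
  refine ⟨x, Set.ext fun y => ⟨fun hy => ?_, fun hxy f hf => ?_⟩⟩
  · exact (hΔ.pointIdeal_eq_iff hB hnd x y).1 (hm.eq_of_le (pointIdeal_ne_top _ y) hy)
  · have := f.2.2 x y hxy
    rw [← this]
    exact hf

end IsWGRS

end Detectability

end LagrangianRelations

namespace LagrangianRelations

universe u v

/-! ### Reduction of Lagrangian relations to I^⊥/I. -/

section Reduction

variable {V : Type u} [AddCommGroup V] [Module ℂ V] {N : Type v} [AddCommGroup N] [Module ℂ N]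

/-- `π` identifies `(N, b)` with the quotient of the orthogonal complement of `I` by `I`. -/
structure IsReduction (B : LinearMap.BilinForm ℂ V) (I : Submodule ℂ V)
    (b : LinearMap.BilinForm ℂ N) (π : B.orthogonal I →ₗ[ℂ] N) : Prop where
  surjective : Function.Surjective π
  apply_eq_zero_iff : ∀ x, π x = 0 ↔ (x : V) ∈ I
  form_apply : ∀ x y, b (π x) (π y) = B x y

/-- The relation induced on the reduction. -/
def inducedRel {C : Submodule ℂ V} (π : C →ₗ[ℂ] N) (R : V → V → Prop) : N → N → Prop :=
  fun p q => ∃ x y : C, π x = p ∧ π y = q ∧ R x y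

/-- The linear relation induced on the reduction. -/
def inducedLinear {C : Submodule ℂ V} (π : C →ₗ[ℂ] N) (L : Submodule ℂ (V × V)) :
    Submodule ℂ (N × N) :=
  (L.comap (C.subtype.prodMap C.subtype)).map (π.prodMap π)

theorem mem_inducedLinear {C : Submodule ℂ V} {π : C →ₗ[ℂ] N} {L : Submodule ℂ (V × V)}
    {p q : N} : (p, q) ∈ inducedLinear π L ↔
      ∃ x y : C, π x = p ∧ π y = q ∧ ((x : V), (y : V)) ∈ L := by
  constructor
  · rintro ⟨⟨x, y⟩, h, e⟩
    exact ⟨x, y, (Prod.ext_iff.1 e).1, (Prod.ext_iff.1 e).2, h⟩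
  · rintro ⟨x, y, rfl, rfl, h⟩
    exact ⟨(x, y), h, rfl⟩

theorem finrank_submodule_prod (S T : Submodule ℂ V) [FiniteDimensional ℂ V] :
    Module.finrank ℂ (S.prod T) = Module.finrank ℂ S + Module.finrank ℂ T := by
  have h : LinearMap.range (S.subtype.prodMap T.subtype) = S.prod T := by
    rw [LinearMap.range_prodMap]; simp
  rw [← h, LinearMap.finrank_range_of_inj
    (Prod.map_injective.2 ⟨S.injective_subtype, T.injective_subtype⟩), Module.finrank_prod]

theorem finrank_map_of_injective {E F : Type*} [AddCommGroup E] [Module ℂ E] [AddCommGroup F]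
    [Module ℂ F] {f : E →ₗ[ℂ] F} (hf : Function.Injective f) (S : Submodule ℂ E) :
    Module.finrank ℂ (S.map f) = Module.finrank ℂ S :=
  (Submodule.equivMapOfInjective f hf S).finrank_eq.symm

/-- Rank and nullity for π × π on L ∩ (C × C), where its kernel is L ∩ (I × I). -/
theorem finrank_inducedLinear [FiniteDimensional ℂ V] {C : Submodule ℂ V} (π : C →ₗ[ℂ] N)
    (L : Submodule ℂ (V × V)) {I : Submodule ℂ V} (hIC : I ≤ C)
    (hπ : ∀ x : C, π x = 0 ↔ (x : V) ∈ I) :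
    Module.finrank ℂ (inducedLinear π L) + Module.finrank ℂ (I.prod I ⊓ L : Submodule ℂ (V × V)) =
      Module.finrank ℂ (C.prod C ⊓ L : Submodule ℂ (V × V)) := by
  set ι := C.subtype.prodMap C.subtype with hι
  have hιinj : Function.Injective ι :=
    Prod.map_injective.2 ⟨C.injective_subtype, C.injective_subtype⟩
  have e1 := LinearMap.finrank_range_add_finrank_ker
    ((π.prodMap π).domRestrict (L.comap ι))
  rw [LinearMap.range_domRestrict] at e1
  have e2 : (L.comap ι).map ι = C.prod C ⊓ L := by
    rw [Submodule.map_comap_eq, LinearMap.range_prodMap, Submodule.range_subtype]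
  have e3 : (LinearMap.ker ((π.prodMap π).domRestrict (L.comap ι))).map
      (ι ∘ₗ (L.comap ι).subtype) = I.prod I ⊓ L := by
    ext ⟨x, y⟩
    constructor
    · rintro ⟨⟨⟨x', y'⟩, h⟩, h0, e⟩
      obtain ⟨rfl, rfl⟩ := Prod.ext_iff.1 e
      have h0' := Prod.ext_iff.1 (LinearMap.mem_ker.1 h0)
      exact ⟨⟨(hπ x').1 h0'.1, (hπ y').1 h0'.2⟩, h⟩
    · rintro ⟨⟨hx, hy⟩, h⟩
      refine ⟨⟨(⟨x, hIC hx⟩, ⟨y, hIC hy⟩), h⟩, ?_, rfl⟩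
      exact LinearMap.mem_ker.2 (Prod.ext ((hπ ⟨x, hIC hx⟩).2 hx) ((hπ ⟨y, hIC hy⟩).2 hy))
  have hinj : Function.Injective (ι ∘ₗ (L.comap ι).subtype) :=
    hιinj.comp (Submodule.injective_subtype _)
  rw [← e2, ← e3, finrank_map_of_injective hιinj, finrank_map_of_injective hinj]
  exact e1

/-- The form `B ⊕ (-B)` on `V × V`. -/
noncomputable def doubleForm (B : LinearMap.BilinForm ℂ V) : LinearMap.BilinForm ℂ (V × V) :=
  B.comp (LinearMap.fst ℂ V V) (LinearMap.fst ℂ V V) -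
    B.comp (LinearMap.snd ℂ V V) (LinearMap.snd ℂ V V)

variable {B : LinearMap.BilinForm ℂ V}

theorem doubleForm_apply (p q : V × V) : doubleForm B p q = B p.1 q.1 - B p.2 q.2 := rfl

theorem doubleForm_isSymm (hB : B.IsSymm) : (doubleForm B).IsSymm :=
  ⟨fun p q => by
    rw [doubleForm_apply, doubleForm_apply, hB.eq q.1 p.1, hB.eq q.2 p.2]⟩

theorem nondegenerate_of_isSymm {b : LinearMap.BilinForm ℂ N} (hb : ∀ x y, b x y = b y x)
    (h : ∀ x, (∀ y, b x y = 0) → x = 0) : b.Nondegenerate :=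
  ⟨h, fun y hy => h y fun x => (hb y x).trans (hy x)⟩

theorem doubleForm_nondegenerate (hB : B.IsSymm) (hnd : B.Nondegenerate) :
    (doubleForm B).Nondegenerate := by
  refine nondegenerate_of_isSymm (fun x y => (doubleForm_isSymm hB).eq x y) fun p hp => ?_
  refine Prod.ext (hnd.1 _ fun y => ?_) (hnd.1 _ fun y => ?_)
  · simpa [doubleForm_apply] using hp (y, 0)
  · simpa [doubleForm_apply] using hp (0, y)

/-- L is isotropic for the form on V × V and has half the dimension of V × V. -/
theorem orthogonal_eq_of_isLinearLagrangian [FiniteDimensional ℂ V] (hB : B.IsSymm)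
    (hnd : B.Nondegenerate) {L : Submodule ℂ (V × V)} (hL : IsLinearLagrangian B L) :
    (doubleForm B).orthogonal L = L := by
  symm
  refine Submodule.eq_of_le_of_finrank_eq (fun p hp q hq => hL.1 q hq p hp) ?_
  rw [LinearMap.BilinForm.finrank_orthogonal (doubleForm_nondegenerate hB hnd), hL.2,
    Module.finrank_prod]
  omega

theorem orthogonal_sup (b : LinearMap.BilinForm ℂ N) (S T : Submodule ℂ N) :
    b.orthogonal (S ⊔ T) = b.orthogonal S ⊓ b.orthogonal T := by
  refine le_antisymm (le_inf (LinearMap.BilinForm.orthogonal_le le_sup_left)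
    (LinearMap.BilinForm.orthogonal_le le_sup_right)) ?_
  rintro x ⟨hS, hT⟩ _ hy
  obtain ⟨s, hs, t, ht, rfl⟩ := Submodule.mem_sup.1 hy
  have h1 : b s x = 0 := hS s hs
  have h2 : b t x = 0 := hT t ht
  change b (s + t) x = 0
  simp [h1, h2]

theorem orthogonal_prod (hB : B.IsSymm) (hnd : B.Nondegenerate) [FiniteDimensional ℂ V]
    (I : Submodule ℂ V) :
    (doubleForm B).orthogonal ((B.orthogonal I).prod (B.orthogonal I)) = I.prod I := by
  conv_rhs => rw [← LinearMap.BilinForm.orthogonal_orthogonal hnd hB.isRefl I]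
  ext p
  constructor
  · intro h
    refine ⟨fun y hy => ?_, fun y hy => ?_⟩
    · have : doubleForm B (y, 0) p = 0 := h (y, 0) ⟨hy, zero_mem _⟩
      simpa [doubleForm_apply] using this
    · have : doubleForm B (0, y) p = 0 := h (0, y) ⟨zero_mem _, hy⟩
      simpa [doubleForm_apply] using this
  · rintro ⟨h1, h2⟩ y ⟨hy1, hy2⟩
    have e1 : B y.1 p.1 = 0 := h1 _ hy1
    have e2 : B y.2 p.2 = 0 := h2 _ hy2
    change doubleForm B y p = 0
    rw [doubleForm_apply, e1, e2, sub_zero]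

namespace IsReduction

variable {I : Submodule ℂ V} {b : LinearMap.BilinForm ℂ N} {π : B.orthogonal I →ₗ[ℂ] N}
  (hπ : IsReduction B I b π)
include hπ

theorem form_symm (hB : B.IsSymm) (p q : N) : b p q = b q p := by
  obtain ⟨x, rfl⟩ := hπ.surjective p
  obtain ⟨y, rfl⟩ := hπ.surjective q
  rw [hπ.form_apply, hπ.form_apply, hB.eq]

theorem nondegenerate [FiniteDimensional ℂ V] (hB : B.IsSymm) (hnd : B.Nondegenerate) :
    b.Nondegenerate := by
  refine nondegenerate_of_isSymm (hπ.form_symm hB) fun p hp => ?_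
  obtain ⟨x, rfl⟩ := hπ.surjective p
  rw [hπ.apply_eq_zero_iff]
  refine (LinearMap.BilinForm.orthogonal_orthogonal hnd hB.isRefl I).le fun y hy => ?_
  exact (hB.eq y x).trans ((hπ.form_apply x ⟨y, hy⟩).symm.trans (hp _))

theorem finiteDimensional [FiniteDimensional ℂ V] : FiniteDimensional ℂ N :=
  FiniteDimensional.of_surjective π hπ.surjective

theorem finrank_add [FiniteDimensional ℂ V] (hnd : B.Nondegenerate)
    (hI : ∀ x ∈ I, ∀ y ∈ I, B x y = 0) :
    Module.finrank ℂ N + 2 * Module.finrank ℂ I = Module.finrank ℂ V := by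
  have h1 := LinearMap.finrank_range_add_finrank_ker π
  rw [LinearMap.range_eq_top.2 hπ.surjective, finrank_top] at h1
  have h2 : (LinearMap.ker π).map (B.orthogonal I).subtype = I := by
    ext x
    constructor
    · rintro ⟨y, hy, rfl⟩
      exact (hπ.apply_eq_zero_iff y).1 hy
    · exact fun hx => ⟨⟨x, fun y hy => hI y hy x hx⟩, (hπ.apply_eq_zero_iff _).2 hx, rfl⟩
  rw [← Submodule.finrank_map_subtype_eq (B.orthogonal I) (LinearMap.ker π), h2,
    LinearMap.BilinForm.finrank_orthogonal hnd] at h1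
  have h3 := Submodule.finrank_le I
  omega

/-- The dimension count of linear reduction: with C = I^⊥, the complement of C × C + L is (I × I) ∩
L, which determines the dimension of (C × C) ∩ L relative to that of the kernel. -/
theorem isLinearLagrangian_inducedLinear [FiniteDimensional ℂ V] (hB : B.IsSymm)
    (hnd : B.Nondegenerate) (hI : ∀ x ∈ I, ∀ y ∈ I, B x y = 0) {L : Submodule ℂ (V × V)}
    (hL : IsLinearLagrangian B L) : IsLinearLagrangian b (inducedLinear π L) := by
  constructor
  · rintro ⟨p, q⟩ hp ⟨p', q'⟩ hp'
    obtain ⟨x, y, rfl, rfl, h⟩ := mem_inducedLinear.1 hp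
    obtain ⟨x', y', rfl, rfl, h'⟩ := mem_inducedLinear.1 hp'
    rw [hπ.form_apply, hπ.form_apply]
    exact hL.1 _ h _ h'
  have hIC : I ≤ B.orthogonal I := fun x hx y hy => hI y hy x hx
  have e1 := finrank_inducedLinear π L hIC hπ.apply_eq_zero_iff
  have e4 := Submodule.finrank_sup_add_finrank_inf_eq ((B.orthogonal I).prod (B.orthogonal I)) L
  have e5 := LinearMap.BilinForm.finrank_orthogonal (doubleForm_nondegenerate hB hnd)
    ((B.orthogonal I).prod (B.orthogonal I) ⊔ L)
  rw [orthogonal_sup, orthogonal_prod hB hnd, orthogonal_eq_of_isLinearLagrangian hB hnd hL,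
    Module.finrank_prod] at e5
  rw [finrank_submodule_prod, hL.2, LinearMap.BilinForm.finrank_orthogonal hnd] at e4
  have e6 := hπ.finrank_add hnd hI
  have e7 := Submodule.finrank_le ((B.orthogonal I).prod (B.orthogonal I) ⊔ L)
  rw [Module.finrank_prod] at e7
  have e8 := Submodule.finrank_le I
  omega

theorem map_eq_of_sub_mem {x y : V} (hx : x ∈ B.orthogonal I) (hy : y ∈ B.orthogonal I)
    (h : y - x ∈ I) : π ⟨x, hx⟩ = π ⟨y, hy⟩ := by
  rw [← sub_eq_zero, ← map_sub, hπ.apply_eq_zero_iff]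
  have : x - y ∈ I := by rw [← neg_sub]; exact I.neg_mem h
  exact this

theorem sub_mem_of_map_eq {x y : B.orthogonal I} (h : π x = π y) : (y : V) - x ∈ I :=
  (hπ.apply_eq_zero_iff (y - x)).1 (by rw [map_sub, h, sub_self])

/-- The isometry of the reduction induced by an isometry stabilizing `I`. -/
theorem exists_isometry [FiniteDimensional ℂ V] (hB : B.IsSymm) (hnd : B.Nondegenerate)
    {w : V ≃ₗ[ℂ] V} (hw : ∀ x y, B (w x) (w y) = B x y) (hwI : I.map (w : V →ₗ[ℂ] V) = I) :
    ∃ s : N ≃ₗ[ℂ] N, (∀ p q, b (s p) (s q) = b p q) ∧ ∀ x y : B.orthogonal I, (y : V) = w x →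
      s (π x) = π y := by
  have hfin := hπ.finiteDimensional
  have hC : ∀ x ∈ B.orthogonal I, w x ∈ B.orthogonal I := by
    intro x hx y hy
    rw [← hwI] at hy
    obtain ⟨y, hy, rfl⟩ := hy
    exact (hw y x).trans (hx y hy)
  obtain ⟨σ, hσ⟩ := π.exists_rightInverse_of_surjective (LinearMap.range_eq_top.2 hπ.surjective)
  have hσ' : ∀ p, π (σ p) = p := fun p => LinearMap.congr_fun hσ p
  let wC : B.orthogonal I →ₗ[ℂ] B.orthogonal I := (w : V →ₗ[ℂ] V).restrict hC
  let s : N →ₗ[ℂ] N := π ∘ₗ wC ∘ₗ σ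
  have hs : ∀ x y : B.orthogonal I, (y : V) = w x → s (π x) = π y := by
    intro x y hy
    have h1 := hπ.sub_mem_of_map_eq (hσ' (π x))
    refine hπ.map_eq_of_sub_mem (x := w (σ (π x))) (hC _ (σ (π x)).2) y.2 ?_
    rw [hy, ← map_sub]
    exact hwI.le ⟨_, h1, rfl⟩
  have hform : ∀ p q, b (s p) (s q) = b p q := by
    intro p q
    obtain ⟨x, rfl⟩ := hπ.surjective p
    obtain ⟨y, rfl⟩ := hπ.surjective q
    rw [hs x (wC x) rfl, hs y (wC y) rfl, hπ.form_apply, hπ.form_apply]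
    exact hw x y
  have hinj : Function.Injective s := by
    rw [← LinearMap.ker_eq_bot, LinearMap.ker_eq_bot']
    intro p hp
    refine (hπ.nondegenerate hB hnd).1 p fun q => ?_
    rw [← hform p q, hp]
    simp
  exact ⟨LinearEquiv.ofInjectiveEndo s hinj, hform, hs⟩

end IsReduction

end Reduction

end LagrangianRelations

namespace LagrangianRelations

universe u

/-! ### Transitivity of stabilizers in indecomposable systems. -/

section Indecomposable

variable {V : Type u} [AddCommGroup V] [Module ℂ V] {B : LinearMap.BilinForm ℂ V} {Δ : Set V}

theorem form_formReflection_left {γ : V} (h : B γ γ ≠ 0) (α β : V) :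
    B (formReflection B γ h α) β = B α β - 2 * B γ α / B γ γ * B γ β := by
  rw [formReflection_apply]
  simp

theorem map_eq_of_forall_eq {w : V ≃ₗ[ℂ] V} {I : Submodule ℂ V} (h : ∀ x ∈ I, w x = x) :
    I.map (w : V →ₗ[ℂ] V) = I := by
  ext x
  constructor
  · rintro ⟨y, hy, rfl⟩
    have : w y = y := h y hy
    exact this.symm ▸ hy
  · exact fun hx => ⟨x, hx, h x hx⟩

namespace IsWGRS

variable (hΔ : IsWGRS B Δ)
include hΔ

/-- In an indecomposable system the non-orthogonality graph of the isotropic roots, up to sign,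
is connected. -/
theorem isoRoots_subset_of_closed (hB : B.IsSymm) (hind : IsIndecomposable B Δ) {K : Set V}
    (hK : K ⊆ isoRoots B Δ) (hne : K.Nonempty) (hneg : ∀ κ ∈ K, -κ ∈ K)
    (hadj : ∀ κ ∈ K, ∀ β ∈ isoRoots B Δ, B κ β ≠ 0 → β ∈ K) : isoRoots B Δ ⊆ K := by
  intro β₀ hβ₀
  by_contra hβK
  have hrefl : ∀ γ ∈ Δ, ∀ h : B γ γ ≠ 0, ∀ κ ∈ K, formReflection B γ h κ ∈ K := by
    intro γ hγ h κ hκ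
    by_cases h0 : B γ κ = 0
    · rwa [formReflection_of_orthogonal h h0]
    · refine hadj κ hκ _
        (hΔ.rootWeyl_mem_iso hB (formReflection_mem_rootWeyl hγ h) (hK hκ)) ?_
      rw [hB.eq κ, form_formReflection_left, (hK hκ).2, zero_sub]
      exact neg_ne_zero.2 (mul_ne_zero (div_ne_zero (mul_ne_zero two_ne_zero h0) h) h0)
  -- K together with the anisotropic roots not orthogonal to it splits off. A root β outside is
  -- orthogonal to K. For an anisotropic α in this part and κ in K with B(κ, α) nonzero, the
  -- reflection of κ in α stays in K, so β is orthogonal to α too.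
  refine hind ⟨K ∪ {γ ∈ anisoRoots B Δ | ∃ κ ∈ K, B κ γ ≠ 0},
    Δ \ (K ∪ {γ ∈ anisoRoots B Δ | ∃ κ ∈ K, B κ γ ≠ 0}), hne.inl,
    ⟨β₀, hβ₀.1, fun h => h.elim hβK fun h => h.1.2 hβ₀.2⟩, Set.disjoint_sdiff_right, ?_, ?_, ?_, ?_⟩
  · refine (Set.union_sdiff_cancel (Set.union_subset (fun κ hκ => (hK hκ).1) ?_)).symm
    exact fun γ hγ => hγ.1.1
  · rintro α (hα | ⟨hα, κ, hκ, hακ⟩)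
    · exact Or.inl (hneg α hα)
    · exact Or.inr ⟨⟨hΔ.neg_mem α hα.1, by simpa using hα.2⟩, κ, hκ, by simpa using hακ⟩
  · rintro α ⟨hα, hαK⟩
    refine ⟨hΔ.neg_mem α hα, ?_⟩
    rintro (h | ⟨h, κ, hκ, hακ⟩)
    · exact hαK (Or.inl (by simpa using hneg _ h))
    · exact hαK (Or.inr ⟨⟨hα, by simpa using h.2⟩, κ, hκ, by simpa using hακ⟩)
  · intro α hα β hβ
    have hβ0 : ∀ κ ∈ K, B κ β = 0 := by
      intro κ hκ
      by_contra hc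
      by_cases h0 : B β β = 0
      · exact hβ.2 (Or.inl (hadj κ hκ β ⟨hβ.1, h0⟩ hc))
      · exact hβ.2 (Or.inr ⟨⟨hβ.1, h0⟩, κ, hκ, hc⟩)
    rcases hα with hα | ⟨hα, κ, hκ, hακ⟩
    · exact hβ0 α hα
    · have h1 := hβ0 _ (hrefl α hα.1 hα.2 κ hκ)
      rw [form_formReflection_left, hβ0 κ hκ, zero_sub, neg_eq_zero] at h1
      rw [hB.eq] at hακ
      exact (mul_eq_zero.1 h1).resolve_left
        (div_ne_zero (mul_ne_zero two_ne_zero hακ) hα.2)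

/-- The set of isotropic roots at distance at most two from ±α in the non-orthogonality graph is
closed under adjacency. For a path α, δ, κ, β without shortcuts, reflecting α in the anisotropic
root δ ± κ gives a common neighbour of α and β. -/
theorem exists_common_neighbour (hB : B.IsSymm) (hind : IsIndecomposable B Δ) {α β : V}
    (hα : α ∈ isoRoots B Δ) (hβ : β ∈ isoRoots B Δ) (hαβ : B α β = 0) (n : α ≠ β) (n' : α ≠ -β) :
    ∃ δ ∈ isoRoots B Δ, B δ α ≠ 0 ∧ B δ β ≠ 0 := by
  have symm : ∀ x y, B x y = B y x := fun x y => hB.eq x y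
  have key := hΔ.isoRoots_subset_of_closed hB hind
    (K := {β ∈ isoRoots B Δ | α = β ∨ α = -β ∨ B α β ≠ 0 ∨
      ∃ δ ∈ isoRoots B Δ, B δ α ≠ 0 ∧ B δ β ≠ 0}) (fun β hβ => hβ.1) ⟨α, hα, Or.inl rfl⟩
    (by
      rintro κ ⟨hκ, h⟩
      refine ⟨hΔ.neg_mem_iso hκ, ?_⟩
      rw [neg_neg, map_neg, neg_ne_zero]
      rcases h with h | h | h | ⟨δ, hδ, h1, h2⟩
      · exact Or.inr (Or.inl h)
      · exact Or.inl h
      · exact Or.inr (Or.inr (Or.inl h))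
      · exact Or.inr (Or.inr (Or.inr ⟨δ, hδ, h1, by simpa using h2⟩)))
    (by
      rintro κ ⟨hκ, h⟩ β hβ hκβ
      refine ⟨hβ, ?_⟩
      by_cases hαβ : B α β = 0
      swap
      · exact Or.inr (Or.inr (Or.inl hαβ))
      by_cases hακ : B α κ = 0
      swap
      · exact Or.inr (Or.inr (Or.inr ⟨κ, hκ, by rwa [symm], hκβ⟩))
      rcases h with h | h | h | ⟨δ, hδ, h1, h2⟩
      · exact absurd hαβ (h ▸ hκβ)
      · refine absurd hαβ ?_
        rw [h, map_neg, LinearMap.neg_apply, neg_eq_zero]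
        exact hκβ
      · exact absurd hακ h
      by_cases hδβ : B δ β = 0
      swap
      · exact Or.inr (Or.inr (Or.inr ⟨δ, hδ, h1, hδβ⟩))
      obtain ⟨ε, hε, hg⟩ := hΔ.exists_sign hκ hδ (by rwa [symm])
      have hgg := form_add_smul_ne hB hκ.2 hδ.2 (by rwa [symm]) hε
      have hε0 : ε ≠ 0 := by rcases hε with rfl | rfl <;> norm_num
      have hgα : B (δ + ε • κ) α = B δ α := by simp [symm κ α, hακ]
      have hgβ : B (δ + ε • κ) β = ε * B κ β := by simp [hδβ]
      refine Or.inr (Or.inr (Or.inr ⟨formReflection B _ hgg α,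
        hΔ.rootWeyl_mem_iso hB (formReflection_mem_rootWeyl hg hgg) hα, ?_, ?_⟩))
      · rw [form_formReflection_left, hα.2, zero_sub, hgα]
        exact neg_ne_zero.2 (mul_ne_zero (div_ne_zero (mul_ne_zero two_ne_zero h1) hgg) h1)
      · rw [form_formReflection_left, hαβ, zero_sub, hgα, hgβ]
        exact neg_ne_zero.2 (mul_ne_zero (div_ne_zero (mul_ne_zero two_ne_zero h1) hgg)
          (mul_ne_zero hε0 hκβ)))
  rcases (key hβ).2 with h | h | h | h
  · exact absurd h n
  · exact absurd h n'
  · exact absurd hαβ h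
  · exact h

/-- In an indecomposable system the stabilizer of an isotropic span acts transitively, up to
sign, on the isotropic roots outside the span and orthogonal to it. -/
theorem exists_map_outerRoots (hB : B.IsSymm) (hind : IsIndecomposable B Δ) {I : Submodule ℂ V}
    (hI : I ∈ isoSpans B Δ) {α β : V} (hα : α ∈ outerRoots B Δ I) (hβ : β ∈ outerRoots B Δ I) :
    ∃ w ∈ rootWeyl B Δ, I.map (w : V →ₗ[ℂ] V) = I ∧ (w α = β ∨ w α = -β) := by
  by_cases n : α = β
  · exact ⟨1, one_mem _, Submodule.map_id I, Or.inl n⟩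
  by_cases n' : α = -β
  · exact ⟨1, one_mem _, Submodule.map_id I, Or.inr n'⟩
  by_cases h : B α β = 0
  · obtain ⟨δ, hδ, hδα, hδβ⟩ := hΔ.exists_common_neighbour hB hind hα.1 hβ.1 h n n'
    obtain ⟨w, hw, hwα, hwσ⟩ := hΔ.exists_rootWeyl_swap hB hα.1 hβ.1 hδ h n n' hδα hδβ
    refine ⟨w, hw, map_eq_of_forall_eq fun x hx => ?_, hwα⟩
    have hle : I ≤ LinearMap.eqLocus (w : V →ₗ[ℂ] V) LinearMap.id := by
      conv_lhs => rw [← hI.2]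
      refine Submodule.span_le.2 ?_
      rintro σ ⟨hσ, hσI⟩
      refine hwσ σ (hα.2.1 σ hσI) (hβ.2.1 σ hσI) ?_
      by_contra hδσ
      have ne : ∀ {b : V}, b ∈ outerRoots B Δ I → b ≠ σ ∧ b ≠ -σ := fun hb =>
        ⟨fun e => hb.2.2 (e ▸ hσI), fun e => hb.2.2 (e ▸ I.neg_mem hσI)⟩
      exact hΔ.not_three_neighbours hB hα.1 hβ.1 hσ hδ h (hα.2.1 σ hσI) (hβ.2.1 σ hσI) n n'
        (ne hα).1 (ne hα).2 (ne hβ).1 (ne hβ).2 hδα hδβ hδσ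
    exact hle hx
  · obtain ⟨ε, hε, hg⟩ := hΔ.exists_sign hα.1 hβ.1 h
    have hgg := form_add_smul_ne hB hα.1.2 hβ.1.2 h hε
    refine ⟨_, formReflection_mem_rootWeyl hg hgg, map_eq_of_forall_eq fun x hx =>
      formReflection_of_orthogonal hgg ?_, ?_⟩
    · simp [hα.2.1 x hx, hβ.2.1 x hx]
    · rw [formReflection_add_smul_left hB hα.1.2 hβ.1.2 h hε hgg]
      rcases hε with rfl | rfl
      · exact Or.inr (by rw [one_smul])
      · exact Or.inl (by rw [neg_one_smul, neg_neg])

end IsWGRS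

end Indecomposable

end LagrangianRelations

namespace LagrangianRelations

universe u v

/-! ### Discriminants of the reductions and 1-regularity. -/

section OneRegular

variable {V : Type u} [AddCommGroup V] [Module ℂ V] {N : Type v} [AddCommGroup N] [Module ℂ N]
  {B : LinearMap.BilinForm ℂ V} {Δ : Set V}

theorem mem_orthogonal_of_mem_outerRoots (hB : B.IsSymm) {I : Submodule ℂ V} {β : V}
    (hβ : β ∈ outerRoots B Δ I) : β ∈ B.orthogonal I :=
  fun y hy => (hB.eq y β).trans (hβ.2.1 y hy)

theorem mem_firstProj {L : Submodule ℂ (V × V)} {x : V} :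
    x ∈ firstProj L ↔ ∃ y, (x, y) ∈ L := by
  constructor
  · rintro ⟨⟨x, y⟩, h, rfl⟩
    exact ⟨y, h⟩
  · rintro ⟨y, h⟩
    exact ⟨(x, y), h, rfl⟩

theorem translationRel_mem_rootComponents {w : V ≃ₗ[ℂ] V} (hw : w ∈ rootWeyl B Δ)
    {I : Submodule ℂ V} (hI : I ∈ isoSpans B Δ) : translationRel B w I ∈ rootComponents B Δ :=
  ⟨w, hw, I, hI, rfl⟩

namespace IsWGRS

variable (hΔ : IsWGRS B Δ) {I : Submodule ℂ V} {b : LinearMap.BilinForm ℂ N}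
  {π : B.orthogonal I →ₗ[ℂ] N}
include hΔ

theorem inducedRel_iff (hB : B.IsSymm) (p q : N) : inducedRel π (rootRel B Δ) p q ↔
    ∃ L ∈ inducedLinear π '' rootComponents B Δ, (p, q) ∈ L := by
  constructor
  · rintro ⟨x, y, rfl, rfl, h⟩
    obtain ⟨L, hL, hxy⟩ := (hΔ.rootRel_iff hB x y).1 h
    exact ⟨_, ⟨L, hL, rfl⟩, mem_inducedLinear.2 ⟨x, y, rfl, rfl, hxy⟩⟩
  · rintro ⟨_, ⟨L, hL, rfl⟩, h⟩
    obtain ⟨x, y, rfl, rfl, hxy⟩ := mem_inducedLinear.1 h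
    exact ⟨x, y, rfl, rfl, (hΔ.rootRel_iff hB x y).2 ⟨L, hL, hxy⟩⟩

variable (hI : I ∈ isoSpans B Δ) (hπ : IsReduction B I b π)
include hI hπ

omit hΔ in
-- Transitivity requires that two lifts of the same point are related; they differ by an element of
-- I.
theorem equivalence_inducedRel (hB : B.IsSymm) : Equivalence (inducedRel π (rootRel B Δ)) where
  refl p := by
    obtain ⟨x, rfl⟩ := hπ.surjective p
    exact ⟨x, x, rfl, rfl, .refl _⟩
  symm := by
    rintro _ _ ⟨x, y, rfl, rfl, h⟩
    exact ⟨y, x, rfl, rfl, h.symm _ _⟩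
  trans := by
    rintro _ _ _ ⟨x, y, rfl, rfl, h⟩ ⟨y', z, e, rfl, h'⟩
    have h1 := rootRel_add hB hI y.2 (hπ.sub_mem_of_map_eq e.symm)
    rw [add_sub_cancel] at h1
    exact ⟨x, z, rfl, rfl, h.trans _ _ _ (h1.trans _ _ _ h')⟩

omit hΔ in
theorem isLinearLagrangian_of_mem_image [FiniteDimensional ℂ V] (hB : B.IsSymm)
    (hnd : B.Nondegenerate) : ∀ L ∈ inducedLinear π '' rootComponents B Δ,
      IsLinearLagrangian b L := by
  rintro _ ⟨L, hL, rfl⟩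
  exact hπ.isLinearLagrangian_inducedLinear hB hnd hI.1 (IsWGRS.isLinearLagrangian_of_mem hB hnd hL)

theorem isLagrangianEquivalence_inducedRel [FiniteDimensional ℂ V] (hB : B.IsSymm)
    (hnd : B.Nondegenerate) : IsLagrangianEquivalence b (inducedRel π (rootRel B Δ)) :=
  ⟨equivalence_inducedRel hI hπ hB, _, isLinearLagrangian_of_mem_image hI hπ hB hnd,
    hΔ.inducedRel_iff hB⟩

theorem components_inducedRel [FiniteDimensional ℂ V] (hB : B.IsSymm) (hnd : B.Nondegenerate) :
    components b (inducedRel π (rootRel B Δ)) = inducedLinear π '' rootComponents B Δ :=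
  have := hπ.finiteDimensional
  components_eq ((hΔ.finite_rootComponents hB).image _)
    (isLinearLagrangian_of_mem_image hI hπ hB hnd) (hΔ.inducedRel_iff hB)

/-- The hyperplane is the image of the orthogonal complement of the isotropic span I + ℂβ, and the
component is induced by translations along that span. -/
theorem ker_mem_specialCoisotropic [FiniteDimensional ℂ V] (hB : B.IsSymm)
    (hnd : B.Nondegenerate) (β : B.orthogonal I) (hβ : (β : V) ∈ outerRoots B Δ I) :
    LinearMap.ker (b (π β)) ∈ specialCoisotropic b (inducedRel π (rootRel B Δ)) := by
  refine ⟨inducedLinear π (translationRel B 1 (I ⊔ Submodule.span ℂ {(β : V)})), ?_, ?_⟩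
  · rw [hΔ.components_inducedRel hI hπ hB hnd]
    exact ⟨_, translationRel_mem_rootComponents (one_mem _)
      (sup_mem_isoSpans hB hI hβ.1 hβ.2.1), rfl⟩
  · ext p
    rw [mem_firstProj, LinearMap.mem_ker]
    constructor
    · rintro ⟨q, hq⟩
      obtain ⟨x, y, rfl, rfl, h⟩ := mem_inducedLinear.1 hq
      rw [hπ.form_apply]
      exact (mem_translationRel.1 h).1 _ (Submodule.mem_sup_right
        (Submodule.mem_span_singleton_self _))
    · obtain ⟨x, rfl⟩ := hπ.surjective p
      intro hp
      rw [hπ.form_apply] at hp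
      refine ⟨π x, mem_inducedLinear.2 ⟨x, x, rfl, rfl, mem_translationRel.2
        ⟨?_, 0, zero_mem _, by simp⟩⟩⟩
      rw [orthogonal_sup]
      refine ⟨x.2, fun y hy => ?_⟩
      obtain ⟨c, rfl⟩ := Submodule.mem_span_singleton.1 hy
      change B (c • (β : V)) x = 0
      simp [hp]

/-- Off the hyperplanes of the outer roots, I is maximal for every lift of p. So J can be moved into
I by an element fixing the lift x, and afterwards the span v⁻¹(I), also orthogonal to the translated
lift, can be moved onto I. The correction puts the Weyl group element into the stabilizer of I. -/
theorem exists_mem_translationRel [FiniteDimensional ℂ V] (hB : B.IsSymm)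
    {L : Submodule ℂ (V × V)} (hL : L ∈ rootComponents B Δ) {p q : N}
    (hpq : (p, q) ∈ inducedLinear π L)
    (hp : ∀ β : B.orthogonal I, (β : V) ∈ outerRoots B Δ I → b (π β) p ≠ 0) :
    ∃ g ∈ rootWeyl B Δ, I.map (g : V →ₗ[ℂ] V) = I ∧
      (p, q) ∈ inducedLinear π (translationRel B g I) := by
  obtain ⟨x, y, rfl, rfl, h⟩ := mem_inducedLinear.1 hpq
  obtain ⟨w, hw, J, hJ, rfl⟩ := hL
  obtain ⟨hxJ, u, hu, hy⟩ := mem_translationRel.1 h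
  have hmax : ∀ z : V, z - x ∈ I → ∀ β ∈ isoRoots B Δ, B β z = 0 → (∀ y ∈ I, B β y = 0) →
      β ∈ I := by
    intro z hz β hβ hβz hβI
    by_contra hc
    have hβo : β ∈ outerRoots B Δ I := ⟨hβ, hβI, hc⟩
    refine hp ⟨β, mem_orthogonal_of_mem_outerRoots hB hβo⟩ hβo ?_
    rw [hπ.form_apply]
    have := hβI _ hz
    rw [map_sub, hβz, zero_sub, neg_eq_zero] at this
    exact this
  obtain ⟨w₁, hw₁, hw₁x, hw₁J⟩ := hΔ.exists_rootWeyl_map_le hB hI x.2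
    (hmax x (by simp)) hJ hxJ
  have hu' : w₁ u ∈ I := hw₁J ⟨u, hu, rfl⟩
  have hx' := orthogonal_add_mem hI.1 x.2 hu'
  have hyw : (y : V) = (w * w₁⁻¹) ((x : V) + w₁ u) := by
    have : w₁⁻¹ ((x : V) + w₁ u) = x + u := by
      rw [← hw₁x, ← map_add]
      change w₁.symm (w₁ (x + u)) = _
      rw [w₁.symm_apply_apply, hw₁x]
    rw [LinearEquiv.mul_apply, this, hy]
  have hv : w * w₁⁻¹ ∈ rootWeyl B Δ := mul_mem hw (inv_mem hw₁)
  set v := w * w₁⁻¹ with hv_def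
  have hxv : (x : V) + w₁ u ∈ B.orthogonal (I.map ((v⁻¹ : V ≃ₗ[ℂ] V) : V →ₗ[ℂ] V)) := by
    have h1 := rootWeyl_mem_orthogonal hB (inv_mem hv) y.2
    rw [hyw] at h1
    have h2 : v⁻¹ (v ((x : V) + w₁ u)) = x + w₁ u := v.symm_apply_apply _
    rwa [h2] at h1
  obtain ⟨w₂, hw₂, hw₂x, hw₂I⟩ := hΔ.exists_rootWeyl_map_le hB hI hx'
    (hmax _ (by rwa [add_sub_cancel_left])) (map_mem_isoSpans hΔ hB (inv_mem hv) hI) hxv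
  have hgI : I.map ((w₂ * v⁻¹ : V ≃ₗ[ℂ] V) : V →ₗ[ℂ] V) = I := by
    refine map_eq_of_map_le ?_
    have : I.map ((w₂ * v⁻¹ : V ≃ₗ[ℂ] V) : V →ₗ[ℂ] V) =
      (I.map ((v⁻¹ : V ≃ₗ[ℂ] V) : V →ₗ[ℂ] V)).map (w₂ : V →ₗ[ℂ] V) := Submodule.map_comp _ _ _
    rw [this]
    exact hw₂I
  have hw₂inv : w₂⁻¹ ((x : V) + w₁ u) = x + w₁ u := by
    conv_lhs => rw [← hw₂x]
    exact w₂.symm_apply_apply _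
  refine ⟨(w₂ * v⁻¹)⁻¹, inv_mem (mul_mem hw₂ (inv_mem hv)), map_inv_eq hgI,
    mem_inducedLinear.2 ⟨x, y, rfl, rfl, mem_translationRel.2 ⟨x.2, _, hu', ?_⟩⟩⟩
  rw [hyw, mul_inv_rev, inv_inv]
  exact (congrArg v hw₂inv).symm

omit hΔ hI in
theorem firstProj_inducedLinear_eq_top [FiniteDimensional ℂ V] (hB : B.IsSymm)
    {g : V ≃ₗ[ℂ] V} (hg : g ∈ rootWeyl B Δ) (hgI : I.map (g : V →ₗ[ℂ] V) = I) :
    firstProj (inducedLinear π (translationRel B g I)) = ⊤ := by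
  refine Submodule.eq_top_iff'.2 fun p => ?_
  obtain ⟨x, rfl⟩ := hπ.surjective p
  have hgx := rootWeyl_mem_orthogonal hB hg x.2
  rw [hgI] at hgx
  exact mem_firstProj.2 ⟨π ⟨g x, hgx⟩, mem_inducedLinear.2 ⟨x, ⟨g x, hgx⟩, rfl, rfl,
    mem_translationRel.2 ⟨x.2, 0, zero_mem _, by simp⟩⟩⟩

omit hΔ hI in
theorem apply_ne_zero_of_outerRoots [FiniteDimensional ℂ V] (hB : B.IsSymm)
    (hnd : B.Nondegenerate) (β : B.orthogonal I) (hβ : (β : V) ∈ outerRoots B Δ I) :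
    b (π β) ≠ 0 := by
  intro h
  refine hβ.2.2 ((hπ.apply_eq_zero_iff β).1 ((hπ.nondegenerate hB hnd).1 _ fun y => ?_))
  rw [h, LinearMap.zero_apply]

/-- By `exists_mem_translationRel` a component is covered by the relations from the stabilizer of I
and by the preimages of the outer hyperplanes, so it lies in one of these finitely many subspaces.
In the first case its projection is everything, in the second it lies in an outer hyperplane. -/
theorem discriminant_inducedRel [FiniteDimensional ℂ V] (hB : B.IsSymm) (hnd : B.Nondegenerate) :
    discriminant b (inducedRel π (rootRel B Δ)) =
      {p | ∃ β : B.orthogonal I, (β : V) ∈ outerRoots B Δ I ∧ b (π β) p = 0} := by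
  have hfd := hπ.finiteDimensional
  ext p
  constructor
  · rintro ⟨_, ⟨K, hK, rfl⟩, hne, hp⟩
    by_contra hc
    have hp0 : ∀ β : B.orthogonal I, (β : V) ∈ outerRoots B Δ I → b (π β) p ≠ 0 :=
      fun β hβ h0 => hc ⟨β, hβ, h0⟩
    have hKl := hK.1
    rw [hΔ.components_inducedRel hI hπ hB hnd] at hK
    obtain ⟨L, hL, rfl⟩ := hK
    let A₁ : Set (Submodule ℂ (N × N)) := {M | ∃ g ∈ rootWeyl B Δ,
      I.map (g : V →ₗ[ℂ] V) = I ∧ M = inducedLinear π (translationRel B g I)}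
    let A₂ : Set (Submodule ℂ (N × N)) := (fun β : B.orthogonal I =>
      (LinearMap.ker (b (π β))).comap (LinearMap.fst ℂ N N)) '' {β | (β : V) ∈ outerRoots B Δ I}
    have hA₁ : A₁.Finite := ((hΔ.finite_rootComponents hB).image (inducedLinear π)).subset (by
      rintro _ ⟨g, hg, -, rfl⟩
      exact ⟨_, translationRel_mem_rootComponents hg hI, rfl⟩)
    have hA₂ : A₂.Finite := ((hΔ.finite_outerRoots I).preimage
      Subtype.val_injective.injOn).image _
    obtain ⟨M, hM, hle⟩ := exists_le_of_finite_cover (A₁ ∪ A₂) (hA₁.union hA₂)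
      (inducedLinear π L) (by
        rintro ⟨p', q'⟩ hpq
        by_cases h0 : ∀ β : B.orthogonal I, (β : V) ∈ outerRoots B Δ I → b (π β) p' ≠ 0
        · obtain ⟨g, hg, hgI, hm⟩ := hΔ.exists_mem_translationRel hI hπ hB hL hpq h0
          exact ⟨_, Or.inl ⟨g, hg, hgI, rfl⟩, hm⟩
        · push Not at h0
          obtain ⟨β, hβ, h0⟩ := h0
          exact ⟨_, Or.inr ⟨β, hβ, rfl⟩, h0⟩)
    obtain ⟨q, hpq⟩ := mem_firstProj.1 hp
    rcases hM with ⟨g, hg, hgI, rfl⟩ | ⟨β, hβ, rfl⟩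
    · have hM := hπ.isLinearLagrangian_inducedLinear hB hnd hI.1
        (IsWGRS.isLinearLagrangian_of_mem hB hnd (translationRel_mem_rootComponents hg hI))
      rw [Submodule.eq_of_le_of_finrank_eq hle (hKl.2.trans hM.2.symm)] at hne
      exact hne (firstProj_inducedLinear_eq_top hπ hB hg hgI)
    · exact hp0 β hβ (hle hpq)
  · rintro ⟨β, hβ, hp⟩
    refine ⟨_, hΔ.ker_mem_specialCoisotropic hI hπ hB hnd β hβ, fun h => ?_, hp⟩
    exact IsWGRS.apply_ne_zero_of_outerRoots hπ hB hnd β hβ (LinearMap.ker_eq_top.1 h)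

end IsWGRS

/-- Applying s to the first coordinate of a component gives another component, because s is an
isometry and moves points within their classes. -/
theorem map_mem_specialCoisotropic {b : LinearMap.BilinForm ℂ N} {S : N → N → Prop}
    (hS : Equivalence S) {C : Submodule ℂ N} (hC : C ∈ specialCoisotropic b S) {s : N ≃ₗ[ℂ] N}
    (hs : s ∈ relWeyl b S) : C.map (s : N →ₗ[ℂ] N) ∈ specialCoisotropic b S := by
  obtain ⟨L, hL, rfl⟩ := hC
  have hsb : ∀ p q, b (s p) (s q) = b p q := fun p q =>
    (sub_eq_zero.1 (hs.1.1 (p, s p) (by simp) (q, s q) (by simp))).symm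
  have hmem : ∀ p, S p (s p) := fun p => hs.2 (p, s p) (by simp)
  refine ⟨L.map ((s : N →ₗ[ℂ] N).prodMap LinearMap.id), ⟨⟨?_, ?_⟩, ?_⟩, ?_⟩
  · rintro _ ⟨p, hp, rfl⟩ _ ⟨q, hq, rfl⟩
    have := hL.1.1 p hp q hq
    simpa [hsb] using this
  · rw [finrank_map_of_injective (Prod.map_injective.2 ⟨s.injective, Function.injective_id⟩),
      hL.1.2]
  · rintro _ ⟨p, hp, rfl⟩
    exact hS.trans (hS.symm (hmem p.1)) (hL.2 p hp)
  · ext p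
    rw [mem_firstProj]
    constructor
    · rintro ⟨q, ⟨⟨x, y⟩, h, e⟩⟩
      exact ⟨x, mem_firstProj.2 ⟨y, h⟩, (Prod.ext_iff.1 e).1⟩
    · rintro ⟨x, hx, rfl⟩
      obtain ⟨y, h⟩ := mem_firstProj.1 hx
      exact ⟨y, (x, y), h, rfl⟩

/-- The reductions of the relation of an indecomposable system are `1`-regular. -/
theorem IsWGRS.isOneRegular_inducedRel [FiniteDimensional ℂ V] (hΔ : IsWGRS B Δ)
    (hB : B.IsSymm) (hnd : B.Nondegenerate) (hind : IsIndecomposable B Δ) {I : Submodule ℂ V}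
    (hI : I ∈ isoSpans B Δ) {b : LinearMap.BilinForm ℂ N} {π : B.orthogonal I →ₗ[ℂ] N}
    (hπ : IsReduction B I b π) : IsOneRegular b (inducedRel π (rootRel B Δ)) := by
  have hfd := hπ.finiteDimensional
  have hdisc := hΔ.discriminant_inducedRel hI hπ hB hnd
  have hcomp := hΔ.components_inducedRel hI hπ hB hnd
  refine ⟨hΔ.isLagrangianEquivalence_inducedRel hI hπ hB hnd,
    hcomp ▸ (hΔ.finite_rootComponents hB).image _, ?_⟩
  by_cases hne : ∃ β : B.orthogonal I, (β : V) ∈ outerRoots B Δ I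
  swap
  · left
    rw [hdisc, Set.eq_empty_iff_forall_notMem]
    rintro p ⟨β, hβ, -⟩
    exact hne ⟨β, hβ⟩
  right
  obtain ⟨β, hβ⟩ := hne
  have hβ0 := IsWGRS.apply_ne_zero_of_outerRoots hπ hB hnd β hβ
  have hspec := hΔ.ker_mem_specialCoisotropic hI hπ hB hnd β hβ
  refine ⟨_, hspec, Module.Dual.finrank_ker_add_one_of_ne_zero hβ0, ?_⟩
  ext p
  constructor
  · rw [hdisc]
    rintro ⟨γ, hγ, hp⟩
    obtain ⟨w, hw, hwI, hwβ⟩ := hΔ.exists_map_outerRoots hB hind hI hβ hγ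
    obtain ⟨s, hs, hsπ⟩ := hπ.exists_isometry hB hnd (form_rootWeyl hB hw) hwI
    refine ⟨s, ?_, s.symm p, ?_, (s.apply_symm_apply p).symm⟩
    · have hmem := translationRel_mem_rootComponents hw hI
      have hlag := hπ.isLinearLagrangian_inducedLinear hB hnd hI.1
        (IsWGRS.isLinearLagrangian_of_mem hB hnd hmem)
      -- The graph is contained in the induced relation, and both have dimension dim N.
      have : (s : N →ₗ[ℂ] N).graph = inducedLinear π (translationRel B w I) := by
        refine Submodule.eq_of_le_of_finrank_eq ?_ ?_
        · rintro ⟨p, q⟩ hpq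
          have hq : q = s p := hpq
          obtain ⟨x, rfl⟩ := hπ.surjective p
          have hwx := rootWeyl_mem_orthogonal hB hw x.2
          rw [hwI] at hwx
          exact mem_inducedLinear.2 ⟨x, ⟨w x, hwx⟩, rfl, by rw [hq, hsπ x ⟨w x, hwx⟩ rfl],
            mem_translationRel.2 ⟨x.2, 0, zero_mem _, by simp⟩⟩
        · rw [hlag.2, LinearMap.graph_eq_range_prod]
          exact LinearMap.finrank_range_of_inj fun p q h => (Prod.ext_iff.1 h).1
      change (s : N →ₗ[ℂ] N).graph ∈ components b _
      rw [this, hcomp]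
      exact ⟨_, hmem, rfl⟩
    · rw [LinearMap.mem_ker, ← hs, s.apply_symm_apply]
      have hwβ' : w β ∈ B.orthogonal I := by
        rcases hwβ with h | h <;> rw [h]
        · exact γ.2
        · exact Submodule.neg_mem _ γ.2
      rw [hsπ β ⟨w β, hwβ'⟩ rfl]
      rcases hwβ with h | h
      · have : (⟨w β, hwβ'⟩ : B.orthogonal I) = γ := Subtype.ext h
        rw [this, hp]
      · have : (⟨w β, hwβ'⟩ : B.orthogonal I) = -γ := Subtype.ext h
        rw [this, map_neg, map_neg, LinearMap.neg_apply, hp, neg_zero]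
  · rintro ⟨s, hs, x, hx, rfl⟩
    refine ⟨_, map_mem_specialCoisotropic (IsWGRS.equivalence_inducedRel hI hπ hB) hspec hs,
      fun h => ?_, ⟨x, hx, rfl⟩⟩
    refine hβ0 (LinearMap.ker_eq_top.1 (Submodule.eq_top_iff'.2 fun y => ?_))
    obtain ⟨z, hz, e⟩ : s y ∈ (LinearMap.ker (b (π β))).map (s : N →ₗ[ℂ] N) := h ▸ trivial
    exact s.injective e ▸ hz

end OneRegular

end LagrangianRelations

namespace LagrangianRelations

universe u v

/-! ### Orthogonal decompositions, products and semiregularity. -/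

section Products

variable {V : Type u} [AddCommGroup V] [Module ℂ V] {N : Type v} [AddCommGroup N] [Module ℂ N]
  {B : LinearMap.BilinForm ℂ V} {Δ : Set V} {k : ℕ} {E : Fin k → Submodule ℂ V}

/-- The projections of a direct sum decomposition. -/
structure IsProjections (E : Fin k → Submodule ℂ V) (p : ∀ i, V →ₗ[ℂ] E i) : Prop where
  apply_coe : ∀ i (x : E i), p i x = x
  apply_of_ne : ∀ i j, i ≠ j → ∀ x ∈ E j, p i x = 0
  sum_apply : ∀ x, ∑ i, (p i x : V) = x

theorem exists_isProjections (hE : DirectSum.IsInternal E) :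
    ∃ p : ∀ i, V →ₗ[ℂ] E i, IsProjections E p := by
  classical
  let e := LinearEquiv.ofBijective (DirectSum.coeLinearMap E) hE
  have he : ∀ i (x : E i), e.symm x = DirectSum.lof ℂ (Fin k) (fun i => E i) i x := fun i x => by
    rw [LinearEquiv.symm_apply_eq]
    exact (DirectSum.coeLinearMap_lof E i x).symm
  let p : ∀ i, V →ₗ[ℂ] E i := fun i =>
    DirectSum.component ℂ (Fin k) (fun i => E i) i ∘ₗ (e.symm : V →ₗ[ℂ] _)
  have h1 : ∀ i (x : E i), p i x = x := fun i x => by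
    change DirectSum.component ℂ (Fin k) (fun i => E i) i (e.symm x) = x
    rw [he, DirectSum.component.lof_self]
  have h2 : ∀ i j, i ≠ j → ∀ x ∈ E j, p i x = 0 := fun i j hij x hx => by
    change DirectSum.component ℂ (Fin k) (fun i => E i) i (e.symm ((⟨x, hx⟩ : E j) : V)) = 0
    rw [he, DirectSum.component.of, dif_neg hij.symm]
  refine ⟨p, h1, h2, fun x => ?_⟩
  have h3 : x ∈ ⨆ i, E i := hE.submodule_iSup_eq_top ▸ Submodule.mem_top
  induction h3 using Submodule.iSup_induction' with
  | mem i x hx =>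
    rw [Finset.sum_eq_single i (fun j _ hj => by rw [h2 j i hj x hx]; rfl) (by simp)]
    exact congrArg _ (h1 i ⟨x, hx⟩)
  | zero => simp
  | add x y _ _ hx hy =>
    simp only [map_add, Submodule.coe_add, Finset.sum_add_distrib, hx, hy]

theorem IsProjections.apply_sum {p : ∀ i, V →ₗ[ℂ] E i} (hp : IsProjections E p)
    (a : ∀ i, E i) (i : Fin k) : p i (∑ j, (a j : V)) = a i := by
  rw [map_sum, Finset.sum_eq_single i (fun j _ hj => hp.apply_of_ne i j hj.symm _ (a j).2)
    (by simp), hp.apply_coe]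

/-- A vector in one summand and in the sum of the others is orthogonal to everything, hence zero. -/
theorem isInternal_of_orthogonal {b : LinearMap.BilinForm ℂ N} (hnd : b.Nondegenerate)
    {F : Fin k → Submodule ℂ N} (hF : ∀ i j, i ≠ j → ∀ x ∈ F i, ∀ y ∈ F j, b x y = 0)
    (hsum : ∀ p, ∃ a : ∀ i, F i, p = ∑ i, (a i : N)) : DirectSum.IsInternal F := by
  rw [DirectSum.isInternal_submodule_iff_iSupIndep_and_iSup_eq_top]
  constructor
  · rw [iSupIndep_def]
    intro i
    rw [Submodule.disjoint_def]
    intro x hx hx'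
    refine hnd.2 x fun z => ?_
    obtain ⟨a, rfl⟩ := hsum z
    rw [map_sum, LinearMap.sum_apply]
    refine Finset.sum_eq_zero fun j _ => ?_
    by_cases hij : j = i
    · subst hij
      have hle : ⨆ l, ⨆ (_ : l ≠ j), F l ≤ b.orthogonal (F j) :=
        iSup₂_le fun l hl y hy z hz => hF j l hl.symm z hz y hy
      exact hle hx' _ (a j).2
    · exact hF j i hij _ (a j).2 x hx
  · refine Submodule.eq_top_iff'.2 fun p => ?_
    obtain ⟨a, rfl⟩ := hsum p
    exact Submodule.sum_mem _ fun i _ => Submodule.mem_iSup_of_mem i (a i).2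

theorem nondegenerate_restrict_of_decomposition (hB : B.IsSymm) (hnd : B.Nondegenerate)
    (hE : IsOrthogonalDecomposition B E) (i : Fin k) : (B.restrict (E i)).Nondegenerate := by
  obtain ⟨p, hp⟩ := exists_isProjections hE.1
  refine nondegenerate_of_isSymm (fun x y => hB.eq (x : V) y) fun x hx => Subtype.ext ?_
  refine hnd.1 _ fun y => ?_
  rw [← hp.sum_apply y, map_sum]
  refine Finset.sum_eq_zero fun j _ => ?_
  by_cases hij : i = j
  · subst hij
    exact hx (p i y)
  · exact hE.2 i j hij _ x.2 _ (p j y).2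

theorem form_component (hE : IsOrthogonalDecomposition B E) {p : ∀ i, V →ₗ[ℂ] E i}
    (hp : IsProjections E p) (i : Fin k) {α : V} (hα : α ∈ E i) (x : V) :
    B α (p i x) = B α x := by
  conv_rhs => rw [← hp.sum_apply x, map_sum]
  exact (Finset.sum_eq_single i (fun j _ hj => hE.2 i j hj.symm α hα _ (p j x).2)
    (by simp)).symm

theorem IsWGRS.restrict (hΔ : IsWGRS B Δ) (E : Submodule ℂ V) :
    IsWGRS (B.restrict E) ((fun x : E => (x : V)) ⁻¹' Δ) where
  finite := hΔ.finite.preimage Subtype.val_injective.injOn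
  zero_notMem := hΔ.zero_notMem
  neg_mem α hα := hΔ.neg_mem α hα
  reflection α hα h β hβ := hΔ.reflection α hα h β hβ
  isotropic α hα h β hβ hαβ := hΔ.isotropic α hα h β hβ hαβ

theorem IsIndecomposable.restrict {E : Submodule ℂ V}
    (h : IsIndecomposable B (Δ ∩ (E : Set V))) :
    IsIndecomposable (B.restrict E) ((fun x : E => (x : V)) ⁻¹' Δ) := by
  rintro ⟨Δ₁, Δ₂, h1, h2, hd, he, hn1, hn2, ho⟩
  refine h ⟨Subtype.val '' Δ₁, Subtype.val '' Δ₂, h1.image _, h2.image _,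
    (Set.disjoint_image_iff Subtype.val_injective).2 hd, ?_, ?_, ?_, ?_⟩
  · rw [← Set.image_union, ← he]
    ext x
    constructor
    · exact fun hx => ⟨⟨x, hx.2⟩, hx.1, rfl⟩
    · rintro ⟨y, hy, rfl⟩
      exact ⟨hy, y.2⟩
  · rintro _ ⟨x, hx, rfl⟩
    exact ⟨-x, hn1 x hx, rfl⟩
  · rintro _ ⟨x, hx, rfl⟩
    exact ⟨-x, hn2 x hx, rfl⟩
  · rintro _ ⟨x, hx, rfl⟩ _ ⟨y, hy, rfl⟩
    exact ho x hx y hy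

/-- Reflections in roots of F are restrictions of reflections of V that fix the orthogonal
complement of F. -/
theorem exists_rootWeyl_extension {F : Submodule ℂ V} {w : F ≃ₗ[ℂ] F}
    (hw : w ∈ rootWeyl (B.restrict F) ((fun x : F => (x : V)) ⁻¹' Δ)) :
    ∃ w' ∈ rootWeyl B Δ, (∀ x : F, w' x = w x) ∧ ∀ z, (∀ y ∈ F, B y z = 0) → w' z = z := by
  refine rootWeyl_induction (p := fun w => ∃ w' ∈ rootWeyl B Δ, (∀ x : F, w' x = w x) ∧
    ∀ z, (∀ y ∈ F, B y z = 0) → w' z = z)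
    ⟨1, one_mem _, fun _ => rfl, fun _ _ => rfl⟩ ?_ ?_ hw
  · intro s t hs ht
    obtain ⟨s', hs', h1, h2⟩ := hs
    obtain ⟨t', ht', h3, h4⟩ := ht
    refine ⟨s' * t', mul_mem hs' ht', fun x => ?_, fun z hz => ?_⟩
    · rw [LinearEquiv.mul_apply, LinearEquiv.mul_apply, h3, h1]
    · rw [LinearEquiv.mul_apply, h4 z hz, h2 z hz]
  · intro α hα h
    have h' : B (α : V) α ≠ 0 := h
    refine ⟨formReflection B (α : V) h', formReflection_mem_rootWeyl (α := (α : V)) hα h',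
      fun x => ?_, fun z hz => formReflection_of_orthogonal h' (hz α α.2)⟩
    rw [formReflection_apply, formReflection_apply]
    rfl

theorem exists_rootWeyl_component (hE : IsOrthogonalDecomposition B E)
    (hΔE : ∀ α ∈ Δ, ∃ i, α ∈ E i) {p : ∀ i, V →ₗ[ℂ] E i} (hp : IsProjections E p) (i : Fin k)
    {w : V ≃ₗ[ℂ] V} (hw : w ∈ rootWeyl B Δ) :
    ∃ w' ∈ rootWeyl (B.restrict (E i)) ((fun x : E i => (x : V)) ⁻¹' Δ),
      ∀ x, p i (w x) = w' (p i x) := by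
  refine rootWeyl_induction (p := fun w => ∃ w' ∈ rootWeyl (B.restrict (E i))
    ((fun x : E i => (x : V)) ⁻¹' Δ), ∀ x, p i (w x) = w' (p i x))
    ⟨1, one_mem _, fun _ => rfl⟩ ?_ ?_ hw
  · intro s t hs ht
    obtain ⟨s', hs', h1⟩ := hs
    obtain ⟨t', ht', h2⟩ := ht
    refine ⟨s' * t', mul_mem hs' ht', fun x => ?_⟩
    rw [LinearEquiv.mul_apply, LinearEquiv.mul_apply, h1, h2]
  · intro α hα h
    obtain ⟨j, hj⟩ := hΔE α hα
    by_cases hij : i = j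
    · subst hij
      have h' : B.restrict (E i) ⟨α, hj⟩ ⟨α, hj⟩ ≠ 0 := h
      refine ⟨formReflection (B.restrict (E i)) ⟨α, hj⟩ h',
        formReflection_mem_rootWeyl (show (⟨α, hj⟩ : E i) ∈ _ from hα) h', fun x => ?_⟩
      have h1 : p i α = ⟨α, hj⟩ := hp.apply_coe i ⟨α, hj⟩
      have h2 : B.restrict (E i) ⟨α, hj⟩ (p i x) = B α x := form_component hE hp i hj x
      have h3 : B.restrict (E i) ⟨α, hj⟩ ⟨α, hj⟩ = B α α := rfl
      rw [formReflection_apply, formReflection_apply, map_sub, map_smul, h1, h2, h3]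
    · refine ⟨1, one_mem _, fun x => ?_⟩
      rw [formReflection_apply, map_sub, map_smul, hp.apply_of_ne i j hij α hj, smul_zero, sub_zero]
      rfl

theorem rootRel_add_of_restrict {F : Submodule ℂ V} {x y : F}
    (h : rootRel (B.restrict F) ((fun x : F => (x : V)) ⁻¹' Δ) x y) {z : V}
    (hz : ∀ y ∈ F, B y z = 0) (hz' : ∀ y ∈ F, B z y = 0) :
    rootRel B Δ ((x : V) + z) ((y : V) + z) := by
  induction h with
  | rel x y h =>
    rcases h with ⟨w, hw, rfl⟩ | ⟨α, hα, hα0, hx, c, rfl⟩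
    · obtain ⟨w', hw', h1, h2⟩ := exists_rootWeyl_extension hw
      have := IsWGRS.rootRel_rootWeyl hw' ((x : V) + z)
      rwa [map_add, h1, h2 z hz] at this
    · refine .rel _ _ (Or.inr ⟨α, hα, hα0, ?_, c, ?_⟩)
      · have hx' : B (x : V) α = 0 := hx
        rw [map_add, LinearMap.add_apply, hx', hz' α α.2, add_zero]
      · rw [Submodule.coe_add, Submodule.coe_smul]
        abel
  | refl => exact .refl _
  | symm _ _ _ h => exact h.symm _ _
  | trans _ _ _ _ _ h1 h2 => exact h1.trans _ _ _ h2

theorem rootRel_component (hB : B.IsSymm) (hE : IsOrthogonalDecomposition B E)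
    (hΔE : ∀ α ∈ Δ, ∃ i, α ∈ E i) {p : ∀ i, V →ₗ[ℂ] E i} (hp : IsProjections E p) (i : Fin k)
    {x y : V} (h : rootRel B Δ x y) :
    rootRel (B.restrict (E i)) ((fun x : E i => (x : V)) ⁻¹' Δ) (p i x) (p i y) := by
  induction h with
  | rel x y h =>
    rcases h with ⟨w, hw, rfl⟩ | ⟨α, hα, hα0, hx, c, rfl⟩
    · obtain ⟨w', hw', h1⟩ := exists_rootWeyl_component hE hΔE hp i hw
      rw [h1]
      exact IsWGRS.rootRel_rootWeyl hw' _
    · obtain ⟨j, hj⟩ := hΔE α hα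
      by_cases hij : i = j
      · subst hij
        refine .rel _ _ (Or.inr ⟨⟨α, hj⟩, hα, hα0, ?_, c, ?_⟩)
        · change B (p i x : V) α = 0
          rw [hB.eq, form_component hE hp i hj x, hB.eq, hx]
        · rw [map_add, map_smul]
          exact congrArg _ (congrArg _ (hp.apply_coe i ⟨α, hj⟩))
      · rw [map_add, map_smul, hp.apply_of_ne i j hij α hj, smul_zero, add_zero]
        exact .refl _
  | refl => exact .refl _
  | symm _ _ _ h => exact h.symm _ _
  | trans _ _ _ _ _ h1 h2 => exact h1.trans _ _ _ h2

theorem rootRel_sum (hE : IsOrthogonalDecomposition B E) (x y : ∀ i, E i)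
    (h : ∀ i, rootRel (B.restrict (E i)) ((fun x : E i => (x : V)) ⁻¹' Δ) (x i) (y i)) :
    rootRel B Δ (∑ i, (x i : V)) (∑ i, (y i : V)) := by
  classical
  -- The coordinates are changed one at a time; s contains those in which x and y may still differ.
  have key : ∀ (s : Finset (Fin k)) (x : ∀ i, E i), (∀ i, rootRel (B.restrict (E i))
      ((fun x : E i => (x : V)) ⁻¹' Δ) (x i) (y i)) → (∀ i ∉ s, x i = y i) →
      rootRel B Δ (∑ i, (x i : V)) (∑ i, (y i : V)) := by
    intro s
    induction s using Finset.induction_on with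
    | empty =>
      intro x _ hx
      rw [funext fun i => hx i (Finset.notMem_empty i)]
      exact .refl _
    | insert a s ha ih =>
      intro x h hx
      have h1 := ih (Function.update x a (y a)) (fun i => by
        by_cases hi : i = a
        · subst hi
          rw [Function.update_self]
          exact .refl _
        · rw [Function.update_of_ne hi]
          exact h i) (fun i hi => by
        by_cases hia : i = a
        · subst hia
          rw [Function.update_self]
        · rw [Function.update_of_ne hia]
          exact hx i (by simp [hia, hi]))
      refine .trans _ _ _ ?_ h1
      rw [← Finset.add_sum_erase _ _ (Finset.mem_univ a),
        ← Finset.add_sum_erase _ (fun i => (Function.update x a (y a) i : V)) (Finset.mem_univ a),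
        Function.update_self]
      have h2 : ∑ i ∈ Finset.univ.erase a, (Function.update x a (y a) i : V) =
          ∑ i ∈ Finset.univ.erase a, (x i : V) :=
        Finset.sum_congr rfl fun i hi => by rw [Function.update_of_ne (Finset.ne_of_mem_erase hi)]
      rw [h2]
      refine rootRel_add_of_restrict (h a) (fun z hz => ?_) fun z hz => ?_
      · rw [map_sum]
        exact Finset.sum_eq_zero fun i hi =>
          hE.2 a i (Finset.ne_of_mem_erase hi).symm z hz _ (x i).2
      · rw [map_sum, LinearMap.sum_apply]
        exact Finset.sum_eq_zero fun i hi =>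
          hE.2 i a (Finset.ne_of_mem_erase hi) _ (x i).2 z hz
  exact key Finset.univ x h fun i hi => absurd (Finset.mem_univ i) hi

/-- Each root lies in a single summand, so its components are itself and zeros. Consequently an
isotropic span is the direct sum of its intersections with the summands. -/
theorem component_mem_span (hΔE : ∀ α ∈ Δ, ∃ i, α ∈ E i) {p : ∀ i, V →ₗ[ℂ] E i}
    (hp : IsProjections E p) (i : Fin k) {I : Submodule ℂ V} (hI : I ∈ isoSpans B Δ) {x : V}
    (hx : x ∈ I) : p i x ∈ Submodule.span ℂ (isoRoots (B.restrict (E i))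
      ((fun x : E i => (x : V)) ⁻¹' Δ) ∩ (I.comap (E i).subtype : Submodule ℂ (E i))) := by
  rw [← hI.2] at hx
  have hle : isoRoots B Δ ∩ I ⊆ (Submodule.span ℂ (isoRoots (B.restrict (E i))
      ((fun x : E i => (x : V)) ⁻¹' Δ) ∩
        (I.comap (E i).subtype : Submodule ℂ (E i)))).comap (p i) := by
    rintro α ⟨hα, hαI⟩
    obtain ⟨j, hj⟩ := hΔE α hα.1
    rw [SetLike.mem_coe, Submodule.mem_comap]
    by_cases hij : i = j
    · subst hij
      have h1 : p i α = ⟨α, hj⟩ := hp.apply_coe i ⟨α, hj⟩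
      rw [h1]
      exact Submodule.subset_span ⟨⟨hα.1, hα.2⟩, hαI⟩
    · rw [hp.apply_of_ne i j hij α hj]
      exact zero_mem _
  exact Submodule.span_le.2 hle hx

theorem comap_mem_isoSpans (hΔE : ∀ α ∈ Δ, ∃ i, α ∈ E i) {p : ∀ i, V →ₗ[ℂ] E i}
    (hp : IsProjections E p) (i : Fin k) {I : Submodule ℂ V} (hI : I ∈ isoSpans B Δ) :
    I.comap (E i).subtype ∈ isoSpans (B.restrict (E i)) ((fun x : E i => (x : V)) ⁻¹' Δ) := by
  refine ⟨fun x hx y hy => hI.1 x hx y hy, le_antisymm ?_ fun x hx => ?_⟩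
  · exact Submodule.span_le.2 fun x hx => hx.2
  · have := component_mem_span (B := B) hΔE hp i hI hx
    rwa [Submodule.subtype_apply, hp.apply_coe] at this

theorem component_mem (hΔE : ∀ α ∈ Δ, ∃ i, α ∈ E i) {p : ∀ i, V →ₗ[ℂ] E i}
    (hp : IsProjections E p) (i : Fin k) {I : Submodule ℂ V} (hI : I ∈ isoSpans B Δ) {x : V}
    (hx : x ∈ I) : (p i x : V) ∈ I :=
  (comap_mem_isoSpans hΔE hp i hI).2.le (component_mem_span hΔE hp i hI hx)

theorem mem_orthogonal_of_restrict (hB : B.IsSymm) (hE : IsOrthogonalDecomposition B E)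
    (hΔE : ∀ α ∈ Δ, ∃ i, α ∈ E i) {p : ∀ i, V →ₗ[ℂ] E i} (hp : IsProjections E p) {i : Fin k}
    {I : Submodule ℂ V} (hI : I ∈ isoSpans B Δ) {x : E i}
    (hx : x ∈ (B.restrict (E i)).orthogonal (I.comap (E i).subtype)) :
    (x : V) ∈ B.orthogonal I := by
  intro y hy
  have h1 : B (p i y : V) x = 0 := hx (p i y) (component_mem hΔE hp i hI hy)
  change B y x = 0
  rw [hB.eq, ← form_component hE hp i x.2, hB.eq, h1]

theorem component_mem_orthogonal (hE : IsOrthogonalDecomposition B E)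
    {p : ∀ i, V →ₗ[ℂ] E i} (hp : IsProjections E p) (i : Fin k) {I : Submodule ℂ V} {x : V} (hx : x ∈ B.orthogonal I) :
    p i x ∈ (B.restrict (E i)).orthogonal (I.comap (E i).subtype) := by
  intro y hy
  have h1 : B (y : V) x = 0 := hx y hy
  change B (y : V) (p i x) = 0
  rw [form_component hE hp i y.2, h1]

/-- The images F_i of I^⊥ ∩ E_i decompose N orthogonally, and F_i is the reduction of E_i by I ∩
E_i, to which the indecomposable case applies. The relation is tested coordinatewise on lifts. -/
theorem isOneSemiregular_inducedRel [FiniteDimensional ℂ V] (hΔ : IsWGRS B Δ) (hB : B.IsSymm)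
    (hnd : B.Nondegenerate) (hcomp : HasOrthogonalComponents B Δ) {I : Submodule ℂ V}
    (hI : I ∈ isoSpans B Δ) {b : LinearMap.BilinForm ℂ N} {π : B.orthogonal I →ₗ[ℂ] N}
    (hπ : IsReduction B I b π) : IsOneSemiregular b (inducedRel π (rootRel B Δ)) := by
  obtain ⟨k, E, hE, hΔE, hind⟩ := hcomp
  obtain ⟨p, hp⟩ := exists_isProjections hE.1
  let F : Fin k → Submodule ℂ N := fun i => ((E i).comap (B.orthogonal I).subtype).map π
  have hmem : ∀ i (x : E i), x ∈ (B.restrict (E i)).orthogonal (I.comap (E i).subtype) →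
      (x : V) ∈ B.orthogonal I := fun i x hx => mem_orthogonal_of_restrict hB hE hΔE hp hI hx
  let ι : ∀ i, (B.restrict (E i)).orthogonal (I.comap (E i).subtype) →ₗ[ℂ] B.orthogonal I :=
    fun i => LinearMap.codRestrict _ ((E i).subtype ∘ₗ Submodule.subtype _)
      fun x => hmem i x x.2
  let ρ : ∀ i, (B.restrict (E i)).orthogonal (I.comap (E i).subtype) →ₗ[ℂ] F i :=
    fun i => LinearMap.codRestrict _ (π ∘ₗ ι i) fun x => ⟨ι i x, (x : E i).2, rfl⟩
  have hρ : ∀ i x, (ρ i x : N) = π (ι i x) := fun i x => rfl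
  have hred : ∀ i, IsReduction (B.restrict (E i)) (I.comap (E i).subtype) (b.restrict (F i))
      (ρ i) := by
    refine fun i => ⟨?_, fun x => ?_, fun x y => hπ.form_apply (ι i x) (ι i y)⟩
    · rintro ⟨_, x, hx, rfl⟩
      refine ⟨⟨⟨x, hx⟩, fun y hy => x.2 y hy⟩, rfl⟩
    · exact Subtype.ext_iff.trans (hπ.apply_eq_zero_iff (ι i x))
  have hF : ∀ i j, i ≠ j → ∀ x ∈ F i, ∀ y ∈ F j, b x y = 0 := by
    rintro i j hij _ ⟨x, hx, rfl⟩ _ ⟨y, hy, rfl⟩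
    rw [hπ.form_apply]
    exact hE.2 i j hij x hx y hy
  let c : ∀ i, B.orthogonal I → (B.restrict (E i)).orthogonal (I.comap (E i).subtype) :=
    fun i x => ⟨p i x, component_mem_orthogonal hE hp i x.2⟩
  have hsum : ∀ x, π x = ∑ i, (ρ i (c i x) : N) := by
    intro x
    simp only [hρ]
    rw [← map_sum]
    congr 1
    ext
    rw [Submodule.coe_sum]
    exact (hp.sum_apply x).symm
  have hFint : DirectSum.IsInternal F := by
    refine isInternal_of_orthogonal (hπ.nondegenerate hB hnd) hF fun q => ?_
    obtain ⟨x, rfl⟩ := hπ.surjective q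
    exact ⟨_, hsum x⟩
  obtain ⟨r, hr⟩ := exists_isProjections hFint
  have hcoord : ∀ (x : B.orthogonal I) (a : ∀ i, F i), π x = ∑ i, (a i : N) →
      ∀ i, ρ i (c i x) = a i := by
    intro x a h i
    rw [hsum x] at h
    rw [← hr.apply_sum (fun i => ρ i (c i x)) i, h, hr.apply_sum]
  refine ⟨k, F, ⟨hFint, hF⟩, fun i => inducedRel (ρ i)
    (rootRel (B.restrict (E i)) ((fun x : E i => (x : V)) ⁻¹' Δ)), fun i => ?_, fun a a' => ?_⟩
  · exact (hΔ.restrict (E i)).isOneRegular_inducedRel ⟨fun x y => hB.eq (x : V) y⟩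
      (nondegenerate_restrict_of_decomposition hB hnd hE i) (hind i).restrict
      (comap_mem_isoSpans hΔE hp i hI) (hred i)
  · constructor
    · rintro ⟨x, y, hx, hy, h⟩ i
      exact ⟨c i x, c i y, hcoord x a hx i, hcoord y a' hy i,
        rootRel_component hB hE hΔE hp i h⟩
    · intro h
      choose x y hx hy hxy using h
      refine ⟨∑ i, ι i (x i), ∑ i, ι i (y i), ?_, ?_, ?_⟩
      · rw [map_sum]
        exact Finset.sum_congr rfl fun i _ => congrArg Subtype.val (hx i)
      · rw [map_sum]
        exact Finset.sum_congr rfl fun i _ => congrArg Subtype.val (hy i)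
      · rw [Submodule.coe_sum, Submodule.coe_sum]
        exact rootRel_sum hE (fun i => (x i : E i)) (fun i => (y i : E i)) hxy

theorem isReduction_subquotient [FiniteDimensional ℂ V] (hB : B.IsSymm) (hnd : B.Nondegenerate)
    (I : Submodule ℂ V) : IsReduction B I (reducedForm B hB (B.orthogonal I))
      (radicalIn B (B.orthogonal I)).mkQ where
  surjective := Submodule.mkQ_surjective _
  apply_eq_zero_iff x := by
    rw [Submodule.mkQ_apply, Submodule.Quotient.mk_eq_zero]
    change (x : V) ∈ B.orthogonal (B.orthogonal I) ↔ _
    rw [LinearMap.BilinForm.orthogonal_orthogonal hnd hB.isRefl I]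
  form_apply _ _ := rfl

theorem IsWGRS.isSemiregular_rootRel [FiniteDimensional ℂ V] (hΔ : IsWGRS B Δ) (hB : B.IsSymm)
    (hnd : B.Nondegenerate) (hcomp : HasOrthogonalComponents B Δ) :
    IsSemiregular B hB (rootRel B Δ) := by
  refine ⟨hΔ.isLagrangianEquivalence_rootRel hB hnd, ?_⟩
  rintro _ ⟨L, hL, rfl⟩
  rw [hΔ.components_rootRel hB hnd] at hL
  obtain ⟨w, -, I, hI, rfl⟩ := hL
  rw [firstProj_translationRel]
  exact isOneSemiregular_inducedRel hΔ hB hnd hcomp hI (isReduction_subquotient hB hnd I)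

end Products

end LagrangianRelations

theorem mainTheorem3 {V : Type*} [AddCommGroup V] [Module ℂ V] [FiniteDimensional ℂ V]
    (B : LinearMap.BilinForm ℂ V) (hB : B.IsSymm) (hnd : B.Nondegenerate)
    (Δ : Set V) (hΔ : LagrangianRelations.IsWGRS B Δ) :
    LagrangianRelations.IsLagrangianEquivalence B (LagrangianRelations.rootRel B Δ) ∧
    (LagrangianRelations.components B (LagrangianRelations.rootRel B Δ)).Finite ∧
    (LagrangianRelations.HasOrthogonalComponents B Δ →
      LagrangianRelations.IsSemiregular B hB (LagrangianRelations.rootRel B Δ)) ∧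
    LagrangianRelations.IsDetectable (LagrangianRelations.rootRel B Δ) ∧
    (∀ m : Ideal (LagrangianRelations.invariantRing (LagrangianRelations.rootRel B Δ)),
      m.IsMaximal →
        ∃ v : V, m = LagrangianRelations.pointIdeal (LagrangianRelations.rootRel B Δ) v) ∧
    (∀ v w : V,
      LagrangianRelations.pointIdeal (LagrangianRelations.rootRel B Δ) v =
          LagrangianRelations.pointIdeal (LagrangianRelations.rootRel B Δ) w ↔
        LagrangianRelations.rootRel B Δ v w) := by
  refine ⟨hΔ.isLagrangianEquivalence_rootRel hB hnd, ?_, ?_, hΔ.isDetectable_rootRel hB hnd,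
    hΔ.exists_eq_pointIdeal hB hnd, hΔ.pointIdeal_eq_iff hB hnd⟩
  · rw [hΔ.components_rootRel hB hnd]
    exact hΔ.finite_rootComponents hB
  · exact hΔ.isSemiregular_rootRel hB hnd
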